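/- **Theorem 5 (Higher-order equivalence of ETEL to EL).** Let $x_1,x_2,\dots$ be random vectors and let $g(x,\theta)\in\mathbb R^{N_g}$ be a (jointly measurable) vector of moment functions, $\theta\in\Theta\subset\mathbb R^{N_\theta}$. For a sample $x_1,\dots,x_n$ and $\theta\in\Theta$ let $\hat w^{\mathrm{EL}}(\theta)$ and $\hat w^{\mathrm{ET}}(\theta)$ be the weights $(w_1,\dots,w_n)$ that minimize, respectively, $n^{-1}\sum_{i=1}^n -\ln(nw_i)$ over $w_i>0$, and $n^{-1}\sum_{i=1}^n nw_i\ln(nw_i)$ over $w_i\ge 0$ (with $0\ln 0=0$), subject to $$\sum_{i=1}^n w_i\,g(x_i,\theta)=0,\qquad \sum_{i=1}^n w_i=1 .$$ Let $\hat\theta_{\mathrm{EL}}$ be a minimizer over $\theta\in\Theta$ of $n^{-1}\sum_i-\ln\big(n\hat w^{\mathrm{EL}}_i(\theta)\big)$ and $\hat\theta_{\mathrm{ETEL}}$ a minimizer over $\theta\in\Theta$ of $n^{-1}\sum_i-\ln\big(n\hat w^{\mathrm{ET}}_i(\theta)\big)$, whenever such minimizers exist (arbitrary otherwise); an objective counts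 as $+\infty$ at those $\theta$ at which the weights do not exist or are not all positive. Write $G(x,\theta)=\partial g(x,\theta)/\partial\theta'$, and suppose that, for some $\theta^*$ and some open neighborhood $\mathcal N$ of $\theta^*$: 1. $x_i$ forms an i.i.d. sequence; 2. $\Theta$ is compact, $\theta^*\in\operatorname{int}(\Theta)$, and $\theta^*$ is the unique solution in $\Theta$ of $E[g(x_i,\theta)]=0$; 3. for each $\theta\in\Theta$, with probability one $g(x_i,\cdot)$ is continuous at $\theta$ (as a function on $\Theta$); 4. $E[\sup_{\theta\in\Theta}\|g(x_i,\theta)\|^{2+\delta}]<\infty$ for some $\delta>0$, and $E[\sup_{\theta\in\mathcal N}\|G(x_i,\theta)\|]<\infty$; 5. $E[g(x_i,\theta^*)g(x_i,\theta^*)']$ is finite and nonsingular, and $E[G(x_i,\theta^*)]$ has rank $N_\theta$; 6. with probability one, $g(x_i,\cdot)$ is continuously differentiable on $\mathcal N$; 7. $E[\sup_{\theta\in\mathcal N}\|g(x_i,\theta)\|^4]<\infty$ and $E[\sup_{\theta\in\mathcal N}\|G(x_i,\theta)\|^2]<\infty$; 8. there is a function $b$ with $E[|b(x_i)|]<\infty$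 such that, with probability one, $\|G(x_i,\theta_1)-G(x_i,\theta_2)\|\le b(x_i)\|\theta_1-\theta_2\|$ for all $\theta_1,\theta_2\in\mathcal N$. Then $\hat\theta_{\mathrm{ETEL}}-\hat\theta_{\mathrm{EL}}=O_p(n^{-3/2})$ as $n\to\infty$, that is, for every $\varepsilon>0$ there is $C$ such that $P\big(\|\hat\theta_{\mathrm{ETEL}}-\hat\theta_{\mathrm{EL}}\|>Cn^{-3/2}\big)\le\varepsilon$ for all sufficiently large $n$. -/

import Mathlib

open MeasureTheory ProbabilityTheory Filter Topology
open scoped ENNReal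

noncomputable section

/-- `ℝ^k` with its Euclidean norm. -/
abbrev Vec (k : ℕ) : Type := EuclideanSpace ℝ (Fin k)

/-! ### Discrepancies, weights and estimators -/

/-- The empirical likelihood discrepancy `-ln t`, as a function of `t = n w`. -/
def hEL (t : ℝ) : ℝ := -Real.log t

/-- The exponential tilting discrepancy `t ln t`, as a function of `t = n w`
(with `0 ln 0 = 0`). -/
def hET (t : ℝ) : ℝ := t * Real.log t

/-- The empirical discrepancy `n⁻¹ ∑ᵢ h(n wᵢ)`. -/
def discrepancy {n : ℕ} (h : ℝ → ℝ) (w : Fin n → ℝ) : ℝ :=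
  (n : ℝ)⁻¹ * ∑ i, h (n * w i)

/-- Weights with values in `D` satisfying the moment constraint `∑ᵢ wᵢ yᵢ = 0` and the
normalization `∑ᵢ wᵢ = 1`. Here `yᵢ` stands for `g(xᵢ, θ)`, and `D` is the set on which the
discrepancy in use is defined. -/
def weightSet {n m : ℕ} (D : Set ℝ) (y : Fin n → Vec m) : Set (Fin n → ℝ) :=
  {w | (∀ i, w i ∈ D) ∧ ∑ i, w i • y i = 0 ∧ ∑ i, w i = 1}

/-- `w` solves the minimum discrepancy problem for `h`, whose domain is `D`. -/
def IsMinDiscrepancyWeights {n m : ℕ} (D : Set ℝ) (h : ℝ → ℝ) (y : Fin n → Vec m)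
    (w : Fin n → ℝ) : Prop :=
  w ∈ weightSet D y ∧ IsMinOn (discrepancy h) (weightSet D y) w

/-- The empirical likelihood weights. -/
def IsELWeights {n m : ℕ} (y : Fin n → Vec m) (w : Fin n → ℝ) : Prop :=
  IsMinDiscrepancyWeights (Set.Ioi 0) hEL y w

/-- The exponential tilting weights. -/
def IsETWeights {n m : ℕ} (y : Fin n → Vec m) (w : Fin n → ℝ) : Prop :=
  IsMinDiscrepancyWeights (Set.Ici 0) hET y w

/-- `θ` minimizes over `Θ` the discrepancy `n⁻¹ ∑ᵢ -ln(n ŵᵢ(θ))`, where `ŵ(θ)` is the solution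
of the inner problem `IsSol`. The minimum runs over the `θ` at which this objective is defined
and finite, that is, at which the inner problem has a solution with positive weights. -/
def IsLogEstimator {k m n : ℕ} (IsSol : (Fin n → Vec m) → (Fin n → ℝ) → Prop)
    (Θ : Set (Vec k)) (y : Vec k → Fin n → Vec m) (θ : Vec k) : Prop :=
  θ ∈ Θ ∧ ∃ w, IsSol (y θ) w ∧ (∀ i, 0 < w i) ∧
    ∀ θ' ∈ Θ, ∀ w', IsSol (y θ') w' → (∀ i, 0 < w' i) →
      discrepancy hEL w ≤ discrepancy hEL w'

/-- `θ` is an empirical likelihood estimate for the sample `x 0, …, x (n - 1)`. -/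
def IsELEstimate {X : Type*} {k m : ℕ} (g : X → Vec k → Vec m) (Θ : Set (Vec k))
    (n : ℕ) (x : ℕ → X) (θ : Vec k) : Prop :=
  IsLogEstimator (n := n) IsELWeights Θ (fun θ i => g (x i) θ) θ

/-- `θ` is an exponentially tilted empirical likelihood estimate for the sample
`x 0, …, x (n - 1)`. -/
def IsETELEstimate {X : Type*} {k m : ℕ} (g : X → Vec k → Vec m) (Θ : Set (Vec k))
    (n : ℕ) (x : ℕ → X) (θ : Vec k) : Prop :=
  IsLogEstimator (n := n) IsETWeights Θ (fun θ i => g (x i) θ) θ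

/-! ### Regularity conditions -/

/-- The Jacobian `G(x, θ) = ∂g(x, θ)/∂θ'`. -/
def jac {X : Type*} {k m : ℕ} (g : X → Vec k → Vec m) (x : X) (θ : Vec k) :
    Vec k →L[ℝ] Vec m :=
  fderiv ℝ (g x) θ

/-- `E[G(x, θ)]` for `x` with law `P`. -/
def meanJac {X : Type*} [MeasurableSpace X] {k m : ℕ} (P : Measure X)
    (g : X → Vec k → Vec m) (θ : Vec k) : Vec k →L[ℝ] Vec m :=
  ∫ x, jac g x θ ∂P

/-- `Ω(θ) = E[g(x, θ) g(x, θ)']` for `x` with law `P`. -/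
def momentMatrix {X : Type*} [MeasurableSpace X] {k m : ℕ} (P : Measure X)
    (g : X → Vec k → Vec m) (θ : Vec k) : Matrix (Fin m) (Fin m) ℝ :=
  Matrix.of fun a b => ∫ x, g x θ a * g x θ b ∂P

/-- The first-order regularity conditions on the moment function `g`, the parameter set `Θ`, the
true value `θs` and the neighborhood `N` of `θs`, for observations with law `P`. -/
structure Regular {X : Type*} [MeasurableSpace X] {k m : ℕ} (P : Measure X)
    (g : X → Vec k → Vec m) (Θ N : Set (Vec k)) (θs : Vec k) : Prop where
  measurable : Measurable (Function.uncurry g)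
  isCompact : IsCompact Θ
  mem_interior : θs ∈ interior Θ
  moment_eq_zero : ∫ x, g x θs ∂P = 0
  unique : ∀ θ ∈ Θ, ∫ x, g x θ ∂P = 0 → θ = θs
  continuous : ∀ θ ∈ Θ, ∀ᵐ x ∂P, ContinuousWithinAt (g x) Θ θ
  moment_bound : ∃ δ : ℝ, 0 < δ ∧ ∫⁻ x, ⨆ θ ∈ Θ, ‖g x θ‖ₑ ^ (2 + δ) ∂P < ∞
  isOpen : IsOpen N
  mem_nhd : θs ∈ N
  contDiff : ∀ᵐ x ∂P, ContDiffOn ℝ 1 (g x) N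
  jac_bound : ∫⁻ x, ⨆ θ ∈ N, ‖jac g x θ‖ₑ ∂P < ∞
  finite_var : ∀ a b, Integrable (fun x => g x θs a * g x θs b) P
  nonsingular : (momentMatrix P g θs).det ≠ 0
  rank_eq : Module.finrank ℝ (LinearMap.range (meanJac P g θs).toLinearMap) = k

/-! ### Stochastic order -/

/-- `Y n = O_p(a n)`: for every `ε > 0` there is `C` with `P(‖Y n‖ > C a n) ≤ ε` for all large
`n`. For sets that are not measurable, `μ` is the outer measure. -/
def IsBigOInProbability {Ω : Type*} [MeasurableSpace Ω] {k : ℕ} (μ : Measure Ω)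
    (Y : ℕ → Ω → Vec k) (a : ℕ → ℝ) : Prop :=
  ∀ ε : ℝ, 0 < ε → ∃ C : ℝ, ∀ᶠ n in atTop,
    μ {ω | C * a n < ‖Y n ω‖} ≤ ENNReal.ofReal ε

end

/-! All randomness is confined to the event that the sample is a `GoodSample`. For large `n` it has
probability at least `1 - ε`, and on it the bound is deterministic.

Write `yᵢ = g(xᵢ, θ)`. Both inner problems are solved by weights proportional to `τ(λ'yᵢ)`, with
`τ(t) = 1/(1+t)` for EL and `τ(t) = exp(-t)` for ET, where `λ` solves `avg τ(λ'y) y = 0`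
(`isELWeights_iff`, `isETWeights_iff`, abstracted in `IsTilting`). At `θs` the log-discrepancy is
`O(1/n)`. By weak duality such a level forces the average moment to be `O(n^{-1/2})`; identification
and the rank condition then place `θ` within `O(n^{-1/2})` of `θs`. This gives existence of both
estimates and the rate `n^{-1/2}` for them and their tilting parameters
(`GoodSample.exists_isLogEstimator`). Fourth moments keep `λ'yᵢ` small uniformly in `i`.

The estimates are interior, so Lagrange's rule applies. The EL pair `(θ₁, λ₁)` solves `avg (1+λ'y)⁻¹
y = 0` and `avg (1+λ'y)⁻¹ G'λ = 0`. For ETEL the constraint on the tilting parameter `λ₂` brings in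
a genuine multiplier `ν` (`exists_multiplier_of_ETEL`). The decisive point is that `(θ₂, ν)`, rather
than `(θ₂, λ₂)`, nearly solves the EL equations: `ν - λ₂ = O(1/n)`, and subtracting the ETEL
equations cancels all terms of first and second order, which leaves `O(n^{-3/2})`
(`exists_bound_EL_residual`).

Near `(θs, 0)` the EL equations are a small perturbation of the system `(v, u) ↦ (Γv - Ωu, Γ'u)`,
with `Γ` the mean Jacobian and `Ω` the second moment operator. It is invertible because `Γ` is
injective and `Ω` positive definite (`exists_bound_of_linearized`). The perturbation is a small
multiple of the distance between `(θ₂, ν)` and `(θ₁, λ₁)`, so it is absorbed, and that distance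
inherits the order of the residual. -/

noncomputable section

/-! ### Suprema over uncountable parameter sets -/

section Analytic

lemma isCompact_setOf_forall_le (k : ℕ → ℕ) : IsCompact {x : ℕ → ℕ | ∀ i, x i ≤ k i} := by
  have h := isCompact_univ_pi (X := fun _ : ℕ => ℕ) (s := fun i => Set.Iic (k i))
    fun i => (Set.finite_Iic (k i)).isCompact
  convert h using 1
  ext x
  simp [Pi.le_def]

/-- A neighbourhood of a box `{x | ∀ i, x i ≤ k i}` of the Baire space contains a box in which
only finitely many coordinates are bounded. -/
lemma exists_box_subset_of_isOpen {V : Set (ℕ → ℕ)} (hV : IsOpen V) (k : ℕ → ℕ)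
    (hkV : {x : ℕ → ℕ | ∀ i, x i ≤ k i} ⊆ V) :
    ∃ n, {x : ℕ → ℕ | ∀ i < n, x i ≤ k i} ⊆ V := by
  by_contra! hcon
  have hC := isCompact_setOf_forall_le k
  have hex : ∀ n, ∃ x : ℕ → ℕ, (∀ i < n, x i ≤ k i) ∧ x ∉ V := fun n => by
    obtain ⟨x, hx, hxV⟩ := Set.not_subset.1 (hcon n)
    exact ⟨x, hx, hxV⟩
  choose x hx hxV using hex
  -- Truncating at `k` moves the counterexamples into the compact box. Coordinate `i` of the `n`-th
  -- one is unchanged once `n > i`, so the untruncated subsequence has the same limit.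
  obtain ⟨y, hy, φ, hφ, hlim⟩ := hC.tendsto_subseq (x := fun n i => min (x n i) (k i))
    (fun n i => min_le_right _ _)
  have hlim' : Tendsto (fun n => x (φ n)) atTop (𝓝 y) := by
    rw [tendsto_pi_nhds] at hlim ⊢
    intro i
    refine (hlim i).congr' ?_
    filter_upwards [hφ.tendsto_atTop.eventually_gt_atTop i] with n hn
    exact min_eq_left (hx (φ n) i hn)
  obtain ⟨n, hn⟩ := (hlim'.eventually_mem (hV.mem_nhds (hkV hy))).exists
  exact hxV _ hn

/-- Analytic sets are inner regular with respect to compact sets. -/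
lemma MeasureTheory.AnalyticSet.exists_isCompact_subset {α : Type*} [TopologicalSpace α]
    [MeasurableSpace α] [BorelSpace α] {μ : Measure α} [IsFiniteMeasure μ]
    [μ.OuterRegular] {s : Set α} (hs : AnalyticSet s) {ε : ℝ≥0∞} (hε : ε ≠ 0) :
    ∃ K ⊆ s, IsCompact K ∧ μ s ≤ μ K + ε := by
  rw [AnalyticSet] at hs
  rcases hs with rfl | ⟨f, hf, rfl⟩
  · exact ⟨∅, subset_rfl, isCompact_empty, by simp⟩
  -- `δ n` is the measure that may be lost when the `n`-th coordinate is capped.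
  obtain ⟨δ, hδ, hδε⟩ := ENNReal.exists_pos_sum_of_countable' hε ℕ
  have step : ∀ (B : Set (ℕ → ℕ)) (n : ℕ), ∃ j : ℕ,
      μ (f '' B) ≤ μ (f '' (B ∩ {x | x n ≤ j})) + δ n := by
    intro B n
    have hmono : Monotone fun j : ℕ => f '' (B ∩ {x | x n ≤ j}) := by
      intro i j hij
      refine Set.image_mono (Set.inter_subset_inter_right _ fun x hx => ?_)
      exact le_trans (show x n ≤ i from hx) hij
    have hU : ⋃ j : ℕ, f '' (B ∩ {x | x n ≤ j}) = f '' B := by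
      rw [← Set.image_iUnion, ← Set.inter_iUnion]
      congr 1
      refine Set.inter_eq_left.2 fun x _ => Set.mem_iUnion.2 ⟨x n, by simp⟩
    have hsup := hmono.measure_iUnion (μ := μ)
    rw [hU] at hsup
    by_cases h0 : μ (f '' B) = 0
    · exact ⟨0, by simp [h0]⟩
    have hlt : μ (f '' B) - δ n < μ (f '' B) :=
      ENNReal.sub_lt_self (measure_ne_top _ _) h0 (hδ n).ne'
    conv_rhs at hlt => rw [hsup]
    obtain ⟨j, hj⟩ := lt_iSup_iff.1 hlt
    exact ⟨j, tsub_le_iff_right.1 hj.le⟩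
  choose J hJ using step
  let B : ℕ → Set (ℕ → ℕ) := fun n =>
    Nat.rec Set.univ (fun n B => B ∩ {x | x n ≤ J B n}) n
  have hBsucc : ∀ n, B (n + 1) = B n ∩ {x | x n ≤ J (B n) n} := fun n => rfl
  let k : ℕ → ℕ := fun n => J (B n) n
  have hB : ∀ n, B n = {x | ∀ i < n, x i ≤ k i} := by
    intro n
    induction n with
    | zero => ext x; simp [B]
    | succ n ih =>
      rw [hBsucc, ih]
      ext x
      simp only [Set.mem_inter_iff, Set.mem_ofPred_eq, Nat.lt_succ_iff_lt_or_eq]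
      constructor
      · rintro ⟨h1, h2⟩ i (hi | rfl)
        · exact h1 i hi
        · rw [← ih] at h2; exact h2
      · intro h
        refine ⟨fun i hi => h i (Or.inl hi), ?_⟩
        rw [← ih]
        exact h n (Or.inr rfl)
  have hmeas : ∀ n, μ (Set.range f) ≤ μ (f '' B n) + ∑ i ∈ Finset.range n, δ i := by
    intro n
    induction n with
    | zero => simp [B]
    | succ n ih =>
      rw [Finset.sum_range_succ, hBsucc]
      calc _ ≤ _ := ih
        _ ≤ _ := add_le_add_left (hJ (B n) n) _
        _ = _ := by ring
  have hC := isCompact_setOf_forall_le k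
  refine ⟨f '' {x | ∀ i, x i ≤ k i}, Set.image_subset_range _ _, hC.image hf, ?_⟩
  -- Only the finite stages `B n` are controlled in measure. Outer regularity reduces to an open `U`
  -- around the compact image, and the preimage of `U` already contains some `B n`.
  rw [Set.measure_eq_iInf_isOpen (f '' {x | ∀ i, x i ≤ k i}) μ]
  simp only [ENNReal.iInf_add]
  refine le_iInf₂ fun U hU => le_iInf fun hUo => ?_
  obtain ⟨n, hn⟩ := exists_box_subset_of_isOpen (hUo.preimage hf) k
    (Set.image_subset_iff.1 hU)
  refine (hmeas n).trans (add_le_add (measure_mono ?_) ?_)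
  · rw [hB]; exact Set.image_subset_iff.2 hn
  · exact (ENNReal.sum_le_tsum _).trans hδε.le

/-- Analytic sets are universally measurable. -/
lemma MeasureTheory.AnalyticSet.nullMeasurableSet {α : Type*} [TopologicalSpace α] [T2Space α]
    [MeasurableSpace α] [BorelSpace α] {μ : Measure α} [IsFiniteMeasure μ]
    [μ.OuterRegular] {s : Set α} (hs : AnalyticSet s) : NullMeasurableSet s μ := by
  choose K hKs hK hle using fun n : ℕ =>
    hs.exists_isCompact_subset (μ := μ) (ENNReal.inv_ne_zero.2 (ENNReal.natCast_ne_top n))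
  have hm : MeasurableSet (⋃ n, K n) := .iUnion fun n => (hK n).measurableSet
  refine hm.nullMeasurableSet.congr ?_
  refine ae_eq_of_subset_of_measure_ge (Set.iUnion_subset hKs) ?_ hm.nullMeasurableSet
    (measure_ne_top _ _)
  have h : ∀ n : ℕ, μ s ≤ μ (⋃ n, K n) + (n : ℝ≥0∞)⁻¹ := fun n =>
    (hle n).trans (add_le_add_left (measure_mono (Set.subset_iUnion K n)) _)
  have hlim := tendsto_const_nhds (x := μ (⋃ n, K n)).add ENNReal.tendsto_inv_nat_nhds_zero
  rw [add_zero] at hlim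
  exact ge_of_tendsto' hlim h

/-- The supremum over a measurable parameter set of a jointly measurable function is
almost everywhere measurable. -/
lemma aemeasurable_biSup_of_measurable {X Y : Type*} [MeasurableSpace X] [StandardBorelSpace X]
    [MeasurableSpace Y] [StandardBorelSpace Y] {μ : Measure X} [IsFiniteMeasure μ]
    {f : X → Y → ℝ≥0∞} (hf : Measurable (Function.uncurry f)) {s : Set Y}
    (hs : MeasurableSet s) : AEMeasurable (fun x => ⨆ y ∈ s, f x y) μ := by
  let := upgradeStandardBorel X
  let : MetricSpace X := TopologicalSpace.metrizableSpaceMetric X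
  have hnull : NullMeasurable (fun x => ⨆ y ∈ s, f x y) μ := by
    refine measurable_of_Ioi (α := ℝ≥0∞) (δ := NullMeasurableSpace X μ) fun a => ?_
    -- A superlevel set of the supremum is the projection of a measurable set, hence analytic.
    have hset : (fun x => ⨆ y ∈ s, f x y) ⁻¹' Set.Ioi a
        = Prod.fst '' ({p : X × Y | a < Function.uncurry f p} ∩ Prod.snd ⁻¹' s) := by
      ext x
      simp only [Set.mem_preimage, Set.mem_Ioi, lt_iSup_iff, Set.mem_image, Set.mem_inter_iff,
        Set.mem_ofPred_eq, Prod.exists, exists_and_right, exists_eq_right,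
        Function.uncurry_apply_pair]
      exact exists_congr fun y => ⟨fun ⟨h1, h2⟩ => ⟨h2, h1⟩, fun ⟨h1, h2⟩ => ⟨h2, h1⟩⟩
    have hA : AnalyticSet ((fun x => ⨆ y ∈ s, f x y) ⁻¹' Set.Ioi a) := by
      rw [hset]
      exact ((measurableSet_lt measurable_const hf).inter
        (measurable_snd hs)).analyticSet_image measurable_fst
    exact hA.nullMeasurableSet (μ := μ)
  exact hnull.aemeasurable

end Analytic

/-! ### Sample averages -/

/-- The average `n⁻¹ ∑ᵢ fᵢ`. -/
def avg {n : ℕ} {E : Type*} [AddCommGroup E] [Module ℝ E] (f : Fin n → E) : E :=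
  (n : ℝ)⁻¹ • ∑ i, f i

section Average

variable {n : ℕ} {E F : Type*} [NormedAddCommGroup E] [NormedSpace ℝ E]
  [NormedAddCommGroup F] [NormedSpace ℝ F]

lemma avg_add (f h : Fin n → E) : avg (fun i => f i + h i) = avg f + avg h := by
  simp [avg, Finset.sum_add_distrib]

lemma avg_sub (f h : Fin n → E) : avg (fun i => f i - h i) = avg f - avg h := by
  simp [avg, Finset.sum_sub_distrib, smul_sub]

lemma avg_neg (f : Fin n → E) : avg (fun i => - f i) = - avg f := by
  simp [avg]

lemma avg_smul (c : ℝ) (f : Fin n → E) : avg (fun i => c • f i) = c • avg f := by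
  simp [avg, ← Finset.smul_sum, smul_comm c]

lemma avg_mul_left (c : ℝ) (f : Fin n → ℝ) : avg (fun i => c * f i) = c * avg f :=
  avg_smul c f

lemma avg_mul_right (c : ℝ) (f : Fin n → ℝ) : avg (fun i => f i * c) = avg f * c := by
  simp only [mul_comm _ c, avg_mul_left]

lemma avg_const (hn : n ≠ 0) (c : E) : avg (fun _ : Fin n => c) = c := by
  have : (n : ℝ) ≠ 0 := by exact_mod_cast hn
  rw [avg, Finset.sum_const, Finset.card_univ, Fintype.card_fin, ← Nat.cast_smul_eq_nsmul ℝ,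
    smul_smul, inv_mul_cancel₀ this, one_smul]

lemma map_avg (L : E →L[ℝ] F) (f : Fin n → E) : L (avg f) = avg fun i => L (f i) := by
  simp [avg]

lemma inner_avg {m : ℕ} (v : Vec m) (f : Fin n → Vec m) :
    inner ℝ v (avg f) = avg fun i => inner ℝ v (f i) :=
  map_avg (innerSL ℝ v) f

lemma avg_apply (f : Fin n → E →L[ℝ] F) (v : E) : avg f v = avg fun i => f i v := by
  simp [avg]

lemma avg_mono {f h : Fin n → ℝ} (hfh : ∀ i, f i ≤ h i) : avg f ≤ avg h := by
  simp only [avg, smul_eq_mul]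
  gcongr
  exact hfh _

lemma avg_nonneg {f : Fin n → ℝ} (hf : ∀ i, 0 ≤ f i) : 0 ≤ avg f := by
  simp only [avg, smul_eq_mul]
  exact mul_nonneg (by positivity) (Finset.sum_nonneg fun i _ => hf i)

lemma avg_pos (hn : n ≠ 0) {f : Fin n → ℝ} (hf : ∀ i, 0 < f i) : 0 < avg f := by
  have : NeZero n := ⟨hn⟩
  have h := Finset.sum_pos (fun i _ => hf i) ⟨(0 : Fin n), Finset.mem_univ _⟩
  simp only [avg, smul_eq_mul]
  positivity

lemma continuousOn_avg {Z : Type*} [TopologicalSpace Z] {f : Fin n → Z → E} {s : Set Z}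
    (hf : ∀ i, ContinuousOn (f i) s) : ContinuousOn (fun z => avg fun i => f i z) s := by
  have h : ContinuousOn (fun z => ∑ i, f i z) s := continuousOn_finsetSum _ fun i _ => hf i
  exact h.const_smul (n : ℝ)⁻¹

lemma norm_avg_le (f : Fin n → E) : ‖avg f‖ ≤ avg fun i => ‖f i‖ := by
  simp only [avg, norm_smul, smul_eq_mul, norm_inv, Real.norm_natCast]
  gcongr
  exact norm_sum_le _ _

lemma norm_avg_le_of_le {f : Fin n → E} {h : Fin n → ℝ} (hfh : ∀ i, ‖f i‖ ≤ h i) :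
    ‖avg f‖ ≤ avg h :=
  (norm_avg_le f).trans (avg_mono hfh)

lemma sum_eq_mul_avg (hn : n ≠ 0) (f : Fin n → ℝ) : ∑ i, f i = n * avg f := by
  have : (n : ℝ) ≠ 0 := by exact_mod_cast hn
  simp [avg, mul_inv_cancel_left₀ this]

lemma le_mul_avg {f : Fin n → ℝ} (hf : ∀ i, 0 ≤ f i) (i : Fin n) : f i ≤ n * avg f := by
  rw [← sum_eq_mul_avg (by have := i.2; omega)]
  exact Finset.single_le_sum (fun j _ => hf j) (Finset.mem_univ i)

end Average

/-! ### Events whose probability tends to one -/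

/-- `p n` holds with probability approaching one, in the sense that the outer measure of its
complement tends to zero. -/
def HoldsWPA {S : Type*} [MeasurableSpace S] (μ : Measure S) (p : ℕ → S → Prop) : Prop :=
  Tendsto (fun n => μ {s | ¬ p n s}) atTop (𝓝 0)

section WPA

variable {S : Type*} [MeasurableSpace S] {μ : Measure S} {p q : ℕ → S → Prop}

lemma HoldsWPA.mono (hp : HoldsWPA μ p) (h : ∀ᶠ n in atTop, ∀ᵐ s ∂μ, p n s → q n s) :
    HoldsWPA μ q := by
  refine tendsto_of_tendsto_of_tendsto_of_le_of_le' tendsto_const_nhds hp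
    (Eventually.of_forall fun _ => zero_le) ?_
  filter_upwards [h] with n hn
  refine measure_mono_ae ?_
  filter_upwards [hn] with s hs hq hp
  exact hq (hs hp)

lemma HoldsWPA.and (hp : HoldsWPA μ p) (hq : HoldsWPA μ q) :
    HoldsWPA μ fun n s => p n s ∧ q n s := by
  have h := Tendsto.add hp hq
  rw [add_zero] at h
  refine tendsto_of_tendsto_of_tendsto_of_le_of_le tendsto_const_nhds h
    (fun _ => zero_le) fun n => ?_
  refine (measure_mono fun s hs => ?_).trans (measure_union_le _ _)
  by_cases h : p n s
  · exact Or.inr fun hq => hs ⟨h, hq⟩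
  · exact Or.inl h

lemma HoldsWPA.of_forall (h : ∀ n, ∀ᵐ s ∂μ, p n s) : HoldsWPA μ p := by
  have : (fun n => μ {s | ¬ p n s}) = fun _ => 0 := funext fun n => h n
  rw [HoldsWPA, this]
  exact tendsto_const_nhds

lemma HoldsWPA.eventually_measure_le {p : ℕ → S → Prop} (hp : HoldsWPA μ p) {ε : ℝ}
    (hε : 0 < ε) : ∀ᶠ n in atTop, μ {s | ¬ p n s} ≤ ENNReal.ofReal ε :=
  hp.eventually_le_const (ENNReal.ofReal_pos.2 hε)

end WPA

/-! ### Laws of large numbers -/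

section Sample

variable {S X : Type*} [MeasurableSpace S] [MeasurableSpace X] {μ : Measure S}
  {P : Measure X} {x : ℕ → S → X}

lemma ae_forall_sample (x_law : ∀ i, HasLaw (x i) P μ) {p : X → Prop} (hp : ∀ᵐ z ∂P, p z) :
    ∀ᵐ s ∂μ, ∀ i, p (x i s) := by
  rw [ae_all_iff]
  intro i
  rw [← (x_law i).map_eq] at hp
  exact ae_of_ae_map (x_law i).aemeasurable hp

variable [IsProbabilityMeasure μ]

/-- The weak law of large numbers for functions of an i.i.d. sequence. -/
lemma holdsWPA_norm_avg_sub_integral_lt {E : Type*} [NormedAddCommGroup E] [NormedSpace ℝ E]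
    [CompleteSpace E] (x_indep : iIndepFun x μ) (x_law : ∀ i, HasLaw (x i) P μ)
    {f : X → E} (hf : Integrable f P) {δ : ℝ} (hδ : 0 < δ) :
    HoldsWPA μ fun n s => ‖avg (fun i : Fin n => f (x i s)) - ∫ z, f z ∂P‖ < δ := by
  borelize E
  have hmap : ∀ i, AEStronglyMeasurable f (μ.map (x i)) := fun i => by
    rw [(x_law i).map_eq]; exact hf.1
  have hmeas : ∀ i, AEStronglyMeasurable (fun s => f (x i s)) μ := fun i =>
    (hmap i).comp_aemeasurable (x_law i).aemeasurable
  have hident : ∀ i, IdentDistrib (fun s => f (x i s)) (fun s => f (x 0 s)) μ μ := fun i => by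
    have h : IdentDistrib (x i) (x 0) μ μ :=
      ⟨(x_law i).aemeasurable, (x_law 0).aemeasurable, by
        rw [(x_law i).map_eq, (x_law 0).map_eq]⟩
    exact h.comp_of_aemeasurable (hmap i).aemeasurable
  have hint : Integrable (fun s => f (x 0 s)) μ := by
    have h := hf
    rw [← (x_law 0).map_eq] at h
    exact h.comp_aemeasurable (x_law 0).aemeasurable
  have hindep : Pairwise fun i j => IndepFun (fun s => f (x i s)) (fun s => f (x j s)) μ :=
    fun i j hij => (x_indep.indepFun hij).comp₀ (x_law i).aemeasurable (x_law j).aemeasurable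
      (hmap i).aemeasurable (hmap j).aemeasurable
  have hlim := strong_law_ae (fun i s => f (x i s)) hint hindep hident
  have havg : ∀ n : ℕ, AEStronglyMeasurable
      (fun s => (n : ℝ)⁻¹ • ∑ i ∈ Finset.range n, f (x i s)) μ := fun n =>
    (Finset.aestronglyMeasurable_fun_sum _ fun i _ => hmeas i).const_smul _
  have htim := tendstoInMeasure_iff_norm.1 (tendstoInMeasure_of_tendsto_ae havg hlim) δ hδ
  have hE : ∫ s, f (x 0 s) ∂μ = ∫ z, f z ∂P := (x_law 0).integral_comp hf.1
  simp only [hE] at htim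
  refine htim.congr fun n => ?_
  simp only [avg, Finset.sum_range, not_lt]

/-- Chebyshev's inequality for averages of a centred square integrable function of an i.i.d.
sequence. -/
lemma exists_measure_lt_abs_avg_le (x_indep : iIndepFun x μ) (x_law : ∀ i, HasLaw (x i) P μ)
    {f : X → ℝ} (hf : MemLp f 2 P) (hf0 : ∫ z, f z ∂P = 0) {ε : ℝ} (hε : 0 < ε) :
    ∃ C : ℝ, 0 < C ∧ ∀ n : ℕ,
      μ {s | C / √n < |avg fun i : Fin n => f (x i s)|} ≤ ENNReal.ofReal ε := by
  have hmap : ∀ i, AEStronglyMeasurable f (μ.map (x i)) := fun i => by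
    rw [(x_law i).map_eq]; exact hf.1
  have hLp : ∀ i, MemLp (fun s => f (x i s)) 2 μ := fun i => by
    have h := hf
    rw [← (x_law i).map_eq] at h
    exact h.comp_of_map (x_law i).aemeasurable
  have hindep : Pairwise fun i j => IndepFun (fun s => f (x i s)) (fun s => f (x j s)) μ :=
    fun i j hij => (x_indep.indepFun hij).comp₀ (x_law i).aemeasurable (x_law j).aemeasurable
      (hmap i).aemeasurable (hmap j).aemeasurable
  have hE : ∀ i, ∫ s, f (x i s) ∂μ = 0 := fun i => by
    rw [← hf0]; exact (x_law i).integral_comp hf.1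
  have hvar : ∀ i, variance (fun s => f (x i s)) μ = variance (fun s => f (x 0 s)) μ := fun i => by
    rw [variance_eq_integral (hLp i).1.aemeasurable, variance_eq_integral (hLp 0).1.aemeasurable,
      hE, hE]
    have hm : AEStronglyMeasurable (fun z => (f z - 0) ^ 2) P :=
      (hf.1.sub aestronglyMeasurable_const).pow 2
    exact ((x_law i).integral_comp hm).trans ((x_law 0).integral_comp hm).symm
  set σ := variance (fun s => f (x 0 s)) μ
  have hσ : 0 ≤ σ := variance_nonneg _ _
  -- The sum has variance `n σ` and is compared with `C √n`, so Chebyshev gives `σ / C²`. The `+ 1`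
  -- keeps `C` positive when `σ = 0`.
  refine ⟨√((σ + 1) / ε), by positivity, fun n => ?_⟩
  rcases Nat.eq_zero_or_pos n with rfl | hn
  · simp [avg]
  have hn' : (0 : ℝ) < n := by exact_mod_cast hn
  have hsum : MemLp (∑ i : Fin n, fun s => f (x i s)) 2 μ := memLp_finsetSum' _ fun i _ => hLp i
  have hc : 0 < √((σ + 1) / ε) * √n := by positivity
  have hcheb := meas_ge_le_variance_div_sq hsum hc
  have hEsum : ∫ s, (∑ i : Fin n, fun s => f (x i s)) s ∂μ = 0 := by
    simp only [Finset.sum_apply]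
    rw [integral_finsetSum _ fun (i : Fin n) _ => (hLp i).integrable one_le_two]
    simp [hE]
  rw [hEsum, IndepFun.variance_sum (fun (i : Fin n) _ => hLp i) (fun i _ j _ hij => hindep (by
    intro h; exact hij (Fin.ext h)))] at hcheb
  simp only [hvar, Finset.sum_const, Finset.card_univ, Fintype.card_fin, nsmul_eq_mul] at hcheb
  refine (measure_mono fun s hs => ?_).trans (hcheb.trans (ENNReal.ofReal_le_ofReal ?_))
  · simp only [Set.mem_ofPred_eq, avg, smul_eq_mul, abs_mul, abs_inv, Nat.abs_cast] at hs
    simp only [Set.mem_ofPred_eq, Finset.sum_apply, sub_zero]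
    rw [inv_mul_eq_div, div_lt_div_iff₀ (by positivity) hn'] at hs
    have h2 : √((σ + 1) / ε) * √n * √n < |∑ i : Fin n, f (x i s)| * √n := by
      rwa [mul_assoc, Real.mul_self_sqrt hn'.le]
    exact (lt_of_mul_lt_mul_right h2 (by positivity)).le
  · rw [mul_pow, Real.sq_sqrt (by positivity), Real.sq_sqrt hn'.le, div_le_iff₀ (by positivity)]
    have : ε * ((σ + 1) / ε * n) = (σ + 1) * n := by field_simp
    rw [this]
    nlinarith

end Sample

/-! ### Integrable envelopes -/

section Envelope

variable {X : Type*} [MeasurableSpace X] [StandardBorelSpace X] {P : Measure X}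
  [IsFiniteMeasure P]

/-- A jointly measurable function whose supremum has a finite integral has an integrable
envelope. -/
lemma exists_integrable_envelope {Y : Type*} [MeasurableSpace Y] [StandardBorelSpace Y]
    {f : X → Y → ℝ≥0∞} (hf : Measurable (Function.uncurry f)) {s : Set Y}
    (hs : MeasurableSet s) (hfin : ∫⁻ z, ⨆ y ∈ s, f z y ∂P ≠ ∞) :
    ∃ e : X → ℝ, (∀ z, 0 ≤ e z) ∧ Integrable e P ∧ ∫ z, e z ∂P = (∫⁻ z, ⨆ y ∈ s, f z y ∂P).toReal ∧
      ∀ᵐ z ∂P, ∀ y ∈ s, f z y ≤ ENNReal.ofReal (e z) := by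
  have hm := aemeasurable_biSup_of_measurable (μ := P) hf hs
  have hlt := ae_lt_top' hm hfin
  refine ⟨fun z => (⨆ y ∈ s, f z y).toReal, fun z => ENNReal.toReal_nonneg,
    integrable_toReal_of_lintegral_ne_top hm hfin, integral_toReal hm hlt, ?_⟩
  filter_upwards [hlt] with z hz y hy
  rw [ENNReal.ofReal_toReal hz.ne]
  exact le_iSup₂ (f := fun y (_ : y ∈ s) => f z y) y hy

variable {k m : ℕ} {g : X → Vec k → Vec m}

lemma norm_le_sqrt_of_enorm_sq_le {E : Type*} [NormedAddCommGroup E] {v : E} {t : ℝ}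
    (h : ‖v‖ₑ ^ 2 ≤ ENNReal.ofReal t) : ‖v‖ ≤ √t := by
  rw [← ofReal_norm, ← ENNReal.ofReal_pow (norm_nonneg _)] at h
  rcases ENNReal.ofReal_le_ofReal_iff'.1 h with h | h
  · exact Real.le_sqrt_of_sq_le h
  · have : ‖v‖ = 0 := by simpa using le_antisymm h (sq_nonneg _)
    exact this ▸ Real.sqrt_nonneg t

/-- A square integrable envelope for a function with finite moments of order `2 + δ`. -/
lemma exists_sq_integrable_envelope (hg : Measurable (Function.uncurry g)) {Θ : Set (Vec k)}
    (hΘ : MeasurableSet Θ) {δ : ℝ} (hδ : 0 < δ)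
    (hfin : ∫⁻ z, ⨆ θ ∈ Θ, ‖g z θ‖ₑ ^ (2 + δ) ∂P < ∞) :
    ∃ e : X → ℝ, (∀ z, 0 ≤ e z) ∧ Integrable (fun z => e z ^ 2) P ∧
      ∀ᵐ z ∂P, ∀ θ ∈ Θ, ‖g z θ‖ ≤ e z := by
  have hf : Measurable (Function.uncurry fun z θ => ‖g z θ‖ₑ ^ 2) := hg.enorm.pow_const 2
  -- The first summand covers `t ≤ 1`, the second `t ≥ 1`; this trades the order `2 + δ` for a
  -- square.
  have hle : ∀ t : ℝ≥0∞, t ^ 2 ≤ 1 + t ^ (2 + δ) := fun t => by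
    rcases le_total t 1 with h | h
    · exact (pow_le_one₀ zero_le h).trans le_self_add
    · refine le_trans ?_ le_add_self
      rw [← ENNReal.rpow_two]
      exact ENNReal.rpow_le_rpow_of_exponent_le h (by linarith)
  obtain ⟨e, he0, he, -, hle⟩ := exists_integrable_envelope (P := P) hf hΘ (by
    refine ((lintegral_mono (g := fun z => 1 + ⨆ θ ∈ Θ, ‖g z θ‖ₑ ^ (2 + δ)) fun z => ?_).trans_lt
      ?_).ne
    · exact iSup₂_le fun θ hθ => (hle _).trans
        (add_le_add_right (le_iSup₂ (f := fun θ (_ : θ ∈ Θ) => ‖g z θ‖ₑ ^ (2 + δ)) θ hθ) _)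
    · rw [lintegral_add_left measurable_const]
      simpa using hfin)
  refine ⟨fun z => √(e z), fun z => Real.sqrt_nonneg _, ?_, ?_⟩
  · simpa only [Real.sq_sqrt (he0 _)] using he
  · filter_upwards [hle] with z hz θ hθ
    exact norm_le_sqrt_of_enorm_sq_le (hz θ hθ)

/-- An envelope with integrable fourth power. -/
lemma exists_pow_four_integrable_envelope (hg : Measurable (Function.uncurry g))
    {N : Set (Vec k)} (hN : MeasurableSet N)
    (hfin : ∫⁻ z, ⨆ θ ∈ N, ‖g z θ‖ₑ ^ 4 ∂P < ∞) :
    ∃ a : X → ℝ, (∀ z, 0 ≤ a z) ∧ Integrable (fun z => a z ^ 4) P ∧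
      ∀ᵐ z ∂P, ∀ θ ∈ N, ‖g z θ‖ ≤ a z := by
  have hf : Measurable (Function.uncurry fun z θ => ‖g z θ‖ₑ ^ 4) := hg.enorm.pow_const 4
  obtain ⟨e, he0, he, -, hle⟩ := exists_integrable_envelope (P := P) hf hN hfin.ne
  have hsq : ∀ z, √(√(e z)) ^ 4 = e z := fun z => by
    rw [show 4 = 2 * 2 from rfl, pow_mul, Real.sq_sqrt (Real.sqrt_nonneg _), Real.sq_sqrt (he0 z)]
  refine ⟨fun z => √(√(e z)), fun z => Real.sqrt_nonneg _, ?_, ?_⟩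
  · simpa only [hsq] using he
  · filter_upwards [hle] with z hz θ hθ
    have h := hz θ hθ
    rw [show 4 = 2 * 2 from rfl, pow_mul] at h
    have h2 : ‖‖g z θ‖ ^ 2‖ₑ ^ 2 ≤ ENNReal.ofReal (e z) := by
      simpa [enorm_pow] using h
    have h3 := norm_le_sqrt_of_enorm_sq_le h2
    rw [Real.norm_of_nonneg (by positivity)] at h3
    exact Real.le_sqrt_of_sq_le h3

/-- A square integrable envelope for the Jacobian on a ball. -/
lemma exists_jac_envelope (hg : Measurable (Function.uncurry g)) {N : Set (Vec k)}
    (hN : IsOpen N) (hdiff : ∀ᵐ z ∂P, ContDiffOn ℝ 1 (g z) N)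
    (hfin : ∫⁻ z, ⨆ θ ∈ N, ‖jac g z θ‖ₑ ^ 2 ∂P < ∞) {θs : Vec k} {ρ : ℝ}
    (hρ : Metric.ball θs ρ ⊆ N) :
    ∃ l : X → ℝ, (∀ z, 0 ≤ l z) ∧ Integrable (fun z => l z ^ 2) P ∧
      ∀ᵐ z ∂P, ∀ θ ∈ Metric.ball θs ρ, ‖jac g z θ‖ ≤ l z := by
  -- The envelope is the supremum of difference quotients, whose joint measurability comes from that
  -- of `g`. The mean value inequality bounds them by the supremum of the Jacobian, and conversely a
  -- Lipschitz constant bounds the derivative. On the diagonal the quotient is `0 / 0 = 0`.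
  let f : X → Vec k × Vec k → ℝ≥0∞ := fun z q =>
    (‖g z q.1 - g z q.2‖ₑ / ‖q.1 - q.2‖ₑ) ^ 2
  have hf : Measurable (Function.uncurry f) := by
    have h1 : Measurable fun p : X × (Vec k × Vec k) => g p.1 p.2.1 :=
      hg.comp (measurable_fst.prodMk (measurable_fst.comp measurable_snd))
    have h2 : Measurable fun p : X × (Vec k × Vec k) => g p.1 p.2.2 :=
      hg.comp (measurable_fst.prodMk (measurable_snd.comp measurable_snd))
    exact ((h1.sub h2).enorm.div (by fun_prop)).pow_const 2
  let U : Set (Vec k × Vec k) := Metric.ball θs ρ ×ˢ Metric.ball θs ρ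
  have hU : MeasurableSet U := measurableSet_ball.prod measurableSet_ball
  obtain ⟨e, he0, he, -, hle⟩ := exists_integrable_envelope (P := P) hf hU (by
    refine ((lintegral_mono_ae (g := fun z => ⨆ θ ∈ N, ‖jac g z θ‖ₑ ^ 2) ?_).trans_lt hfin).ne
    filter_upwards [hdiff] with z hz
    refine iSup₂_le fun q hq => ?_
    by_cases htop : (⨆ θ ∈ N, ‖jac g z θ‖ₑ ^ 2) = ∞
    · rw [htop]; exact le_top
    have hbound : ∀ θ ∈ Metric.ball θs ρ,
        ‖fderiv ℝ (g z) θ‖ ≤ √((⨆ θ ∈ N, ‖jac g z θ‖ₑ ^ 2).toReal) := fun θ hθ => by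
      refine norm_le_sqrt_of_enorm_sq_le ?_
      rw [ENNReal.ofReal_toReal htop]
      exact le_iSup₂ (f := fun θ (_ : θ ∈ N) => ‖jac g z θ‖ₑ ^ 2) θ (hρ hθ)
    have hmv := (convex_ball θs ρ).norm_image_sub_le_of_norm_fderiv_le
      (fun θ hθ => (hz.contDiffAt (hN.mem_nhds (hρ hθ))).differentiableAt one_ne_zero) hbound
      hq.2 hq.1
    have hdiv : ‖g z q.1 - g z q.2‖ₑ / ‖q.1 - q.2‖ₑ
        ≤ ENNReal.ofReal √((⨆ θ ∈ N, ‖jac g z θ‖ₑ ^ 2).toReal) := by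
      refine ENNReal.div_le_of_le_mul ?_
      rw [← ofReal_norm, ← ofReal_norm, ← ENNReal.ofReal_mul (Real.sqrt_nonneg _)]
      exact ENNReal.ofReal_le_ofReal hmv
    calc f z q ≤ (ENNReal.ofReal √((⨆ θ ∈ N, ‖jac g z θ‖ₑ ^ 2).toReal)) ^ 2 :=
          pow_le_pow_left₀ zero_le hdiv 2
      _ = _ := by
        rw [← ENNReal.ofReal_pow (Real.sqrt_nonneg _), Real.sq_sqrt ENNReal.toReal_nonneg,
          ENNReal.ofReal_toReal htop])
  refine ⟨fun z => √(e z), fun z => Real.sqrt_nonneg _, ?_, ?_⟩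
  · simpa only [Real.sq_sqrt (he0 _)] using he
  · filter_upwards [hle] with z hz θ hθ
    refine norm_fderiv_le_of_lipschitzOn ℝ (C := ⟨√(e z), Real.sqrt_nonneg _⟩)
      (Metric.isOpen_ball.mem_nhds hθ) (LipschitzOnWith.of_dist_le_mul fun θ₁ h₁ θ₂ h₂ => ?_)
    by_cases hne : θ₁ = θ₂
    · simp [hne]
    have h := hz (θ₁, θ₂) ⟨h₁, h₂⟩
    have hpos : 0 < ‖θ₁ - θ₂‖ := norm_pos_iff.2 (sub_ne_zero.2 hne)
    have h2 : ‖‖g z θ₁ - g z θ₂‖ / ‖θ₁ - θ₂‖‖ₑ ^ 2 ≤ ENNReal.ofReal (e z) := by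
      refine le_trans (le_of_eq ?_) h
      simp only [f]
      congr 1
      rw [Real.enorm_of_nonneg (by positivity), ENNReal.ofReal_div_of_pos hpos, ofReal_norm,
        ofReal_norm]
    have h3 := norm_le_sqrt_of_enorm_sq_le h2
    rw [Real.norm_of_nonneg (by positivity), div_le_iff₀ hpos] at h3
    rw [dist_eq_norm, dist_eq_norm]
    exact h3

end Envelope

/-! ### Separation from the true value -/

section Consistency

variable {S X : Type*} [MeasurableSpace S] [MeasurableSpace X] [StandardBorelSpace X]
  {μ : Measure S} [IsProbabilityMeasure μ] {P : Measure X} {x : ℕ → S → X}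
  {k m : ℕ} {g : X → Vec k → Vec m} {Θ : Set (Vec k)} {e : X → ℝ}

/-- Continuity at the single point `θ₀` and dominated convergence make the mean oscillation of `g`
over small balls tend to zero. With `M` the norm of the mean at `θ₀`, a radius with mean oscillation
below `M / 4` is fixed. The laws of large numbers for the oscillation and for `g · θ₀` each cost a
further `M / 4`, which leaves `M / 4`. -/
lemma exists_nhds_holdsWPA_le_norm_avg (x_indep : iIndepFun x μ)
    (x_law : ∀ i, HasLaw (x i) P μ) (hg : Measurable (Function.uncurry g))
    (hΘ : MeasurableSet Θ) (he : Integrable e P) (hle : ∀ᵐ z ∂P, ∀ θ ∈ Θ, ‖g z θ‖ ≤ e z)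
    {θ₀ : Vec k} (hθ₀ : θ₀ ∈ Θ) (hcont : ∀ᵐ z ∂P, ContinuousWithinAt (g z) Θ θ₀)
    (hne : ∫ z, g z θ₀ ∂P ≠ 0) :
    ∃ c : ℝ, 0 < c ∧ ∃ t ∈ 𝓝 θ₀, HoldsWPA μ fun n s =>
      ∀ θ ∈ Θ ∩ t, c ≤ ‖avg fun i : Fin n => g (x i s) θ‖ := by
  have : IsProbabilityMeasure P := (x_law 0).isProbabilityMeasure_iff.1 inferInstance
  have hg0 : Measurable fun z => g z θ₀ := hg.comp (measurable_id.prodMk measurable_const)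
  have hg0int : Integrable (fun z => g z θ₀) P := by
    refine he.mono' hg0.aestronglyMeasurable ?_
    filter_upwards [hle] with z hz using hz θ₀ hθ₀
  have hM : 0 < ‖∫ z, g z θ₀ ∂P‖ := norm_pos_iff.2 hne
  set M := ‖∫ z, g z θ₀ ∂P‖ with hMdef
  let f : X → Vec k → ℝ≥0∞ := fun z θ => ‖g z θ - g z θ₀‖ₑ
  have hf : Measurable (Function.uncurry f) :=
    (hg.sub (hg0.comp measurable_fst)).enorm
  let B : ℕ → Set (Vec k) := fun j => Θ ∩ Metric.ball θ₀ (1 / ((j : ℝ) + 1))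
  have hB : ∀ j, MeasurableSet (B j) := fun j => hΘ.inter measurableSet_ball
  have hlim : Tendsto (fun j => ∫⁻ z, ⨆ θ ∈ B j, f z θ ∂P) atTop (𝓝 0) := by
    have h := tendsto_lintegral_of_dominated_convergence' (μ := P)
      (F := fun j z => ⨆ θ ∈ B j, f z θ) (f := fun _ => 0)
      (fun z => ENNReal.ofReal (2 * e z)) (fun j => aemeasurable_biSup_of_measurable hf (hB j))
      (fun j => ?_) ?_ ?_
    · simpa using h
    · filter_upwards [hle] with z hz
      refine iSup₂_le fun θ hθ => ?_
      simp only [f]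
      rw [← ofReal_norm]
      refine ENNReal.ofReal_le_ofReal ((norm_sub_le _ _).trans ?_)
      linarith [hz θ hθ.1, hz θ₀ hθ₀]
    · exact ((he.const_mul 2).lintegral_lt_top).ne
    · filter_upwards [hcont] with z hz
      rw [ENNReal.tendsto_atTop_zero]
      intro ε hε
      obtain ⟨r, hr, hr'⟩ := Metric.mem_nhdsWithin_iff.1
        (hz.tendsto (Metric.eball_mem_nhds (g z θ₀) hε))
      obtain ⟨j₀, hj₀⟩ := exists_nat_one_div_lt hr
      refine ⟨j₀, fun j hj => iSup₂_le fun θ hθ => ?_⟩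
      have hmem : θ ∈ Metric.ball θ₀ r ∩ Θ := by
        refine ⟨Metric.ball_subset_ball ?_ hθ.2, hθ.1⟩
        refine le_trans ?_ hj₀.le
        gcongr
      have h1 := hr' hmem
      have h2 : edist (g z θ) (g z θ₀) < ε := h1
      rw [edist_eq_enorm_sub] at h2
      exact h2.le
  obtain ⟨j, hj⟩ := (hlim.eventually_lt_const
    (ENNReal.ofReal_pos.2 (show 0 < M / 4 by positivity))).exists
  obtain ⟨o, ho0, ho, hoI, hole⟩ := exists_integrable_envelope (P := P) hf (hB j)
    (hj.trans ENNReal.ofReal_lt_top).ne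
  have hoM : ∫ z, o z ∂P < M / 4 := by
    rw [hoI]
    exact (ENNReal.lt_ofReal_iff_toReal_lt (hj.trans ENNReal.ofReal_lt_top).ne).1 hj
  refine ⟨M / 4, by positivity, Metric.ball θ₀ (1 / ((j : ℝ) + 1)),
    Metric.ball_mem_nhds _ (by positivity), ?_⟩
  refine ((holdsWPA_norm_avg_sub_integral_lt x_indep x_law ho
    (show 0 < M / 4 by positivity)).and (holdsWPA_norm_avg_sub_integral_lt x_indep x_law hg0int
    (show 0 < M / 4 by positivity))).mono (Eventually.of_forall fun n => ?_)
  filter_upwards [ae_forall_sample x_law hole] with s hs ⟨h1, h2⟩ θ hθ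
  have h3 : ‖avg (fun i : Fin n => g (x i s) θ) - avg fun i : Fin n => g (x i s) θ₀‖
      ≤ avg fun i : Fin n => o (x i s) := by
    rw [← avg_sub]
    refine norm_avg_le_of_le fun i => ?_
    have h := hs i θ hθ
    simp only [f] at h
    rwa [← ofReal_norm, ENNReal.ofReal_le_ofReal_iff (ho0 _)] at h
  have h4 := (abs_lt.1 h1).2
  have h5 := norm_sub_norm_le (∫ z, g z θ₀ ∂P) (avg fun i : Fin n => g (x i s) θ₀)
  have h6 := norm_sub_norm_le (avg fun i : Fin n => g (x i s) θ₀)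
    (avg fun i : Fin n => g (x i s) θ)
  rw [norm_sub_rev] at h5 h6
  linarith

/-- Away from the true value, the sample moments are bounded away from zero with probability
approaching one. -/
lemma exists_holdsWPA_le_norm_avg_of_isCompact (x_indep : iIndepFun x μ)
    (x_law : ∀ i, HasLaw (x i) P μ) (hg : Measurable (Function.uncurry g))
    (hΘ : MeasurableSet Θ) (he : Integrable e P) (hle : ∀ᵐ z ∂P, ∀ θ ∈ Θ, ‖g z θ‖ ≤ e z)
    (hcont : ∀ θ ∈ Θ, ∀ᵐ z ∂P, ContinuousWithinAt (g z) Θ θ) {K : Set (Vec k)}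
    (hK : IsCompact K) (hKΘ : K ⊆ Θ) (hne : ∀ θ ∈ K, ∫ z, g z θ ∂P ≠ 0) :
    ∃ c : ℝ, 0 < c ∧ HoldsWPA μ fun n s =>
      ∀ θ ∈ K, c ≤ ‖avg fun i : Fin n => g (x i s) θ‖ := by
  have key : ∃ c : ℝ, 0 < c ∧ HoldsWPA μ fun n s =>
      ∀ θ ∈ Θ ∩ K, c ≤ ‖avg fun i : Fin n => g (x i s) θ‖ := by
    -- High-probability events are stable under finite intersections only, so the local bounds are
    -- glued by compactness. Intersecting with `Θ` keeps the property meaningful for sets `t` that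
    -- leave `Θ`.
    refine hK.induction_on (p := fun t => ∃ c : ℝ, 0 < c ∧ HoldsWPA μ fun n s =>
      ∀ θ ∈ Θ ∩ t, c ≤ ‖avg fun i : Fin n => g (x i s) θ‖) ?_ ?_ ?_ ?_
    · exact ⟨1, one_pos, .of_forall fun n => by simp⟩
    · rintro t u htu ⟨c, hc, h⟩
      exact ⟨c, hc, h.mono (.of_forall fun n => .of_forall fun s hs θ hθ =>
        hs θ ⟨hθ.1, htu hθ.2⟩)⟩
    · rintro t u ⟨c, hc, h⟩ ⟨c', hc', h'⟩
      refine ⟨min c c', lt_min hc hc', (h.and h').mono (.of_forall fun n => .of_forall ?_)⟩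
      rintro s ⟨h1, h2⟩ θ ⟨hθ, hθ' | hθ'⟩
      · exact (min_le_left _ _).trans (h1 θ ⟨hθ, hθ'⟩)
      · exact (min_le_right _ _).trans (h2 θ ⟨hθ, hθ'⟩)
    · intro θ hθ
      obtain ⟨c, hc, t, ht, h⟩ := exists_nhds_holdsWPA_le_norm_avg x_indep x_law hg hΘ he hle
        (hKΘ hθ) (hcont θ (hKΘ hθ)) (hne θ hθ)
      exact ⟨t, mem_nhdsWithin_of_mem_nhds ht, c, hc, h⟩
  obtain ⟨c, hc, h⟩ := key
  exact ⟨c, hc, h.mono (.of_forall fun n => .of_forall fun s hs θ hθ => hs θ ⟨hKΘ hθ, hθ⟩)⟩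

end Consistency

/-! ### Tilted weights and duality -/

section Duality

variable {n m : ℕ}

/-- The weights `wᵢ = τ(λ'yᵢ) / ∑ⱼ τ(λ'yⱼ)`. -/
def tilt (τ : ℝ → ℝ) (y : Fin n → Vec m) (l : Vec m) (i : Fin n) : ℝ :=
  τ (inner ℝ l (y i)) / ∑ j, τ (inner ℝ l (y j))

lemma discrepancy_eq_avg (h : ℝ → ℝ) (w : Fin n → ℝ) :
    discrepancy h w = avg fun i => h (n * w i) := rfl

lemma tilt_pos {τ : ℝ → ℝ} {y : Fin n → Vec m} {l : Vec m} (hτ : ∀ i, 0 < τ (inner ℝ l (y i)))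
    (i : Fin n) : 0 < tilt τ y l i :=
  div_pos (hτ i) (Finset.sum_pos (fun j _ => hτ j) ⟨i, Finset.mem_univ i⟩)

lemma tilt_mem_weightSet (hn : n ≠ 0) {τ : ℝ → ℝ} {y : Fin n → Vec m} {l : Vec m}
    (hτ : ∀ i, 0 < τ (inner ℝ l (y i))) (h0 : avg (fun i => τ (inner ℝ l (y i)) • y i) = 0) :
    tilt τ y l ∈ weightSet (Set.Ioi 0) y := by
  have : NeZero n := ⟨hn⟩
  have hn' : (n : ℝ) ≠ 0 := by exact_mod_cast hn
  have hs : 0 < ∑ j, τ (inner ℝ l (y j)) := Finset.sum_pos (fun j _ => hτ j) ⟨0, Finset.mem_univ _⟩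
  refine ⟨fun i => tilt_pos hτ i, ?_, ?_⟩
  · have h1 : ∑ i, τ (inner ℝ l (y i)) • y i = 0 := by
      rw [avg] at h0
      exact (smul_eq_zero.1 h0).resolve_left (inv_ne_zero hn')
    simp only [tilt, div_eq_inv_mul, mul_smul, ← Finset.smul_sum]
    rw [h1, smul_zero]
  · simp only [tilt, ← Finset.sum_div]
    exact div_self hs.ne'

lemma natCast_mul_tilt (hn : n ≠ 0) (τ : ℝ → ℝ) (y : Fin n → Vec m) (l : Vec m) (i : Fin n) :
    n * tilt τ y l i = τ (inner ℝ l (y i)) / avg fun j => τ (inner ℝ l (y j)) := by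
  have hn' : (n : ℝ) ≠ 0 := by exact_mod_cast hn
  simp only [tilt, avg, smul_eq_mul]
  field_simp

/-- The log-discrepancy of tilted weights. -/
lemma discrepancy_hEL_tilt (hn : n ≠ 0) {τ : ℝ → ℝ} {y : Fin n → Vec m} {l : Vec m}
    (hτ : ∀ i, 0 < τ (inner ℝ l (y i))) :
    discrepancy hEL (tilt τ y l) = Real.log (avg fun i => τ (inner ℝ l (y i)))
      - avg fun i => Real.log (τ (inner ℝ l (y i))) := by
  have hs : 0 < avg fun j => τ (inner ℝ l (y j)) := avg_pos hn hτ
  rw [discrepancy_eq_avg]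
  simp only [natCast_mul_tilt hn, hEL, Real.log_div (hτ _).ne' hs.ne', neg_sub]
  rw [avg_sub, avg_const hn]

lemma sum_mul_inner_of_mem_weightSet {D : Set ℝ} {y : Fin n → Vec m} {w : Fin n → ℝ}
    (hw : w ∈ weightSet D y) (l : Vec m) : ∑ i, w i * inner ℝ l (y i) = 0 := by
  have h := congrArg (fun v => inner ℝ l v) hw.2.1
  simpa only [inner_sum, inner_smul_right, inner_zero_right] using h

/-- Weak duality for empirical likelihood. -/
lemma avg_log_le_discrepancy_hEL (hn : n ≠ 0) {y : Fin n → Vec m} {w : Fin n → ℝ}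
    (hw : w ∈ weightSet (Set.Ioi 0) y) {l : Vec m} (hl : ∀ i, 0 < 1 + inner ℝ l (y i)) :
    avg (fun i => Real.log (1 + inner ℝ l (y i))) ≤ discrepancy hEL w ∧
      (discrepancy hEL w ≤ avg (fun i => Real.log (1 + inner ℝ l (y i))) →
        ∀ i, n * w i * (1 + inner ℝ l (y i)) = 1) := by
  have hn' : (0 : ℝ) < n := by positivity
  -- Weak duality is `log t ≤ t - 1` at `t = n wᵢ (1 + l'yᵢ)`, whose average is `1` by the two
  -- constraints. Equality forces `t = 1` for every `i`.
  have hsum : avg (fun i => n * w i * (1 + inner ℝ l (y i)) - 1) = 0 := by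
    have h1 := sum_mul_inner_of_mem_weightSet hw l
    simp only [avg, mul_assoc, mul_add, mul_one, Finset.sum_sub_distrib, Finset.sum_add_distrib,
      ← Finset.mul_sum, h1, hw.2.2]
    simp
  have hpos : ∀ i, 0 < n * w i * (1 + inner ℝ l (y i)) := fun i =>
    mul_pos (mul_pos hn' (hw.1 i)) (hl i)
  have hdiff : avg (fun i => Real.log (1 + inner ℝ l (y i))) - discrepancy hEL w
      = avg fun i => Real.log (n * w i * (1 + inner ℝ l (y i)))
          - (n * w i * (1 + inner ℝ l (y i)) - 1) := by
    rw [avg_sub, hsum, discrepancy_eq_avg, ← avg_sub, sub_zero]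
    congr 1
    funext i
    rw [Real.log_mul (mul_pos hn' (hw.1 i)).ne' (hl i).ne', hEL]
    ring
  have hle : ∀ i, Real.log (n * w i * (1 + inner ℝ l (y i)))
      - (n * w i * (1 + inner ℝ l (y i)) - 1) ≤ 0 := fun i =>
    sub_nonpos.2 (Real.log_le_sub_one_of_pos (hpos i))
  constructor
  · have h : avg (fun i => Real.log (n * w i * (1 + inner ℝ l (y i)))
        - (n * w i * (1 + inner ℝ l (y i)) - 1)) ≤ avg fun _ : Fin n => (0 : ℝ) := avg_mono hle
    rw [avg_const hn, ← hdiff] at h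
    linarith
  · intro h i
    have h0 : ∑ i, -(Real.log (n * w i * (1 + inner ℝ l (y i)))
        - (n * w i * (1 + inner ℝ l (y i)) - 1)) ≤ 0 := by
      rw [sum_eq_mul_avg hn, avg_neg, ← hdiff]
      nlinarith
    have h1 := (Finset.sum_eq_zero_iff_of_nonneg fun i _ => neg_nonneg.2 (hle i)).1
      (le_antisymm h0 (Finset.sum_nonneg fun i _ => neg_nonneg.2 (hle i))) i (Finset.mem_univ i)
    by_contra hne
    have := Real.log_lt_sub_one_of_pos (hpos i) hne
    linarith

lemma avg_inv_one_add_inner_eq_one (hn : n ≠ 0) {y : Fin n → Vec m} {l : Vec m}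
    (hl : ∀ i, 0 < 1 + inner ℝ l (y i))
    (h0 : avg (fun i => (1 + inner ℝ l (y i))⁻¹ • y i) = 0) :
    avg (fun i => (1 + inner ℝ l (y i))⁻¹) = 1 := by
  have h1 := congrArg (fun v => inner ℝ l v) h0
  simp only [inner_avg, inner_smul_right, inner_zero_right] at h1
  have h2 : avg (fun i => (1 + inner ℝ l (y i))⁻¹ * (1 + inner ℝ l (y i))) = 1 := by
    simp only [inv_mul_cancel₀ (hl _).ne']
    exact avg_const hn 1
  simp only [mul_add, mul_one] at h2
  rw [avg_add, h1] at h2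
  simpa using h2

/-- The tilted weights attain the weak duality bound, hence are optimal; the equality case of that
bound gives uniqueness. -/
lemma isELWeights_iff (hn : n ≠ 0) {y : Fin n → Vec m} {l : Vec m}
    (hl : ∀ i, 0 < 1 + inner ℝ l (y i))
    (h0 : avg (fun i => (1 + inner ℝ l (y i))⁻¹ • y i) = 0) (w : Fin n → ℝ) :
    IsELWeights y w ↔ w = tilt (fun t => (1 + t)⁻¹) y l := by
  have hn' : (0 : ℝ) < n := by positivity
  have hmem := tilt_mem_weightSet hn (τ := fun t => (1 + t)⁻¹) (fun i => inv_pos.2 (hl i)) h0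
  have hone := avg_inv_one_add_inner_eq_one hn hl h0
  have hval : discrepancy hEL (tilt (fun t => (1 + t)⁻¹) y l)
      = avg fun i => Real.log (1 + inner ℝ l (y i)) := by
    rw [discrepancy_hEL_tilt hn (τ := fun t => (1 + t)⁻¹) fun i => inv_pos.2 (hl i)]
    simp only [hone, Real.log_inv, avg_neg, Real.log_one]
    ring
  have htilt : IsELWeights y (tilt (fun t => (1 + t)⁻¹) y l) :=
    ⟨hmem, isMinOn_iff.2 fun w hw => hval ▸ (avg_log_le_discrepancy_hEL hn hw hl).1⟩
  refine ⟨fun hw => ?_, fun hw => hw ▸ htilt⟩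
  have h1 := (avg_log_le_discrepancy_hEL hn hw.1 hl).2 (hval ▸ isMinOn_iff.1 hw.2 _ hmem)
  funext i
  have h2 := natCast_mul_tilt hn (fun t => (1 + t)⁻¹) y l i
  simp only [hone, div_one] at h2
  have h3 : n * w i = (1 + inner ℝ l (y i))⁻¹ := eq_inv_of_mul_eq_one_left (h1 i)
  exact mul_left_cancel₀ hn'.ne' (h3.trans h2.symm)

/-- The pointwise inequality behind nonnegativity of relative entropy, with its equality case. Here
`w = 0` is allowed, as it is for ET weights, and `c` becomes the sample size. -/
lemma sub_le_mul_log_sub {w v : ℝ} (hw : 0 ≤ w) (hv : 0 < v) {c : ℝ} (hc : 0 < c) :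
    w - v ≤ w * Real.log (c * w) - w * Real.log (c * v) ∧
      (w * Real.log (c * w) - w * Real.log (c * v) ≤ w - v → w = v) := by
  rcases hw.eq_or_lt with rfl | hw
  · exact ⟨by simp [hv.le], fun h => by simp at h; linarith⟩
  have hlog : w * Real.log (c * w) - w * Real.log (c * v) = -(w * Real.log (v / w)) := by
    rw [Real.log_mul hc.ne' hw.ne', Real.log_mul hc.ne' hv.ne', Real.log_div hv.ne' hw.ne']
    ring
  have hmul : w * (v / w - 1) = v - w := by field_simp
  rw [hlog]
  constructor
  · have := mul_le_mul_of_nonneg_left (Real.log_le_sub_one_of_pos (div_pos hv hw)) hw.le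
    linarith
  · intro h
    by_contra hne
    have h1 : v / w ≠ 1 := fun h1 => hne ((div_eq_one_iff_eq hw.ne').1 h1).symm
    have := mul_lt_mul_of_pos_left (Real.log_lt_sub_one_of_pos (div_pos hv hw) h1) hw
    linarith

/-- Since `log (n vᵢ)` is affine in `l'yᵢ`, the cross term `∑ uᵢ log (n vᵢ)` takes the same value
for all feasible `u`. The excess discrepancy of `u` over `v` is therefore their relative entropy,
which vanishes only at `u = v`. -/
lemma isETWeights_iff (hn : n ≠ 0) {y : Fin n → Vec m} {l : Vec m}
    (h0 : avg (fun i => Real.exp (-inner ℝ l (y i)) • y i) = 0) (w : Fin n → ℝ) :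
    IsETWeights y w ↔ w = tilt (fun t => Real.exp (-t)) y l := by
  have hn' : (0 : ℝ) < n := by positivity
  have hmem0 := tilt_mem_weightSet hn (τ := fun t => Real.exp (-t)) (fun i => Real.exp_pos _) h0
  set v := tilt (fun t => Real.exp (-t)) y l with hv
  have hvpos : ∀ i, 0 < v i := hmem0.1
  have hmem : v ∈ weightSet (Set.Ici 0) y := ⟨fun i => (hvpos i).le, hmem0.2⟩
  have hM : 0 < avg fun j => Real.exp (-inner ℝ l (y j)) := avg_pos hn fun _ => Real.exp_pos _
  have hlogv : ∀ i, Real.log (n * v i)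
      = -inner ℝ l (y i) - Real.log (avg fun j => Real.exp (-inner ℝ l (y j))) := fun i => by
    rw [hv, natCast_mul_tilt hn, Real.log_div (Real.exp_pos _).ne' hM.ne', Real.log_exp]
  have hcross : ∀ u ∈ weightSet (Set.Ici 0) y, ∑ i, u i * Real.log (n * v i)
      = -Real.log (avg fun j => Real.exp (-inner ℝ l (y j))) := fun u hu => by
    simp only [hlogv, mul_sub, mul_neg, Finset.sum_sub_distrib, ← Finset.sum_mul,
      Finset.sum_neg_distrib, sum_mul_inner_of_mem_weightSet hu l, hu.2.2]
    ring
  have hdisc : ∀ u : Fin n → ℝ, discrepancy hET u = ∑ i, u i * Real.log (n * u i) := fun u => by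
    simp only [discrepancy, hET, mul_assoc, ← Finset.mul_sum]
    rw [inv_mul_cancel_left₀ hn'.ne']
  have hdiff : ∀ u ∈ weightSet (Set.Ici 0) y, discrepancy hET u - discrepancy hET v
      = ∑ i, (u i * Real.log (n * u i) - u i * Real.log (n * v i) - (u i - v i)) := fun u hu => by
    rw [hdisc, hdisc, hcross v hmem]
    simp only [Finset.sum_sub_distrib]
    rw [hcross u hu, hu.2.2, hmem.2.2]
    ring
  have hnn : ∀ u ∈ weightSet (Set.Ici 0) y, ∀ i,
      0 ≤ u i * Real.log (n * u i) - u i * Real.log (n * v i) - (u i - v i) := fun u hu i =>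
    sub_nonneg.2 (sub_le_mul_log_sub (hu.1 i) (hvpos i) hn').1
  refine ⟨fun hw => ?_, fun hw => hw ▸ ⟨hmem, isMinOn_iff.2 fun u hu => ?_⟩⟩
  · have h1 := isMinOn_iff.1 hw.2 v hmem
    have h2 := hdiff w hw.1
    have h3 := (Finset.sum_eq_zero_iff_of_nonneg fun i _ => hnn w hw.1 i).1
      (le_antisymm (h2 ▸ sub_nonpos.2 h1) (Finset.sum_nonneg fun i _ => hnn w hw.1 i))
    funext i
    refine (sub_le_mul_log_sub (hw.1.1 i) (hvpos i) hn').2 ?_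
    linarith [h3 i (Finset.mem_univ i)]
  · have h2 := Finset.sum_nonneg fun i (_ : i ∈ Finset.univ) => hnn u hu i
    rw [← hdiff u hu] at h2
    linarith

/-! ### Tilting families -/

/-- The common structure of the empirical likelihood and exponential tilting problems: the
solution has the form `tilt τ y λ`, where `-τ` is the derivative of the dual criterion `T`. -/
structure IsTilting (m : ℕ) (IsSol : ∀ {n : ℕ}, (Fin n → Vec m) → (Fin n → ℝ) → Prop)
    (τ T : ℝ → ℝ) : Prop where
  hasDerivAt : ∀ t, |t| < 1 → HasDerivAt T (-τ t) t
  growth : ∀ t, |t| ≤ 1 / 8 → T 0 - t + t ^ 2 / 4 ≤ T t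
  pos : ∀ t, |t| < 1 → 0 < τ t
  continuousOn : ContinuousOn τ (Set.Ioo (-1) 1)
  mem_weightSet : ∀ {n : ℕ} {y : Fin n → Vec m} {w : Fin n → ℝ}, IsSol y w → (∀ i, 0 < w i) →
    w ∈ weightSet (Set.Ioi 0) y
  isSol_iff : ∀ {n : ℕ} {y : Fin n → Vec m} {l : Vec m}, n ≠ 0 → (∀ i, |inner ℝ l (y i)| < 1) →
    avg (fun i => τ (inner ℝ l (y i)) • y i) = 0 → ∀ w, IsSol y w ↔ w = tilt τ y l
  discrepancy_le : ∀ {n : ℕ} {y : Fin n → Vec m} {l : Vec m}, n ≠ 0 →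
    (∀ i, |inner ℝ l (y i)| < 1) → avg (fun i => τ (inner ℝ l (y i)) • y i) = 0 →
    discrepancy hEL (tilt τ y l) ≤ inner ℝ l (avg y)

lemma one_add_pos_of_abs_lt_one {t : ℝ} (ht : |t| < 1) : 0 < 1 + t := by
  linarith [(abs_lt.1 ht).1]

/-- Here `T(t) = -t + t²/2 + O(t³)`; giving up half of the quadratic term in `growth` absorbs the
remainder. The discrepancy bound is `log (1 + t) ≤ t`, because the normalizer equals `1`. -/
lemma isTilting_EL (m : ℕ) : IsTilting m (fun {_} => IsELWeights) (fun t => (1 + t)⁻¹)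
    (fun t => -Real.log (1 + t)) where
  hasDerivAt t ht := by
    have h := ((hasDerivAt_id t).const_add 1).log (one_add_pos_of_abs_lt_one ht).ne'
    simpa using h.fun_neg
  growth t ht := by
    have h := Real.abs_log_sub_add_sum_range_le (x := -t) (by rw [abs_neg]; linarith) 2
    simp only [Finset.sum_range_succ, Finset.sum_range_zero, sub_neg_eq_add, abs_neg] at h
    have h2 : |t| ^ (2 + 1) / (1 - |t|) ≤ t ^ 2 / 4 := by
      rw [div_le_iff₀ (by linarith), ← sq_abs t]
      nlinarith [abs_nonneg t, mul_nonneg (sq_nonneg |t|) (sub_nonneg.2 ht)]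
    have h3 := (abs_le.1 (h.trans h2)).2
    norm_num at h3 ⊢
    linarith
  pos t ht := inv_pos.2 (one_add_pos_of_abs_lt_one ht)
  continuousOn := by
    refine ContinuousOn.inv₀ (by fun_prop) fun t ht => ?_
    have := ht.1
    linarith
  mem_weightSet h _ := h.1
  isSol_iff hn hl h0 w := isELWeights_iff hn (fun i => one_add_pos_of_abs_lt_one (hl i)) h0 w
  discrepancy_le {n y l} hn hl h0 := by
    have hp := fun i => one_add_pos_of_abs_lt_one (hl i)
    rw [discrepancy_hEL_tilt hn (τ := fun t => (1 + t)⁻¹) fun i => inv_pos.2 (hp i), inner_avg]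
    simp only [avg_inv_one_add_inner_eq_one hn hp h0, Real.log_inv, avg_neg, Real.log_one,
      zero_sub, neg_neg]
    exact avg_mono fun i => by linarith [Real.log_le_sub_one_of_pos (hp i)]

/-- Again half of the quadratic term pays for the Taylor remainder. For the discrepancy bound, `exp
t ≥ 1 + t` and the moment condition show that the normalizer is at most `1`, so its logarithm can be
dropped. -/
lemma isTilting_ET (m : ℕ) : IsTilting m (fun {_} => IsETWeights) (fun t => Real.exp (-t))
    (fun t => Real.exp (-t)) where
  hasDerivAt t _ := by simpa using (hasDerivAt_neg t).exp
  growth t ht := by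
    have h := Real.exp_bound (x := -t) (by rw [abs_neg]; linarith) (n := 3) (by norm_num)
    simp only [Finset.sum_range_succ, Finset.sum_range_zero, abs_neg] at h
    have h2 : |t| ^ 3 ≤ t ^ 2 / 8 := by
      rw [← sq_abs t]
      nlinarith [abs_nonneg t, mul_nonneg (sq_nonneg |t|) (sub_nonneg.2 ht)]
    have h3 := (abs_le.1 h).1
    norm_num [Nat.factorial] at h3 ⊢
    nlinarith [sq_nonneg t]
  pos t _ := Real.exp_pos _
  continuousOn := by fun_prop
  mem_weightSet h hpos := ⟨hpos, h.1.2⟩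
  isSol_iff hn _ h0 w := isETWeights_iff hn h0 w
  discrepancy_le {n y l} hn hl h0 := by
    rw [discrepancy_hEL_tilt hn (τ := fun t => Real.exp (-t)) fun i => Real.exp_pos _, inner_avg]
    simp only [Real.log_exp, avg_neg, sub_neg_eq_add, add_le_iff_nonpos_left]
    refine Real.log_nonpos (avg_nonneg fun i => (Real.exp_pos _).le) ?_
    have h1 := congrArg (fun v => inner ℝ l v) h0
    simp only [inner_avg, inner_smul_right, inner_zero_right] at h1
    have h2 : avg (fun i => Real.exp (-inner ℝ l (y i)))
        ≤ avg fun i => 1 - Real.exp (-inner ℝ l (y i)) * inner ℝ l (y i) := by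
      refine avg_mono fun i => ?_
      have h3 := Real.add_one_le_exp (inner ℝ l (y i))
      have h4 := mul_le_mul_of_nonneg_left h3 (Real.exp_pos (-inner ℝ l (y i))).le
      rw [← Real.exp_add, neg_add_cancel, Real.exp_zero] at h4
      linarith
    rwa [avg_sub, avg_const hn, h1, sub_zero] at h2

/-- Existence of the tilting parameter when the average of the `yᵢ` is small. -/
lemma IsTilting.exists_tilting {IsSol : ∀ {n : ℕ}, (Fin n → Vec m) → (Fin n → ℝ) → Prop}
    {τ T : ℝ → ℝ} (hT : IsTilting m IsSol τ T) (hn : n ≠ 0) {y : Fin n → Vec m} {c r : ℝ}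
    (hr : 0 < r) (hy : ∀ i, r * ‖y i‖ ≤ 1 / 8)
    (hc : ∀ u : Vec m, c * ‖u‖ ^ 2 ≤ avg fun i => inner ℝ u (y i) ^ 2)
    (hbar : ‖avg y‖ < c * r / 4) :
    ∃ l : Vec m, ‖l‖ ≤ r ∧ avg (fun i => τ (inner ℝ l (y i)) • y i) = 0 := by
  have hin : ∀ l : Vec m, ‖l‖ ≤ r → ∀ i, |inner ℝ l (y i)| ≤ 1 / 8 := fun l hl i =>
    (abs_real_inner_le_norm l (y i)).trans
      ((mul_le_mul_of_nonneg_right hl (norm_nonneg _)).trans (hy i))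
  -- The moment condition says that the gradient of `Φ` vanishes, so it suffices that a minimizer
  -- over the closed ball of radius `r` is interior.
  let Φ : Vec m → ℝ := fun l => avg fun i => T (inner ℝ l (y i))
  have hder : ∀ l : Vec m, ‖l‖ ≤ r →
      HasFDerivAt Φ (avg fun i => -τ (inner ℝ l (y i)) • innerSL ℝ (y i)) l := by
    intro l hl
    have hsum : HasFDerivAt (fun l : Vec m => ∑ i, T (inner ℝ l (y i)))
        (∑ i, -τ (inner ℝ l (y i)) • innerSL ℝ (y i)) l := HasFDerivAt.fun_sum fun i _ => ?_
    · exact hsum.const_smul (n : ℝ)⁻¹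
    have h1 : HasFDerivAt (fun l : Vec m => inner ℝ l (y i)) (innerSL ℝ (y i)) l := by
      refine (innerSL ℝ (y i)).hasFDerivAt.congr_of_eventuallyEq (.of_forall fun l => ?_)
      exact real_inner_comm _ _
    exact (hT.hasDerivAt _ (by linarith [hin l hl i])).comp_hasFDerivAt l h1
  have hcont : ContinuousOn Φ (Metric.closedBall 0 r) := fun l hl =>
    (hder l (mem_closedBall_zero_iff.1 hl)).continuousAt.continuousWithinAt
  obtain ⟨l, hl, hmin⟩ := (isCompact_closedBall (0 : Vec m) r).exists_isMinOn
    ⟨0, Metric.mem_closedBall_self hr.le⟩ hcont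
  have hl' : ‖l‖ ≤ r := mem_closedBall_zero_iff.1 hl
  have hlt : ‖l‖ < r := by
    by_contra! hge
    have heq : ‖l‖ = r := le_antisymm hl' hge
    have h0 : Φ l ≤ Φ 0 := isMinOn_iff.1 hmin 0 (Metric.mem_closedBall_self hr.le)
    -- On the sphere `‖l‖ = r`, `growth` gives `Φ l ≥ T 0 - r ‖avg y‖ + c r² / 4`. By `hbar` this
    -- exceeds `T 0 = Φ 0`.
    have h1 : avg (fun i => T 0 - inner ℝ l (y i) + inner ℝ l (y i) ^ 2 * 4⁻¹) ≤ Φ l :=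
      avg_mono fun i => by
        have := hT.growth _ (hin l hl' i)
        linarith
    have h2 : Φ 0 = T 0 := by simp only [Φ, inner_zero_left]; exact avg_const hn _
    rw [avg_add, avg_sub, avg_const hn, avg_mul_right, ← inner_avg] at h1
    have h3 := hc l
    have h4 := (le_abs_self _).trans (abs_real_inner_le_norm l (avg y))
    rw [heq] at h3 h4
    nlinarith
  have hloc : IsLocalMin Φ l := by
    refine hmin.isLocalMin (Filter.mem_of_superset
      (Metric.isOpen_ball.mem_nhds (mem_ball_zero_iff.2 hlt)) Metric.ball_subset_closedBall)
  have hz := hloc.hasFDerivAt_eq_zero (hder l hl')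
  refine ⟨l, hl', ?_⟩
  -- Evaluating the vanishing derivative at the gradient vector itself gives its squared norm.
  have h1 := DFunLike.congr_fun hz (avg fun i => τ (inner ℝ l (y i)) • y i)
  rw [avg_apply] at h1
  simp only [smul_apply, innerSL_apply_apply, smul_eq_mul, neg_mul,
    zero_apply] at h1
  rw [avg_neg, neg_eq_zero] at h1
  have h2 : inner ℝ (avg fun i => τ (inner ℝ l (y i)) • y i)
      (avg fun i => τ (inner ℝ l (y i)) • y i) = 0 := by
    conv_lhs => rw [inner_avg]
    rw [← h1]
    congr 1
    funext i
    rw [inner_smul_right]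
    congr 1
    exact real_inner_comm _ _
  exact inner_self_eq_zero.1 h2

end Duality

/-! ### Existence and characterization of the estimates -/

section Estimates

variable {n k m : ℕ} {IsSol : ∀ {n : ℕ}, (Fin n → Vec m) → (Fin n → ℝ) → Prop} {τ T : ℝ → ℝ}
  {Θ K : Set (Vec k)} {Y : Vec k → Fin n → Vec m} {r R : ℝ} {θs : Vec k}
  {ls : Vec m}

lemma abs_inner_lt_one {l v : Vec m} (hl : ‖l‖ ≤ r) (hv : r * ‖v‖ ≤ 1 / 8) :
    |inner ℝ l v| < 1 := by
  have h := (abs_real_inner_le_norm l v).trans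
    (mul_le_mul_of_nonneg_right hl (norm_nonneg v))
  linarith

lemma IsTilting.discrepancy_le_of_norm_le (hT : IsTilting m IsSol τ T) (hn : n ≠ 0)
    {y : Fin n → Vec m} {l : Vec m} (hl : ‖l‖ ≤ r) (hy : ∀ i, r * ‖y i‖ ≤ 1 / 8)
    (h0 : avg (fun i => τ (inner ℝ l (y i)) • y i) = 0) (hR : ‖l‖ * ‖avg y‖ ≤ R) :
    discrepancy hEL (tilt τ y l) ≤ R :=
  (hT.discrepancy_le hn (fun i => abs_inner_lt_one hl (hy i)) h0).trans
    (((le_abs_self _).trans (abs_real_inner_le_norm l (avg y))).trans hR)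

/-- A log-discrepancy estimate exists if the sublevel sets of the criterion are confined to a
compact set on which small tilting parameters exist. -/
lemma IsTilting.exists_isLogEstimator (hT : IsTilting m IsSol τ T) (hn : n ≠ 0)
    (hK : IsCompact K) (hKΘ : K ⊆ Θ) (hcont : ∀ i, ContinuousOn (fun θ => Y θ i) K)
    (hsmall : ∀ θ ∈ K, ∀ i, r * ‖Y θ i‖ ≤ 1 / 8)
    (hex : ∀ θ ∈ K, ∃ l : Vec m, ‖l‖ ≤ r ∧ avg (fun i => τ (inner ℝ l (Y θ i)) • Y θ i) = 0)
    (hlevel : ∀ θ ∈ Θ, ∀ w ∈ weightSet (Set.Ioi 0) (Y θ), discrepancy hEL w ≤ R → θ ∈ K)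
    (hθs : θs ∈ K) (hls : ‖ls‖ ≤ r)
    (hls0 : avg (fun i => τ (inner ℝ ls (Y θs i)) • Y θs i) = 0)
    (hR : ‖ls‖ * ‖avg (Y θs)‖ ≤ R) :
    ∃ θ, IsLogEstimator (fun y w => IsSol y w) Θ Y θ := by
  -- The minimum is taken over pairs `(θ, l)` satisfying the moment condition. These form a compact
  -- set, so no continuous selection `θ ↦ l(θ)` is needed.
  let A : Set (Vec k × Vec m) := K ×ˢ Metric.closedBall 0 r
  have hA : IsCompact A := hK.prod (isCompact_closedBall _ _)
  have hin : ∀ q ∈ A, ∀ i, |inner ℝ q.2 (Y q.1 i)| < 1 := fun q hq i =>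
    abs_inner_lt_one (mem_closedBall_zero_iff.1 hq.2) (hsmall q.1 hq.1 i)
  have hYc : ∀ i, ContinuousOn (fun q : Vec k × Vec m => Y q.1 i) A := fun i =>
    (hcont i).comp continuousOn_fst fun q hq => hq.1
  have hτc : ∀ i, ContinuousOn (fun q : Vec k × Vec m => τ (inner ℝ q.2 (Y q.1 i))) A :=
    fun i => hT.continuousOn.comp (continuousOn_snd.inner (𝕜 := ℝ) (hYc i))
      fun q hq => abs_lt.1 (hin q hq i)
  let F : Vec k × Vec m → Vec m := fun q => avg fun i => τ (inner ℝ q.2 (Y q.1 i)) • Y q.1 i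
  have hFc : ContinuousOn F A := continuousOn_avg fun i => (hτc i).smul (hYc i)
  obtain ⟨A', hA'c, hA'⟩ : ∃ A', IsCompact A' ∧ ∀ q, q ∈ A' ↔ q ∈ A ∧ F q = 0 := by
    obtain ⟨Z, hZ, hZA⟩ := (continuousOn_iff_isClosed.1 hFc) {0} isClosed_singleton
    refine ⟨A ∩ Z, hA.inter_right hZ, fun q => ?_⟩
    have := Set.ext_iff.1 hZA q
    simp only [Set.mem_inter_iff, Set.mem_preimage, Set.mem_singleton_iff] at this
    rw [Set.mem_inter_iff]
    tauto
  have hpos : ∀ q ∈ A, ∀ i, 0 < τ (inner ℝ q.2 (Y q.1 i)) := fun q hq i => hT.pos _ (hin q hq i)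
  have hQc : ContinuousOn (fun q => discrepancy hEL (tilt τ (Y q.1) q.2)) A' := by
    have hA'A : A' ⊆ A := fun q hq => ((hA' q).1 hq).1
    have h1 : ContinuousOn (fun q : Vec k × Vec m => avg fun i => τ (inner ℝ q.2 (Y q.1 i))) A :=
      continuousOn_avg hτc
    have h2 : ContinuousOn (fun q : Vec k × Vec m =>
        avg fun i => Real.log (τ (inner ℝ q.2 (Y q.1 i)))) A :=
      continuousOn_avg fun i => (hτc i).log fun q hq => (hpos q hq i).ne'
    have h3 := (h1.log fun q hq => (avg_pos hn (hpos q hq)).ne').sub h2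
    refine (h3.mono hA'A).congr fun q hq => ?_
    exact discrepancy_hEL_tilt (τ := τ) (y := Y q.1) (l := q.2) hn (hpos q (hA'A hq))
  obtain ⟨q, hq, hmin⟩ := hA'c.exists_isMinOn
    ⟨(θs, ls), (hA' _).2 ⟨⟨hθs, mem_closedBall_zero_iff.2 hls⟩, hls0⟩⟩ hQc
  have hqA := ((hA' q).1 hq).1
  refine ⟨q.1, hKΘ hqA.1, tilt τ (Y q.1) q.2,
    (hT.isSol_iff hn (hin q hqA) ((hA' q).1 hq).2 _).2 rfl, tilt_pos (hpos q hqA), ?_⟩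
  intro θ hθ w hw hwpos
  -- On `K` the inner solution is unique, hence a competing pair of `A'`. Off `K` the discrepancy
  -- exceeds `R`, which is at least the value at `(θs, ls)`.
  by_cases hθK : θ ∈ K
  · obtain ⟨l, hl, hl0⟩ := hex θ hθK
    have hmem : (θ, l) ∈ A' := (hA' _).2 ⟨⟨hθK, mem_closedBall_zero_iff.2 hl⟩, hl0⟩
    have hw' := (hT.isSol_iff hn (hin (θ, l) ((hA' _).1 hmem).1) hl0 w).1 hw
    rw [hw']
    exact isMinOn_iff.1 hmin _ hmem
  · have h1 : R < discrepancy hEL w := by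
      by_contra! h
      exact hθK (hlevel θ hθ w (hT.mem_weightSet hw hwpos) h)
    have h2 := isMinOn_iff.1 hmin (θs, ls)
      ((hA' _).2 ⟨⟨hθs, mem_closedBall_zero_iff.2 hls⟩, hls0⟩)
    have h3 := hT.discrepancy_le_of_norm_le hn hls (hsmall θs hθs) hls0 hR
    exact h2.trans (h3.trans h1.le)

/-- A log-discrepancy estimate comes with a tilting parameter such that the pair minimizes the
criterion subject to the first-order condition of the inner problem. -/
lemma IsTilting.isLogEstimator_exists_tilting (hT : IsTilting m IsSol τ T) (hn : n ≠ 0)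
    (hKΘ : K ⊆ Θ) (hsmall : ∀ θ ∈ K, ∀ i, r * ‖Y θ i‖ ≤ 1 / 8)
    (hex : ∀ θ ∈ K, ∃ l : Vec m, ‖l‖ ≤ r ∧ avg (fun i => τ (inner ℝ l (Y θ i)) • Y θ i) = 0)
    (hlevel : ∀ θ ∈ Θ, ∀ w ∈ weightSet (Set.Ioi 0) (Y θ), discrepancy hEL w ≤ R → θ ∈ K)
    (hθs : θs ∈ K) (hls : ‖ls‖ ≤ r)
    (hls0 : avg (fun i => τ (inner ℝ ls (Y θs i)) • Y θs i) = 0)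
    (hR : ‖ls‖ * ‖avg (Y θs)‖ ≤ R) {θ : Vec k}
    (hθ : IsLogEstimator (fun y w => IsSol y w) Θ Y θ) :
    θ ∈ K ∧ ∃ l : Vec m, ‖l‖ ≤ r ∧ avg (fun i => τ (inner ℝ l (Y θ i)) • Y θ i) = 0 ∧
      ∀ θ' ∈ Θ, ∀ l' : Vec m, (∀ i, |inner ℝ l' (Y θ' i)| < 1) →
        avg (fun i => τ (inner ℝ l' (Y θ' i)) • Y θ' i) = 0 →
        discrepancy hEL (tilt τ (Y θ) l) ≤ discrepancy hEL (tilt τ (Y θ') l') := by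
  obtain ⟨hθΘ, w, hw, hwpos, hmin⟩ := hθ
  have hlts := fun i => abs_inner_lt_one hls (hsmall θs hθs i)
  have h1 := hmin θs (hKΘ hθs) (tilt τ (Y θs) ls) ((hT.isSol_iff hn hlts hls0 _).2 rfl)
    (tilt_pos fun i => hT.pos _ (hlts i))
  have h2 := hT.discrepancy_le_of_norm_le hn hls (hsmall θs hθs) hls0 hR
  have hθK := hlevel θ hθΘ w (hT.mem_weightSet hw hwpos) (h1.trans h2)
  obtain ⟨l, hl, hl0⟩ := hex θ hθK
  have hw' := (hT.isSol_iff hn (fun i => abs_inner_lt_one hl (hsmall θ hθK i)) hl0 w).1 hw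
  refine ⟨hθK, l, hl, hl0, fun θ' hθ' l' hl' hl0' => ?_⟩
  rw [← hw']
  exact hmin θ' hθ' _ ((hT.isSol_iff hn hl' hl0' _).2 rfl)
    (tilt_pos fun i => hT.pos _ (hl' i))

end Estimates

/-! ### First-order conditions -/

section FirstOrder

variable {n k m : ℕ} {Y : Vec k → Fin n → Vec m} {Θ : Set (Vec k)} {θ : Vec k} {l : Vec m}

/-- Lagrange multipliers for constraints with values in a Euclidean space. -/
lemma exists_inner_multiplier {E : Type*} [NormedAddCommGroup E] [NormedSpace ℝ E]
    [CompleteSpace E] {f : E → Vec m} {φ : E → ℝ} {x₀ : E} {f' : E →L[ℝ] Vec m}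
    {φ' : E →L[ℝ] ℝ} (hmin : IsLocalMinOn φ {x | f x = f x₀} x₀)
    (hf : HasStrictFDerivAt f f' x₀) (hφ : HasStrictFDerivAt φ φ' x₀) :
    ∃ (u : Vec m) (c : ℝ), (u ≠ 0 ∨ c ≠ 0) ∧ ∀ x, inner ℝ u (f' x) + c * φ' x = 0 := by
  obtain ⟨Λ, c, hne, h⟩ :=
    IsLocalExtrOn.exists_linear_map_of_hasStrictFDerivAt (Or.inl hmin) hf hφ
  let L : Vec m →L[ℝ] ℝ := LinearMap.toContinuousLinearMap Λ
  have hL : ∀ v, inner ℝ ((InnerProductSpace.toDual ℝ (Vec m)).symm L) v = Λ v := fun v => by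
    rw [InnerProductSpace.toDual_symm_apply]
    rfl
  refine ⟨(InnerProductSpace.toDual ℝ (Vec m)).symm L, c, ?_, fun x => ?_⟩
  · by_contra! hcon
    apply hne
    have : Λ = 0 := by
      ext v
      rw [← hL, hcon.1]
      simp
    rw [this, hcon.2]
    rfl
  · rw [hL]
    exact h x

/-- The derivative of `(θ, λ) ↦ λ'yᵢ(θ)`. -/
def innerDeriv (G : Vec k →L[ℝ] Vec m) (l y : Vec m) : Vec k × Vec m →L[ℝ] ℝ :=
  (innerSL ℝ l).comp (G.comp (ContinuousLinearMap.fst ℝ _ _)) +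
    (innerSL ℝ y).comp (ContinuousLinearMap.snd ℝ _ _)

lemma innerDeriv_apply (G : Vec k →L[ℝ] Vec m) (l y : Vec m) (v : Vec k) (d : Vec m) :
    innerDeriv G l y (v, d) = inner ℝ l (G v) + inner ℝ y d := rfl

lemma hasStrictFDerivAt_inner_snd {f : Vec k → Vec m} {G : Vec k →L[ℝ] Vec m}
    (hf : HasStrictFDerivAt f G θ) (l : Vec m) :
    HasStrictFDerivAt (fun q : Vec k × Vec m => inner ℝ q.2 (f q.1)) (innerDeriv G l (f θ))
      (θ, l) := by
  have h1 : HasStrictFDerivAt (fun q : Vec k × Vec m => f q.1)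
      (G.comp (ContinuousLinearMap.fst ℝ _ _)) (θ, l) :=
    HasStrictFDerivAt.comp (θ, l) (f := Prod.fst) hf hasStrictFDerivAt_fst
  have h2 := HasStrictFDerivAt.inner ℝ
    (hasStrictFDerivAt_snd (𝕜 := ℝ) (p := (θ, l))) h1
  have heq : innerDeriv G l (f θ) = (fderivInnerCLM ℝ (l, f θ)).comp
      ((ContinuousLinearMap.snd ℝ (Vec k) (Vec m)).prod
        (G.comp (ContinuousLinearMap.fst ℝ (Vec k) (Vec m)))) := by
    refine ContinuousLinearMap.ext fun q => ?_
    rw [ContinuousLinearMap.comp_apply, fderivInnerCLM_apply]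
    simp only [ContinuousLinearMap.prod_apply, ContinuousLinearMap.coe_fst',
      ContinuousLinearMap.coe_snd', ContinuousLinearMap.comp_apply]
    rw [real_inner_comm (f θ) q.2]
    rfl
  rw [heq]
  exact h2

/-- The derivative of the first-order condition of the inner problem. -/
lemma hasStrictFDerivAt_moment {G : Fin n → Vec k →L[ℝ] Vec m} {τ : ℝ → ℝ} {τ' : Fin n → ℝ}
    (hY : ∀ i, HasStrictFDerivAt (fun θ => Y θ i) (G i) θ)
    (hτ : ∀ i, HasStrictDerivAt τ (τ' i) (inner ℝ l (Y θ i))) :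
    HasStrictFDerivAt (fun q : Vec k × Vec m => avg fun i => τ (inner ℝ q.2 (Y q.1 i)) • Y q.1 i)
      (avg fun i => τ (inner ℝ l (Y θ i)) • (G i).comp (ContinuousLinearMap.fst ℝ _ _) +
        (τ' i • innerDeriv (G i) l (Y θ i)).smulRight (Y θ i)) (θ, l) := by
  have hsum : HasStrictFDerivAt
      (fun q : Vec k × Vec m => ∑ i, τ (inner ℝ q.2 (Y q.1 i)) • Y q.1 i)
      (∑ i, (τ (inner ℝ l (Y θ i)) • (G i).comp (ContinuousLinearMap.fst ℝ _ _) +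
        (τ' i • innerDeriv (G i) l (Y θ i)).smulRight (Y θ i))) (θ, l) := by
    refine HasStrictFDerivAt.fun_sum fun i _ => ?_
    have h1 : HasStrictFDerivAt (fun q : Vec k × Vec m => Y q.1 i)
        ((G i).comp (ContinuousLinearMap.fst ℝ _ _)) (θ, l) :=
      HasStrictFDerivAt.comp (θ, l) (f := Prod.fst) (hY i) hasStrictFDerivAt_fst
    have h2 : HasStrictFDerivAt (fun q : Vec k × Vec m => τ (inner ℝ q.2 (Y q.1 i)))
        (τ' i • innerDeriv (G i) l (Y θ i)) (θ, l) :=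
      HasStrictDerivAt.comp_hasStrictFDerivAt (θ, l) (hτ i) (hasStrictFDerivAt_inner_snd (hY i) l)
    exact h2.fun_smul h1
  exact hsum.const_smul (n : ℝ)⁻¹

lemma hasStrictFDerivAt_avg_comp_inner {G : Fin n → Vec k →L[ℝ] Vec m} {τ : ℝ → ℝ}
    {τ' : Fin n → ℝ} (hY : ∀ i, HasStrictFDerivAt (fun θ => Y θ i) (G i) θ)
    (hτ : ∀ i, HasStrictDerivAt τ (τ' i) (inner ℝ l (Y θ i))) :
    HasStrictFDerivAt (fun q : Vec k × Vec m => avg fun i => τ (inner ℝ q.2 (Y q.1 i)))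
      (avg fun i => τ' i • innerDeriv (G i) l (Y θ i)) (θ, l) := by
  have hsum : HasStrictFDerivAt (fun q : Vec k × Vec m => ∑ i, τ (inner ℝ q.2 (Y q.1 i)))
      (∑ i, τ' i • innerDeriv (G i) l (Y θ i)) (θ, l) :=
    HasStrictFDerivAt.fun_sum fun i _ =>
      HasStrictDerivAt.comp_hasStrictFDerivAt (θ, l) (hτ i) (hasStrictFDerivAt_inner_snd (hY i) l)
  exact hsum.const_smul (n : ℝ)⁻¹

/-- Admissibility is an open condition, so minimality among admissible pairs is local minimality on
the constraint surface, as Lagrange's rule requires. -/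
lemma eventually_mem_and_abs_inner_lt_one (hθ : Θ ∈ 𝓝 θ)
    (hY : ∀ i, ContinuousAt (fun θ => Y θ i) θ) (hl : ∀ i, |inner ℝ l (Y θ i)| < 1) :
    ∀ᶠ q : Vec k × Vec m in 𝓝 (θ, l), q.1 ∈ Θ ∧ ∀ i, |inner ℝ q.2 (Y q.1 i)| < 1 := by
  refine (continuousAt_fst.eventually_mem hθ).and (eventually_all.2 fun i => ?_)
  have h1 : ContinuousAt (fun q : Vec k × Vec m => Y q.1 i) (θ, l) :=
    ContinuousAt.comp (f := Prod.fst) (x := (θ, l)) (hY i) continuousAt_fst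
  have h2 : ContinuousAt (fun q : Vec k × Vec m => |inner ℝ q.2 (Y q.1 i)|) (θ, l) :=
    (continuousAt_snd.inner (𝕜 := ℝ) h1).abs
  exact h2.eventually_lt continuousAt_const (hl i)

/-- Positive weights do not destroy definiteness of the sample variance. This is what excludes
degenerate Lagrange multipliers. -/
lemma eq_zero_of_avg_mul_inner_sq_eq_zero (hn : n ≠ 0) {y : Fin n → Vec m} {c : ℝ}
    (hc : 0 < c) (hpd : ∀ u : Vec m, c * ‖u‖ ^ 2 ≤ avg fun i => inner ℝ u (y i) ^ 2)
    {a : Fin n → ℝ} (ha : ∀ i, 0 < a i) {u : Vec m}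
    (h : avg (fun i => a i * inner ℝ u (y i) ^ 2) = 0) : u = 0 := by
  have h1 : ∀ i, inner ℝ u (y i) = 0 := fun i => by
    have h2 := le_mul_avg (f := fun i => a i * inner ℝ u (y i) ^ 2)
      (fun i => mul_nonneg (ha i).le (sq_nonneg _)) i
    rw [h, mul_zero] at h2
    have h3 : inner ℝ u (y i) ^ 2 ≤ 0 := by
      by_contra! h4
      exact absurd h2 (not_le.2 (mul_pos (ha i) h4))
    exact pow_eq_zero_iff two_ne_zero |>.1 (le_antisymm h3 (sq_nonneg _))
  have h2 := hpd u
  simp only [h1] at h2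
  rw [avg_const hn] at h2
  have h3 : ‖u‖ ^ 2 ≤ 0 := by nlinarith [sq_nonneg ‖u‖]
  exact norm_eq_zero.1 (pow_eq_zero_iff two_ne_zero |>.1 (le_antisymm h3 (sq_nonneg _)))

/-- The first-order condition of the empirical likelihood estimate. -/
lemma avg_inner_jac_eq_zero_of_EL (hn : n ≠ 0) {G : Fin n → Vec k →L[ℝ] Vec m}
    (hΘ : Θ ∈ 𝓝 θ) (hY : ∀ i, HasStrictFDerivAt (fun θ => Y θ i) (G i) θ)
    (hl : ∀ i, |inner ℝ l (Y θ i)| < 1)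
    (h0 : avg (fun i => (1 + inner ℝ l (Y θ i))⁻¹ • Y θ i) = 0) {c : ℝ} (hc : 0 < c)
    (hpd : ∀ u : Vec m, c * ‖u‖ ^ 2 ≤ avg fun i => inner ℝ u (Y θ i) ^ 2)
    (hmin : ∀ θ' ∈ Θ, ∀ l' : Vec m, (∀ i, |inner ℝ l' (Y θ' i)| < 1) →
      avg (fun i => (1 + inner ℝ l' (Y θ' i))⁻¹ • Y θ' i) = 0 →
      discrepancy hEL (tilt (fun t => (1 + t)⁻¹) (Y θ) l)
        ≤ discrepancy hEL (tilt (fun t => (1 + t)⁻¹) (Y θ') l')) (v : Vec k) :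
    avg (fun i => (1 + inner ℝ l (Y θ i))⁻¹ * inner ℝ l (G i v)) = 0 := by
  have hpos : ∀ i, 0 < 1 + inner ℝ l (Y θ i) := fun i => one_add_pos_of_abs_lt_one (hl i)
  have hval : ∀ (θ' : Vec k) (l' : Vec m), (∀ i, |inner ℝ l' (Y θ' i)| < 1) →
      avg (fun i => (1 + inner ℝ l' (Y θ' i))⁻¹ • Y θ' i) = 0 →
      discrepancy hEL (tilt (fun t => (1 + t)⁻¹) (Y θ') l')
        = avg fun i => Real.log (1 + inner ℝ l' (Y θ' i)) := fun θ' l' hl' h0' => by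
    have hp := fun i => one_add_pos_of_abs_lt_one (hl' i)
    rw [discrepancy_hEL_tilt hn (τ := fun t => (1 + t)⁻¹) fun i => inv_pos.2 (hp i)]
    simp only [avg_inv_one_add_inner_eq_one hn hp h0', Real.log_inv, avg_neg, Real.log_one]
    ring
  have hf := hasStrictFDerivAt_moment (l := l) hY (τ := fun t => (1 + t)⁻¹)
    (τ' := fun i => -((1 + inner ℝ l (Y θ i))⁻¹) ^ 2) fun i => by
      have h := HasStrictDerivAt.comp (inner ℝ l (Y θ i)) (h₂ := Inv.inv)
        (hasStrictDerivAt_inv (hpos i).ne')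
        ((hasStrictDerivAt_id (inner ℝ l (Y θ i))).const_add 1)
      simpa [Function.comp_def] using h
  have hφ := hasStrictFDerivAt_avg_comp_inner (l := l) hY (τ := fun t => Real.log (1 + t))
    (τ' := fun i => (1 + inner ℝ l (Y θ i))⁻¹) fun i => by
      have h := ((hasStrictDerivAt_id (inner ℝ l (Y θ i))).const_add 1).log (hpos i).ne'
      simpa using h
  have hmin' : IsLocalMinOn
      (fun q : Vec k × Vec m => avg fun i => Real.log (1 + inner ℝ q.2 (Y q.1 i)))
      {q | (avg fun i => (1 + inner ℝ q.2 (Y q.1 i))⁻¹ • Y q.1 i)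
        = avg fun i => (1 + inner ℝ (θ, l).2 (Y (θ, l).1 i))⁻¹ • Y (θ, l).1 i} (θ, l) := by
    filter_upwards [self_mem_nhdsWithin, mem_nhdsWithin_of_mem_nhds
      (eventually_mem_and_abs_inner_lt_one hΘ (fun i => (hY i).continuousAt) hl)] with q hq hq'
    have hq0 := (show _ = _ from hq).trans h0
    have h := hmin q.1 hq'.1 q.2 hq'.2 hq0
    rwa [hval θ l hl h0, hval q.1 q.2 hq'.2 hq0] at h
  obtain ⟨u, a, hne, h⟩ := exists_inner_multiplier hmin' hf hφ
  simp only [avg_apply, inner_avg] at h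
  have hcrit : ∀ d : Vec m, avg (fun i => (1 + inner ℝ l (Y θ i))⁻¹ * inner ℝ (Y θ i) d) = 0 :=
    fun d => by
      have h1 := congrArg (fun z => inner ℝ d z) h0
      simp only [inner_avg, inner_smul_right, inner_zero_right] at h1
      simpa only [real_inner_comm d] using h1
  -- The `l`-gradient of the EL objective is the constraint function itself, so it vanishes at
  -- feasible points. The multiplier equation in direction `(0, u)` then leaves only a weighted
  -- quadratic form in `u`. Thus the EL multiplier is zero and the objective is stationary in `θ` as
  -- well.
  have hu : u = 0 := by
    refine eq_zero_of_avg_mul_inner_sq_eq_zero hn hc hpd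
      (a := fun i => ((1 + inner ℝ l (Y θ i))⁻¹) ^ 2) (fun i => pow_pos (inv_pos.2 (hpos i)) 2) ?_
    have h1 := h (0, u)
    simp only [add_apply, smul_apply, ContinuousLinearMap.comp_apply,
      ContinuousLinearMap.coe_fst', map_zero, smul_zero, zero_add,
      ContinuousLinearMap.smulRight_apply, innerDeriv_apply, inner_zero_right, smul_eq_mul,
      inner_smul_right, hcrit, mul_zero, add_zero] at h1
    rw [← neg_eq_zero, ← avg_neg, ← h1]
    congr 1
    funext i
    rw [real_inner_comm u]
    ring
  have ha : a ≠ 0 := hne.resolve_left (not_not.2 hu)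
  have h2 := h (v, 0)
  simp only [hu, inner_zero_left, innerDeriv_apply, smul_apply, smul_eq_mul, inner_zero_right,
    add_zero, avg_const hn, zero_add, mul_eq_zero, ha, false_or] at h2
  exact h2

/-- The first-order conditions of the exponentially tilted empirical likelihood estimate. -/
lemma exists_multiplier_of_ETEL (hn : n ≠ 0) {G : Fin n → Vec k →L[ℝ] Vec m}
    (hΘ : Θ ∈ 𝓝 θ) (hY : ∀ i, HasStrictFDerivAt (fun θ => Y θ i) (G i) θ)
    (hl : ∀ i, |inner ℝ l (Y θ i)| < 1)
    (h0 : avg (fun i => Real.exp (-inner ℝ l (Y θ i)) • Y θ i) = 0) {c : ℝ} (hc : 0 < c)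
    (hpd : ∀ u : Vec m, c * ‖u‖ ^ 2 ≤ avg fun i => inner ℝ u (Y θ i) ^ 2)
    (hmin : ∀ θ' ∈ Θ, ∀ l' : Vec m, (∀ i, |inner ℝ l' (Y θ' i)| < 1) →
      avg (fun i => Real.exp (-inner ℝ l' (Y θ' i)) • Y θ' i) = 0 →
      discrepancy hEL (tilt (fun t => Real.exp (-t)) (Y θ) l)
        ≤ discrepancy hEL (tilt (fun t => Real.exp (-t)) (Y θ') l')) :
    ∃ ν : Vec m,
      (∀ d, avg (fun i => Real.exp (-inner ℝ l (Y θ i)) * inner ℝ ν (Y θ i) * inner ℝ d (Y θ i))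
        = avg fun i => inner ℝ d (Y θ i)) ∧
      ∀ v, avg (fun i => (1 - Real.exp (-inner ℝ l (Y θ i)) /
            (avg fun j => Real.exp (-inner ℝ l (Y θ j)))
          - Real.exp (-inner ℝ l (Y θ i)) * inner ℝ ν (Y θ i)) * inner ℝ l (G i v)
          + Real.exp (-inner ℝ l (Y θ i)) * inner ℝ ν (G i v)) = 0 := by
  have hval : ∀ (θ' : Vec k) (l' : Vec m),
      discrepancy hEL (tilt (fun t => Real.exp (-t)) (Y θ') l')
        = Real.log (avg fun i => Real.exp (-inner ℝ l' (Y θ' i)))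
          + avg fun i => inner ℝ l' (Y θ' i) := fun θ' l' => by
    rw [discrepancy_hEL_tilt hn (τ := fun t => Real.exp (-t)) fun i => Real.exp_pos _]
    simp only [Real.log_exp, avg_neg, sub_neg_eq_add]
  have hexp : ∀ i, HasStrictDerivAt (fun t => Real.exp (-t)) (-Real.exp (-inner ℝ l (Y θ i)))
      (inner ℝ l (Y θ i)) := fun i => by
    simpa using (hasStrictDerivAt_neg (inner ℝ l (Y θ i))).exp
  set M := avg fun j => Real.exp (-inner ℝ l (Y θ j)) with hMdef
  have hM : 0 < M := avg_pos hn fun _ => Real.exp_pos _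
  have hf := hasStrictFDerivAt_moment (l := l) hY (τ := fun t => Real.exp (-t)) hexp
  have hφ := ((hasStrictFDerivAt_avg_comp_inner (l := l) hY (τ := fun t => Real.exp (-t))
    hexp).log hM.ne').fun_add (hasStrictFDerivAt_avg_comp_inner (l := l) hY (τ := fun t => t)
      (τ' := fun _ => 1) fun i => hasStrictDerivAt_id _)
  have hmin' : IsLocalMinOn
      (fun q : Vec k × Vec m => Real.log (avg fun i => Real.exp (-inner ℝ q.2 (Y q.1 i)))
          + avg fun i => inner ℝ q.2 (Y q.1 i))
      {q | (avg fun i => Real.exp (-inner ℝ q.2 (Y q.1 i)) • Y q.1 i)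
        = avg fun i => Real.exp (-inner ℝ (θ, l).2 (Y (θ, l).1 i)) • Y (θ, l).1 i} (θ, l) := by
    filter_upwards [self_mem_nhdsWithin, mem_nhdsWithin_of_mem_nhds
      (eventually_mem_and_abs_inner_lt_one hΘ (fun i => (hY i).continuousAt) hl)] with q hq hq'
    have hq0 := (show _ = _ from hq).trans h0
    have h := hmin q.1 hq'.1 q.2 hq'.2 hq0
    rwa [hval, hval] at h
  obtain ⟨u, a, hne, h⟩ := exists_inner_multiplier hmin' hf hφ
  have hcrit : ∀ d : Vec m, avg (fun i => Real.exp (-inner ℝ l (Y θ i)) * inner ℝ d (Y θ i)) = 0 :=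
    fun d => by
      have h1 := congrArg (fun z => inner ℝ d z) h0
      simpa only [inner_avg, inner_smul_right, inner_zero_right] using h1
  -- The `l`-derivative of the log-normalizer vanishes by the moment condition, but the linear part
  -- contributes `avg y`. Hence the ETEL multiplier does not vanish in general.
  have hl1 : ∀ d : Vec m, a * avg (fun i => inner ℝ d (Y θ i))
      = avg fun i => Real.exp (-inner ℝ l (Y θ i)) * inner ℝ u (Y θ i) * inner ℝ d (Y θ i) := by
    intro d
    have h1 := h (0, d)
    simp only [avg_apply, inner_avg, add_apply, smul_apply, ContinuousLinearMap.comp_apply,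
      ContinuousLinearMap.coe_fst', map_zero, smul_zero, zero_add,
      ContinuousLinearMap.smulRight_apply, innerDeriv_apply, inner_zero_right, smul_eq_mul,
      inner_smul_right, neg_mul, one_mul, avg_neg, mul_neg, real_inner_comm d] at h1
    rw [hcrit] at h1
    simp only [mul_zero, neg_zero, zero_add] at h1
    rw [neg_add_eq_zero] at h1
    rw [← h1]
    congr 1
    funext i
    ring
  have ha : a ≠ 0 := by
    refine hne.elim (fun hu ha => hu ?_) id
    refine eq_zero_of_avg_mul_inner_sq_eq_zero hn hc hpd
      (a := fun i => Real.exp (-inner ℝ l (Y θ i))) (fun i => Real.exp_pos _) ?_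
    have h1 := hl1 u
    rw [ha, zero_mul] at h1
    rw [h1]
    congr 1
    funext i
    ring
  -- Dividing by the multiplier of the objective normalizes its coefficient to one.
  refine ⟨a⁻¹ • u, fun d => ?_, fun v => ?_⟩
  · refine mul_left_cancel₀ ha ?_
    rw [hl1, ← avg_mul_left]
    congr 1
    funext i
    rw [real_inner_smul_left]
    field_simp
  · have h1 := h (v, 0)
    simp only [avg_apply, inner_avg, add_apply, smul_apply, ContinuousLinearMap.comp_apply,
      ContinuousLinearMap.coe_fst', ContinuousLinearMap.smulRight_apply, innerDeriv_apply,
      inner_zero_right, smul_eq_mul, inner_smul_right, add_zero, inner_add_right, one_mul] at h1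
    rw [← avg_mul_left, ← avg_add, ← avg_mul_left, ← avg_add, ← hMdef] at h1
    refine mul_left_cancel₀ ha ?_
    rw [mul_zero, ← h1, ← avg_mul_left]
    congr 1
    funext i
    rw [real_inner_smul_left, real_inner_smul_left]
    field_simp
    ring

end FirstOrder

/-! ### Stochastic expansions -/

section Expansion

variable {n k m : ℕ}

lemma abs_avg_le_mul {f D : Fin n → ℝ} {c K : ℝ} (hc : 0 ≤ c) (hf : ∀ i, |f i| ≤ c * D i)
    (hD : avg D ≤ K) : |avg f| ≤ c * K := by
  have h := norm_avg_le_of_le (f := f) hf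
  rw [avg_mul_left] at h
  exact h.trans (mul_le_mul_of_nonneg_left hD hc)

lemma norm_avg_le_mul {E : Type*} [NormedAddCommGroup E] [NormedSpace ℝ E] {f : Fin n → E}
    {D : Fin n → ℝ} {c K : ℝ} (hc : 0 ≤ c) (hf : ∀ i, ‖f i‖ ≤ c * D i)
    (hD : avg D ≤ K) : ‖avg f‖ ≤ c * K := by
  have h := norm_avg_le_of_le (f := f) hf
  rw [avg_mul_left] at h
  exact h.trans (mul_le_mul_of_nonneg_left hD hc)

lemma exp_neg_bounds {t : ℝ} (ht : |t| ≤ 1 / 8) :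
    1 / 2 ≤ Real.exp (-t) ∧ Real.exp (-t) ≤ 2 ∧ |Real.exp (-t) - 1| ≤ 2 * |t| ∧
      |Real.exp (-t) - 1 + t| ≤ t ^ 2 ∧ |1 - Real.exp (-t) * (1 + t)| ≤ t ^ 2 := by
  have h1 := Real.abs_exp_sub_one_sub_id_le (x := -t) (by rw [abs_neg]; linarith)
  rw [sub_neg_eq_add, neg_sq] at h1
  have h2 : |Real.exp (-t) - 1| ≤ 2 * |t| := by
    have h := abs_sub (Real.exp (-t) - 1 + t) t
    rw [add_sub_cancel_right] at h
    have : t ^ 2 ≤ |t| := by rw [← sq_abs]; nlinarith [abs_nonneg t]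
    linarith
  have h3 := abs_le.1 h2
  have h4 := abs_le.1 ht
  refine ⟨by linarith, by linarith, h2, h1, ?_⟩
  have h5 : Real.exp (-t) * (1 + t) ≤ 1 := by
    have h := mul_le_mul_of_nonneg_left (Real.add_one_le_exp t) (Real.exp_pos (-t)).le
    rw [← Real.exp_add, neg_add_cancel, Real.exp_zero] at h
    linarith
  rw [abs_of_nonneg (by linarith)]
  nlinarith [Real.add_one_le_exp (-t)]

lemma inv_one_add_bounds {t : ℝ} (ht : |t| ≤ 1 / 4) :
    0 < (1 + t)⁻¹ ∧ (1 + t)⁻¹ ≤ 2 ∧ |(1 + t)⁻¹ - 1| ≤ 2 * |t| ∧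
      |(1 + t)⁻¹ - 1 + t| ≤ 2 * t ^ 2 := by
  have h1 := abs_le.1 ht
  have hp : 0 < 1 + t := by linarith
  have h2 : (1 + t)⁻¹ ≤ 2 := by
    rw [inv_le_comm₀ hp two_pos]
    linarith
  have h3 : 0 < (1 + t)⁻¹ := inv_pos.2 hp
  refine ⟨h3, h2, ?_, ?_⟩
  · have : (1 + t)⁻¹ - 1 = (1 + t)⁻¹ * -t := by field_simp; ring
    rw [this, abs_mul, abs_neg, abs_of_pos h3]
    exact mul_le_mul_of_nonneg_right h2 (abs_nonneg t)
  · have : (1 + t)⁻¹ - 1 + t = (1 + t)⁻¹ * t ^ 2 := by field_simp; ring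
    rw [this, abs_mul, abs_of_pos h3, abs_of_nonneg (sq_nonneg t)]
    exact mul_le_mul_of_nonneg_right h2 (sq_nonneg t)

lemma abs_inv_one_add_sub_le {t u : ℝ} (ht : |t| ≤ 1 / 4) (hu : |u| ≤ 1 / 4) :
    |(1 + t)⁻¹ - (1 + u)⁻¹| ≤ 4 * |t - u| := by
  obtain ⟨h1, h2, -⟩ := inv_one_add_bounds ht
  obtain ⟨h3, h4, -⟩ := inv_one_add_bounds hu
  have ht' : 1 + t ≠ 0 := (inv_pos.1 h1).ne'
  have hu' : 1 + u ≠ 0 := (inv_pos.1 h3).ne'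
  have : (1 + t)⁻¹ - (1 + u)⁻¹ = (1 + t)⁻¹ * (1 + u)⁻¹ * (u - t) := by field_simp; ring
  rw [this, abs_mul, abs_mul, abs_of_pos h1, abs_of_pos h3, abs_sub_comm u t]
  refine mul_le_mul_of_nonneg_right ?_ (abs_nonneg _)
  nlinarith

/-- The monomials that appear in the remainder terms. -/
lemma le_one_add_pow_four_add_sq (a g : ℝ) :
    a ^ 2 ≤ 1 + a ^ 4 + g ^ 2 ∧ a ^ 3 ≤ 1 + a ^ 4 + g ^ 2 ∧ a ^ 2 * g ≤ 1 + a ^ 4 + g ^ 2 ∧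
      a * g ≤ 1 + a ^ 4 + g ^ 2 ∧ g ≤ 1 + a ^ 4 + g ^ 2 ∧ g ^ 2 ≤ 1 + a ^ 4 + g ^ 2 := by
  have h2 : a ^ 2 ≤ 1 + a ^ 4 + g ^ 2 := by
    nlinarith [sq_nonneg (a ^ 2 - 1), sq_nonneg g, sq_nonneg a]
  refine ⟨h2, ?_, ?_, ?_, ?_, ?_⟩
  · nlinarith [sq_nonneg (a ^ 2 - a), sq_nonneg (a - 1), sq_nonneg g, sq_nonneg a,
      sq_nonneg (a ^ 2 - 1)]
  · nlinarith [sq_nonneg (a ^ 2 - g), sq_nonneg g, sq_nonneg (a ^ 2)]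
  · nlinarith [sq_nonneg (a - g), sq_nonneg g, sq_nonneg (a ^ 2)]
  · nlinarith [sq_nonneg (g - 1), sq_nonneg g, sq_nonneg (a ^ 2)]
  · nlinarith [sq_nonneg (a ^ 2)]

lemma abs_inner_le {E : Type*} [NormedAddCommGroup E] [InnerProductSpace ℝ E] {u v : E}
    {a b : ℝ} (hu : ‖u‖ ≤ a) (hv : ‖v‖ ≤ b) : |inner ℝ u v| ≤ a * b :=
  (abs_real_inner_le_norm u v).trans
    (mul_le_mul hu hv (norm_nonneg _) ((norm_nonneg _).trans hu))

lemma abs_inner_apply_le {u : Vec m} {G : Vec k →L[ℝ] Vec m} {a g : ℝ} (hu : ‖u‖ ≤ a)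
    (hG : ‖G‖ ≤ g) (v : Vec k) : |inner ℝ u (G v)| ≤ a * (g * ‖v‖) :=
  abs_inner_le hu (G.le_of_opNorm_le hG v)

/-! ### The ETEL multiplier in the EL first-order conditions -/

section Residual

variable {y : Fin n → Vec m} {G : Fin n → Vec k →L[ℝ] Vec m} {a g : Fin n → ℝ}
  {c K s : ℝ} {l ν : Vec m}

/-- The multiplier of the constraint is close to the tilting parameter. -/
lemma norm_multiplier_sub_le (hc : 0 < c)
    (hpd : ∀ u : Vec m, c * ‖u‖ ^ 2 ≤ avg fun i => inner ℝ u (y i) ^ 2)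
    (ha : ∀ i, ‖y i‖ ≤ a i) (hK : avg (fun i => 1 + a i ^ 4 + g i ^ 2) ≤ K)
    (hsa : ∀ i, s * a i ≤ 1 / 8) (hl : ‖l‖ ≤ s)
    (h0 : avg (fun i => Real.exp (-inner ℝ l (y i)) • y i) = 0)
    (hν : ∀ d, avg (fun i => Real.exp (-inner ℝ l (y i)) * inner ℝ ν (y i) * inner ℝ d (y i))
        = avg fun i => inner ℝ d (y i)) :
    ‖ν - l‖ ≤ 2 * K / c * s ^ 2 := by
  set u := ν - l with hu
  have hx : ∀ i, |inner ℝ l (y i)| ≤ s * a i := fun i => abs_inner_le hl (ha i)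
  have ha0 : ∀ i, 0 ≤ a i := fun i => (norm_nonneg _).trans (ha i)
  have hcrit : avg (fun i => Real.exp (-inner ℝ l (y i)) * inner ℝ u (y i)) = 0 := by
    have h1 := congrArg (fun z => inner ℝ u z) h0
    simpa only [inner_avg, inner_smul_right, inner_zero_right] using h1
  -- The multiplier equation is tested at `u = ν - l`. Because `avg exp(-x) u'y = 0` with `x = l'y`,
  -- the right side can be written with the coefficient `1 - exp(-x)(1 + x) = O(x²)`; the left side
  -- is coercive in `u`.
  have h1 : avg (fun i => Real.exp (-inner ℝ l (y i)) * inner ℝ u (y i) ^ 2)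
      = avg fun i => (1 - Real.exp (-inner ℝ l (y i)) * (1 + inner ℝ l (y i)))
          * inner ℝ u (y i) := by
    have h2 : avg (fun i => (1 - Real.exp (-inner ℝ l (y i)) * (1 + inner ℝ l (y i)))
          * inner ℝ u (y i)) = avg (fun i => inner ℝ u (y i))
        - avg (fun i => Real.exp (-inner ℝ l (y i)) * inner ℝ u (y i))
        - avg (fun i => Real.exp (-inner ℝ l (y i)) * inner ℝ l (y i) * inner ℝ u (y i)) := by
      rw [← avg_sub, ← avg_sub]
      congr 1
      funext i
      ring
    rw [h2, hcrit, sub_zero, ← hν u, ← avg_sub]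
    congr 1
    funext i
    rw [hu, inner_sub_left]
    ring
  have h2 : c / 2 * ‖u‖ ^ 2 ≤ avg fun i => Real.exp (-inner ℝ l (y i)) * inner ℝ u (y i) ^ 2 := by
    have h3 := hpd u
    have h4 : avg (fun i => 1 / 2 * inner ℝ u (y i) ^ 2)
        ≤ avg fun i => Real.exp (-inner ℝ l (y i)) * inner ℝ u (y i) ^ 2 :=
      avg_mono fun i => mul_le_mul_of_nonneg_right
        (exp_neg_bounds ((hx i).trans (hsa i))).1 (sq_nonneg _)
    rw [avg_mul_left] at h4
    linarith
  have h3 : |avg fun i => (1 - Real.exp (-inner ℝ l (y i)) * (1 + inner ℝ l (y i)))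
      * inner ℝ u (y i)| ≤ s ^ 2 * ‖u‖ * K := by
    refine abs_avg_le_mul (D := fun i => 1 + a i ^ 4 + g i ^ 2) (by positivity) (fun i => ?_) hK
    rw [abs_mul]
    have h5 := (exp_neg_bounds ((hx i).trans (hsa i))).2.2.2.2
    have h6 : inner ℝ l (y i) ^ 2 ≤ (s * a i) ^ 2 := by
      rw [← sq_abs]; exact pow_le_pow_left₀ (abs_nonneg _) (hx i) 2
    have h7 : |inner ℝ u (y i)| ≤ ‖u‖ * a i := abs_inner_le le_rfl (ha i)
    calc _ ≤ (s * a i) ^ 2 * (‖u‖ * a i) :=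
          mul_le_mul (h5.trans h6) h7 (abs_nonneg _) (sq_nonneg _)
      _ = s ^ 2 * ‖u‖ * a i ^ 3 := by ring
      _ ≤ _ := by
        gcongr
        exact (le_one_add_pow_four_add_sq (a i) (g i)).2.1
  rw [← h1] at h3
  have h4 := (le_abs_self _).trans h3
  rcases (norm_nonneg u).eq_or_lt with hu0 | hu0
  · have hK0 : 0 ≤ K := (avg_nonneg fun i => by have := ha0 i; positivity).trans hK
    rw [← hu0]
    positivity
  · have h5 : c / 2 * ‖u‖ ≤ s ^ 2 * K := by
      refine le_of_mul_le_mul_right ?_ hu0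
      nlinarith
    rw [div_mul_eq_mul_div, le_div_iff₀ hc]
    linarith

/-- Bounds on the two coefficients in the residual of the first-order condition in `θ`. -/
lemma abs_residual_coeff_le {a s K x z p M : ℝ} (ha : 0 ≤ a) (hs : 0 ≤ s) (hs1 : s ≤ 1)
    (hK : 0 ≤ K)
    (hx : |x| ≤ s * a) (hz : |z| ≤ 2 * s * a) (hsa : s * a ≤ 1 / 8) (hp : p = Real.exp (-x))
    (hM : |M - 1| ≤ 3 * K * s ^ 2) (hM2 : 1 / 2 ≤ M) :
    |(1 + z)⁻¹ - p - 1 + p / M + p * z| ≤ s ^ 2 * (12 * a ^ 2 + 12 * K) ∧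
      |1 - p / M - p * z| ≤ s * (6 * a + 12 * K) := by
  obtain ⟨hp1, hp2, hp3, -, -⟩ := exp_neg_bounds (hx.trans hsa)
  rw [← hp] at hp1 hp2 hp3
  obtain ⟨-, -, -, hq⟩ := inv_one_add_bounds (t := z) (by linarith)
  have hM0 : 0 < M := by linarith
  have hz2 : z ^ 2 ≤ 4 * s ^ 2 * a ^ 2 := by
    rw [← sq_abs]
    calc |z| ^ 2 ≤ (2 * s * a) ^ 2 := pow_le_pow_left₀ (abs_nonneg _) hz 2
      _ = _ := by ring
  have hMinv : |1 / M - 1| ≤ 6 * K * s ^ 2 := by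
    have : 1 / M - 1 = (1 - M) / M := by field_simp
    rw [this, abs_div, abs_of_pos hM0, div_le_iff₀ hM0, abs_sub_comm]
    have : 0 ≤ K * s ^ 2 := by positivity
    nlinarith
  have hpM : |p * (1 / M - 1)| ≤ 12 * K * s ^ 2 := by
    rw [abs_mul, abs_of_nonneg (by linarith : 0 ≤ p)]
    calc p * |1 / M - 1| ≤ 2 * (6 * K * s ^ 2) :=
          mul_le_mul hp2 hMinv (abs_nonneg _) (by norm_num)
      _ = _ := by ring
  have hpz : |(p - 1) * z| ≤ 4 * s ^ 2 * a ^ 2 := by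
    rw [abs_mul]
    calc |p - 1| * |z| ≤ (2 * (s * a)) * (2 * s * a) :=
          mul_le_mul (by linarith) hz (abs_nonneg _) (by positivity)
      _ = _ := by ring
  constructor
  · have : (1 + z)⁻¹ - p - 1 + p / M + p * z
        = ((1 + z)⁻¹ - 1 + z) + (p - 1) * z + p * (1 / M - 1) := by ring
    rw [this]
    refine (abs_add_three _ _ _).trans ?_
    nlinarith
  · have : 1 - p / M - p * z = -(p - 1) - p * (1 / M - 1) - p * z := by ring
    rw [this]
    have h1 : |p * z| ≤ 4 * s * a := by
      rw [abs_mul, abs_of_nonneg (by linarith : 0 ≤ p)]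
      calc p * |z| ≤ 2 * (2 * s * a) := mul_le_mul hp2 hz (abs_nonneg _) (by norm_num)
        _ = _ := by ring
    have h2 : 12 * K * s ^ 2 ≤ 12 * K * s := by
      have : 0 ≤ K * s := by positivity
      nlinarith
    refine (abs_sub _ _).trans ?_
    have h3 := abs_sub (-(p - 1)) (p * (1 / M - 1))
    rw [abs_neg] at h3
    nlinarith

/-- The exponentially tilted empirical likelihood estimate and its multiplier satisfy the
first-order conditions of empirical likelihood up to a term of third order. -/
lemma exists_bound_EL_residual (c K : ℝ) (hc : 0 < c) (hK0 : 0 ≤ K) :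
    ∃ R : ℝ, 0 ≤ R ∧ ∀ {n k m : ℕ} {y : Fin n → Vec m} {G : Fin n → Vec k →L[ℝ] Vec m}
      {a g : Fin n → ℝ} {s : ℝ} {l ν : Vec m}, n ≠ 0 →
      (∀ u : Vec m, c * ‖u‖ ^ 2 ≤ avg fun i => inner ℝ u (y i) ^ 2) →
      (∀ i, ‖y i‖ ≤ a i) → (∀ i, ‖G i‖ ≤ g i) →
      avg (fun i => 1 + a i ^ 4 + g i ^ 2) ≤ K →
      0 ≤ s → s ≤ 1 → 2 * K / c * s ≤ 1 → (∀ i, s * a i ≤ 1 / 8) → ‖l‖ ≤ s →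
      avg (fun i => Real.exp (-inner ℝ l (y i)) • y i) = 0 →
      (∀ d, avg (fun i => Real.exp (-inner ℝ l (y i)) * inner ℝ ν (y i) * inner ℝ d (y i))
        = avg fun i => inner ℝ d (y i)) →
      (∀ v, avg (fun i => (1 - Real.exp (-inner ℝ l (y i)) /
            (avg fun j => Real.exp (-inner ℝ l (y j)))
          - Real.exp (-inner ℝ l (y i)) * inner ℝ ν (y i)) * inner ℝ l (G i v)
          + Real.exp (-inner ℝ l (y i)) * inner ℝ ν (G i v)) = 0) →
      ‖ν‖ ≤ 2 * s ∧
      (∀ d, |avg fun i => (1 + inner ℝ ν (y i))⁻¹ * inner ℝ d (y i)| ≤ R * s ^ 3 * ‖d‖) ∧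
      ∀ v, |avg fun i => (1 + inner ℝ ν (y i))⁻¹ * inner ℝ ν (G i v)| ≤ R * s ^ 3 * ‖v‖ := by
  set A := 2 * K / c with hA
  have hA0 : 0 ≤ A := by positivity
  -- The sum of the constants for the moment equation and for the score equation.
  refine ⟨(18 + 2 * A) * K + (24 + 24 * K + A * (6 + 12 * K)) * K, by positivity, ?_⟩
  intro n k m y G a g s l ν hn hpd ha hg hK hs hs1 hAs hsa hl h0 hν hv
  have ha0 : ∀ i, 0 ≤ a i := fun i => (norm_nonneg _).trans (ha i)
  have hg0 : ∀ i, 0 ≤ g i := fun i => (norm_nonneg _).trans (hg i)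
  have hu : ‖ν - l‖ ≤ A * s ^ 2 := norm_multiplier_sub_le hc hpd ha hK hsa hl h0 hν
  have hνs : ‖ν‖ ≤ 2 * s := by
    have h1 : ‖ν‖ ≤ ‖ν - l‖ + ‖l‖ := by simpa using norm_add_le (ν - l) l
    nlinarith
  have hx : ∀ i, |inner ℝ l (y i)| ≤ s * a i := fun i => abs_inner_le hl (ha i)
  have hz : ∀ i, |inner ℝ ν (y i)| ≤ 2 * s * a i := fun i => abs_inner_le hνs (ha i)
  have hzx : ∀ i, |inner ℝ ν (y i) - inner ℝ l (y i)| ≤ A * s ^ 2 * a i := fun i => by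
    rw [← inner_sub_left]; exact abs_inner_le hu (ha i)
  have hx2 : ∀ i, inner ℝ l (y i) ^ 2 ≤ s ^ 2 * a i ^ 2 := fun i => by
    rw [← sq_abs, ← mul_pow]; exact pow_le_pow_left₀ (abs_nonneg _) (hx i) 2
  have hz2 : ∀ i, inner ℝ ν (y i) ^ 2 ≤ 4 * s ^ 2 * a i ^ 2 := fun i => by
    rw [← sq_abs]
    calc _ ≤ (2 * s * a i) ^ 2 := pow_le_pow_left₀ (abs_nonneg _) (hz i) 2
      _ = _ := by ring
  choose ha2 ha3 ha2g hag hg1 hg2 using fun i => le_one_add_pow_four_add_sq (a i) (g i)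
  have hR1 : 0 ≤ (24 + 24 * K + A * (6 + 12 * K)) * K := by positivity
  have hR2 : 0 ≤ (18 + 2 * A) * K := by positivity
  refine ⟨hνs, fun d => ?_, fun v => ?_⟩
  · have h1 : (avg fun i => (1 + inner ℝ ν (y i))⁻¹ * inner ℝ d (y i))
        = avg fun i => ((1 + inner ℝ ν (y i))⁻¹ - 1
            + Real.exp (-inner ℝ l (y i)) * inner ℝ ν (y i)) * inner ℝ d (y i) := by
      have h2 : (avg fun i => ((1 + inner ℝ ν (y i))⁻¹ - 1
            + Real.exp (-inner ℝ l (y i)) * inner ℝ ν (y i)) * inner ℝ d (y i))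
          = (avg fun i => (1 + inner ℝ ν (y i))⁻¹ * inner ℝ d (y i))
            - (avg fun i => inner ℝ d (y i))
            + avg fun i => Real.exp (-inner ℝ l (y i)) * inner ℝ ν (y i) * inner ℝ d (y i) := by
        rw [← avg_sub, ← avg_add]
        congr 1
        funext i
        ring
      rw [h2, hν d]
      ring
    rw [h1]
    have h2 : |avg fun i => ((1 + inner ℝ ν (y i))⁻¹ - 1
            + Real.exp (-inner ℝ l (y i)) * inner ℝ ν (y i)) * inner ℝ d (y i)|
        ≤ s ^ 3 * ‖d‖ * (18 + 2 * A) * K := by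
      refine abs_avg_le_mul (D := fun i => 1 + a i ^ 4 + g i ^ 2) (by positivity) (fun i => ?_) hK
      obtain ⟨-, -, -, hp4, -⟩ := exp_neg_bounds ((hx i).trans (hsa i))
      obtain ⟨hq1, -, -, hq4⟩ := inv_one_add_bounds (t := inner ℝ ν (y i))
        ((hz i).trans (by linarith [hsa i]))
      have hne : 1 + inner ℝ ν (y i) ≠ 0 := (inv_pos.1 hq1).ne'
      -- With `z = ν'y`, the multiplier equation has turned the coefficient into `z (exp(-x) -
      -- (1+z)⁻¹)`. The two functions agree to first order and `z - x` is of order `s²`, so the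
      -- bracket is of order `s²` and the product of order `s³`.
      have hfac : (1 + inner ℝ ν (y i))⁻¹ - 1 + Real.exp (-inner ℝ l (y i)) * inner ℝ ν (y i)
          = inner ℝ ν (y i) * ((Real.exp (-inner ℝ l (y i)) - 1 + inner ℝ l (y i))
            + (inner ℝ ν (y i) - inner ℝ l (y i))
            - ((1 + inner ℝ ν (y i))⁻¹ - 1 + inner ℝ ν (y i))) := by
        field_simp
        ring
      have h3 : |(Real.exp (-inner ℝ l (y i)) - 1 + inner ℝ l (y i))
            + (inner ℝ ν (y i) - inner ℝ l (y i))
            - ((1 + inner ℝ ν (y i))⁻¹ - 1 + inner ℝ ν (y i))|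
          ≤ s ^ 2 * (9 * a i ^ 2 + A * a i) := by
        refine (abs_sub _ _).trans ?_
        have h4 := abs_add_le (Real.exp (-inner ℝ l (y i)) - 1 + inner ℝ l (y i))
          (inner ℝ ν (y i) - inner ℝ l (y i))
        nlinarith [hx2 i, hz2 i, hzx i]
      rw [hfac, abs_mul, abs_mul]
      calc _ ≤ 2 * s * a i * (s ^ 2 * (9 * a i ^ 2 + A * a i)) * (‖d‖ * a i) := by
            have := ha0 i
            exact mul_le_mul (mul_le_mul (hz i) h3 (abs_nonneg _) (by positivity))
              (abs_inner_le le_rfl (ha i)) (abs_nonneg _) (by positivity)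
        _ = s ^ 3 * ‖d‖ * (18 * a i ^ 4 + 2 * A * a i ^ 3) := by ring
        _ ≤ s ^ 3 * ‖d‖ * ((18 + 2 * A) * (1 + a i ^ 4 + g i ^ 2)) := by
            gcongr
            nlinarith [mul_le_mul_of_nonneg_left (ha3 i) hA0, sq_nonneg (g i)]
        _ = _ := by ring
    refine h2.trans ?_
    have : 0 ≤ s ^ 3 * ‖d‖ := by positivity
    nlinarith
  · set M := avg fun j => Real.exp (-inner ℝ l (y j)) with hMdef
    have hM2 : 1 / 2 ≤ M := by
      have h1 : avg (fun _ : Fin n => (1 / 2 : ℝ)) ≤ M :=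
        avg_mono fun i => (exp_neg_bounds ((hx i).trans (hsa i))).1
      rwa [avg_const hn] at h1
    -- The normalizer deviates from `1` only at second order: the moment condition gives `avg
    -- exp(-x) x = 0`, which cancels the linear term.
    have hM : |M - 1| ≤ 3 * K * s ^ 2 := by
      have h1 := congrArg (fun z => inner ℝ l z) h0
      simp only [inner_avg, inner_smul_right, inner_zero_right] at h1
      have h2 : M - 1 = avg fun i => (Real.exp (-inner ℝ l (y i)) - 1 + inner ℝ l (y i))
          + (Real.exp (-inner ℝ l (y i)) - 1) * inner ℝ l (y i) := by
        have h3 : (avg fun i => (Real.exp (-inner ℝ l (y i)) - 1 + inner ℝ l (y i))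
            + (Real.exp (-inner ℝ l (y i)) - 1) * inner ℝ l (y i))
            = M - (avg fun _ : Fin n => (1 : ℝ))
              + avg fun i => Real.exp (-inner ℝ l (y i)) * inner ℝ l (y i) := by
          rw [hMdef, ← avg_sub, ← avg_add]
          congr 1
          funext i
          ring
        rw [h3, h1, avg_const hn, add_zero]
      rw [h2]
      have h3 : |avg fun i => (Real.exp (-inner ℝ l (y i)) - 1 + inner ℝ l (y i))
          + (Real.exp (-inner ℝ l (y i)) - 1) * inner ℝ l (y i)| ≤ 3 * s ^ 2 * K := by
        refine abs_avg_le_mul (D := fun i => 1 + a i ^ 4 + g i ^ 2) (by positivity)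
          (fun i => ?_) hK
        obtain ⟨-, -, hp3, hp4, -⟩ := exp_neg_bounds ((hx i).trans (hsa i))
        refine (abs_add_le _ _).trans ?_
        have h4 : |(Real.exp (-inner ℝ l (y i)) - 1) * inner ℝ l (y i)|
            ≤ 2 * inner ℝ l (y i) ^ 2 := by
          rw [abs_mul, ← sq_abs (inner ℝ l (y i))]
          nlinarith [abs_nonneg (inner ℝ l (y i))]
        nlinarith [hx2 i, mul_le_mul_of_nonneg_left (ha2 i) (sq_nonneg s)]
      linarith
    -- Subtracting the ETEL equation in `θ` leaves a coefficient of order `s²` against `ν = O(s)`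
    -- and one of order `s` against `ν - l = O(s²)`.
    have h1 : (avg fun i => (1 + inner ℝ ν (y i))⁻¹ * inner ℝ ν (G i v))
        = avg fun i => ((1 + inner ℝ ν (y i))⁻¹ - Real.exp (-inner ℝ l (y i)) - 1
            + Real.exp (-inner ℝ l (y i)) / M
            + Real.exp (-inner ℝ l (y i)) * inner ℝ ν (y i)) * inner ℝ ν (G i v)
          + (1 - Real.exp (-inner ℝ l (y i)) / M
            - Real.exp (-inner ℝ l (y i)) * inner ℝ ν (y i)) * inner ℝ (ν - l) (G i v) := by
      have h2 := hv v
      rw [← add_zero (avg fun i => ((1 + inner ℝ ν (y i))⁻¹ - Real.exp (-inner ℝ l (y i)) - 1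
            + Real.exp (-inner ℝ l (y i)) / M
            + Real.exp (-inner ℝ l (y i)) * inner ℝ ν (y i)) * inner ℝ ν (G i v)
          + (1 - Real.exp (-inner ℝ l (y i)) / M
            - Real.exp (-inner ℝ l (y i)) * inner ℝ ν (y i)) * inner ℝ (ν - l) (G i v)), ← h2,
        ← avg_add]
      congr 1
      funext i
      rw [inner_sub_left]
      ring
    rw [h1]
    have h2 : |avg fun i => ((1 + inner ℝ ν (y i))⁻¹ - Real.exp (-inner ℝ l (y i)) - 1
            + Real.exp (-inner ℝ l (y i)) / M
            + Real.exp (-inner ℝ l (y i)) * inner ℝ ν (y i)) * inner ℝ ν (G i v)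
          + (1 - Real.exp (-inner ℝ l (y i)) / M
            - Real.exp (-inner ℝ l (y i)) * inner ℝ ν (y i)) * inner ℝ (ν - l) (G i v)|
        ≤ s ^ 3 * ‖v‖ * (24 + 24 * K + A * (6 + 12 * K)) * K := by
      refine abs_avg_le_mul (D := fun i => 1 + a i ^ 4 + g i ^ 2) (by positivity) (fun i => ?_) hK
      obtain ⟨h3, h4⟩ := abs_residual_coeff_le (ha0 i) hs hs1 hK0 (hx i) (hz i) (hsa i) rfl hM hM2
      have ha0 := ha0 i
      have hg0 := hg0 i
      refine (abs_add_le _ _).trans ?_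
      rw [abs_mul, abs_mul]
      calc _ ≤ s ^ 2 * (12 * a i ^ 2 + 12 * K) * (2 * s * (g i * ‖v‖))
            + s * (6 * a i + 12 * K) * (A * s ^ 2 * (g i * ‖v‖)) :=
            add_le_add
              (mul_le_mul h3 (abs_inner_apply_le hνs (hg i) v) (abs_nonneg _) (by positivity))
              (mul_le_mul h4 (abs_inner_apply_le hu (hg i) v) (abs_nonneg _) (by positivity))
        _ = s ^ 3 * ‖v‖ * (24 * (a i ^ 2 * g i) + 24 * (K * g i)
              + A * (6 * (a i * g i) + 12 * (K * g i))) := by ring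
        _ ≤ s ^ 3 * ‖v‖ * (24 * (1 + a i ^ 4 + g i ^ 2) + 24 * (K * (1 + a i ^ 4 + g i ^ 2))
              + A * (6 * (1 + a i ^ 4 + g i ^ 2) + 12 * (K * (1 + a i ^ 4 + g i ^ 2)))) := by
            gcongr
            · exact ha2g i
            · exact hg1 i
            · exact hag i
            · exact hg1 i
        _ = _ := by ring
    refine h2.trans ?_
    have : 0 ≤ s ^ 3 * ‖v‖ := by positivity
    nlinarith

end Residual

end Expansion

/-! ### Linearization of the first-order conditions of empirical likelihood -/

section Linearization

variable {n k m : ℕ}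

/-- An injective derivative and a coercive variance make the linearized system invertible. -/
lemma exists_bound_of_linearized {Γ : Vec k →L[ℝ] Vec m} {Ω : Vec m →L[ℝ] Vec m} {c₁ c₂ : ℝ}
    (h₁ : 0 < c₁) (h₂ : 0 < c₂) (hΓ : ∀ v, c₁ * ‖v‖ ≤ ‖Γ v‖)
    (hΩ : ∀ u, c₂ * ‖u‖ ^ 2 ≤ inner ℝ (Ω u) u) :
    ∃ A : ℝ, 0 < A ∧ ∀ (v : Vec k) (u : Vec m) (q : ℝ), 0 ≤ q → ‖Γ v - Ω u‖ ≤ q →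
      (∀ w, |inner ℝ u (Γ w)| ≤ q * ‖w‖) → ‖v‖ + ‖u‖ ≤ A * q := by
  set α := 1 / c₁ with hα
  set β := ‖Ω‖ / c₁ + 1 with hβ
  have hα0 : 0 < α := by positivity
  have hβ0 : 0 < β := by positivity
  set A₁ := 2 * α ^ 2
  set A₂ := 2 * β ^ 2 / c₂
  have hA₁ : 0 < A₁ := by positivity
  have hA₂ : 0 < A₂ := by positivity
  refine ⟨A₁ + A₂ + 1, by positivity, fun v u q hq hvu hu => ?_⟩
  -- Pairing the first equation with `u` and taking `w = v` in the second eliminates the term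
  -- `u'Γv`, so coercivity of `Ω` controls `u`. Injectivity of `Γ` then controls `v`.
  have hu2 : ‖u‖ ^ 2 ≤ q * (‖v‖ + ‖u‖) / c₂ := by
    rw [le_div_iff₀ h₂]
    have h3 : inner ℝ (Ω u) u = inner ℝ u (Γ v) - inner ℝ (Γ v - Ω u) u := by
      rw [inner_sub_left, real_inner_comm u (Γ v)]
      ring
    have h4 := (abs_le.1 (hu v)).2
    have h5 := (abs_le.1 (abs_inner_le hvu (le_refl ‖u‖))).1
    have h6 := hΩ u
    rw [h3] at h6
    linarith
  have hv : ‖v‖ ≤ α * q + ‖Ω‖ / c₁ * ‖u‖ := by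
    have h3 : ‖Γ v‖ ≤ q + ‖Ω‖ * ‖u‖ := by
      have h4 : ‖Γ v‖ ≤ ‖Γ v - Ω u‖ + ‖Ω u‖ := by simpa using norm_add_le (Γ v - Ω u) (Ω u)
      linarith [Ω.le_opNorm u]
    have h4 := (hΓ v).trans h3
    have h5 : α * q + ‖Ω‖ / c₁ * ‖u‖ = (q + ‖Ω‖ * ‖u‖) / c₁ := by rw [hα]; ring
    rw [h5, le_div_iff₀ h₁]
    linarith
  have he : ‖v‖ + ‖u‖ ≤ α * q + β * ‖u‖ := by
    rw [hβ, add_mul, one_mul]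
    linarith
  set e := ‖v‖ + ‖u‖ with hedef
  have he0 : 0 ≤ e := by positivity
  have hsq : e ^ 2 ≤ A₁ * q ^ 2 + A₂ * (q * e) := by
    calc e ^ 2 ≤ (α * q + β * ‖u‖) ^ 2 := pow_le_pow_left₀ he0 he 2
      _ ≤ 2 * α ^ 2 * q ^ 2 + 2 * β ^ 2 * ‖u‖ ^ 2 := by
        nlinarith [sq_nonneg (α * q - β * ‖u‖)]
      _ ≤ 2 * α ^ 2 * q ^ 2 + 2 * β ^ 2 * (q * e / c₂) := by gcongr
      _ = _ := by simp only [A₁, A₂]; ring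
  -- From `e² ≤ A₁ q² + A₂ q e`, any `e` above `(A₁ + A₂ + 1) q` would satisfy `q ≤ e` and violate
  -- the inequality.
  by_contra! hlt
  have hqe : q ≤ e := by nlinarith
  have hepos : 0 < e := lt_of_le_of_lt (by positivity) hlt
  have h3 : A₁ * q ^ 2 ≤ A₁ * (q * e) := by
    have := mul_le_mul_of_nonneg_left hqe hq
    nlinarith
  have h4 : (A₁ + A₂) * q * e < e * e := by
    refine mul_lt_mul_of_pos_right ?_ hepos
    linarith
  nlinarith

variable {y₁ y₂ ys l₁ l₂ : Vec m} {G₁ G₂ Gs : Vec k →L[ℝ] Vec m} {v : Vec k} {a g b s t : ℝ}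

set_option maxHeartbeats 800000 in
-- One observation's linearization error in the EL moment equation. Subscripts 1 and 2 are the two
-- compared points, `ys` and `Gs` belong to `θs`, `v` is the parameter increment, `t` bounds the
-- distance to `θs` and `s` the tilting parameters. Every error term is the increment in `(θ, l)`
-- times `s` or `t`, with an integrable factor.
lemma norm_EL_moment_sub_linear_le (h₁ : ‖y₁‖ ≤ a) (h₂ : ‖y₂‖ ≤ a) (hs : ‖ys‖ ≤ a)
    (h₁₂ : ‖y₂ - y₁‖ ≤ g * ‖v‖) (h₂s : ‖y₂ - ys‖ ≤ g * t)
    (hG : ‖y₂ - y₁ - Gs v‖ ≤ b * t * ‖v‖) (hl₁ : ‖l₁‖ ≤ s) (hl₂ : ‖l₂‖ ≤ s)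
    (hsa : s * a ≤ 1 / 4) (hs1 : s ≤ 1) (ht : 0 ≤ t) (hb : 0 ≤ b) (hg : 0 ≤ g) :
    ‖((1 + inner ℝ l₂ y₂)⁻¹ • y₂ - (1 + inner ℝ l₁ y₁)⁻¹ • y₁)
        - (Gs v - inner ℝ (l₂ - l₁) ys • ys)‖
      ≤ 8 * (s + t) * (‖v‖ + ‖l₂ - l₁‖) * (1 + a ^ 4 + g ^ 2 + b) := by
  have ha : 0 ≤ a := (norm_nonneg _).trans h₁
  have hs0 : 0 ≤ s := (norm_nonneg _).trans hl₁
  set u := l₂ - l₁ with hu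
  set z₁ := inner ℝ l₁ y₁ with hz₁def
  set z₂ := inner ℝ l₂ y₂ with hz₂def
  have hz₁ : |z₁| ≤ s * a := abs_inner_le hl₁ h₁
  have hz₂ : |z₂| ≤ s * a := abs_inner_le hl₂ h₂
  obtain ⟨hp₁, hb₁, -, -⟩ := inv_one_add_bounds (hz₁.trans hsa)
  obtain ⟨hp₂, hb₂, hd₂, -⟩ := inv_one_add_bounds (hz₂.trans hsa)
  have hz : z₂ - z₁ = inner ℝ u y₂ + inner ℝ l₁ (y₂ - y₁) := by
    rw [hu, inner_sub_left, inner_sub_right]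
    ring
  have huy : |inner ℝ u y₂| ≤ ‖u‖ * a := abs_inner_le le_rfl h₂
  have hly : |inner ℝ l₁ (y₂ - y₁)| ≤ s * (g * ‖v‖) := abs_inner_le hl₁ h₁₂
  have hτ : |(1 + z₂)⁻¹ - (1 + z₁)⁻¹| ≤ 4 * (‖u‖ * a + s * (g * ‖v‖)) := by
    refine (abs_inv_one_add_sub_le (hz₂.trans hsa) (hz₁.trans hsa)).trans ?_
    rw [hz]
    linarith [abs_add_le (inner ℝ u y₂) (inner ℝ l₁ (y₂ - y₁))]
  set τ₁ := (1 + z₁)⁻¹ with hτ₁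
  set τ₂ := (1 + z₂)⁻¹ with hτ₂
  have e₁ : τ₁ = 1 - z₁ * τ₁ := by
    have : (1 + z₁) * τ₁ = 1 := mul_inv_cancel₀ (inv_pos.1 hp₁).ne'
    linarith
  have e₂ : τ₂ = 1 - (inner ℝ u y₂ + inner ℝ l₁ (y₂ - y₁) + z₁) * τ₂ := by
    have : (1 + z₂) * τ₂ = 1 := mul_inv_cancel₀ (inv_pos.1 hp₂).ne'
    have hz' : inner ℝ u y₂ + inner ℝ l₁ (y₂ - y₁) + z₁ = z₂ := by linarith
    rw [hz']
    linarith
  -- The identity `τ = 1 - z τ` peels the linear part off each weight, so that all remaining terms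
  -- are products of two small quantities.
  have hdec : (τ₂ • y₂ - τ₁ • y₁) - (Gs v - inner ℝ u ys • ys)
      = (y₂ - y₁ - Gs v) - (inner ℝ u y₂ * (τ₂ - 1)) • y₂ - inner ℝ u (y₂ - ys) • y₂
        - inner ℝ u ys • (y₂ - ys) - (inner ℝ l₁ (y₂ - y₁) * τ₂) • y₂
        - (z₁ * (τ₂ - τ₁)) • y₂ - (z₁ * τ₁) • (y₂ - y₁) := by
    have f₁ : τ₁ • y₁ = y₁ - (z₁ * τ₁) • y₁ := by
      conv_lhs => rw [e₁]
      rw [sub_smul, one_smul]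
    have f₂ : τ₂ • y₂ = y₂ - ((inner ℝ u y₂ + inner ℝ l₁ (y₂ - y₁) + z₁) * τ₂) • y₂ := by
      conv_lhs => rw [e₂]
      rw [sub_smul, one_smul]
    rw [f₁, f₂, inner_sub_right u]
    module
  rw [hdec]
  have n₁ : ‖(inner ℝ u y₂ * (τ₂ - 1)) • y₂‖ ≤ ‖u‖ * a * (2 * (s * a)) * a := by
    rw [norm_smul, Real.norm_eq_abs, abs_mul]
    exact mul_le_mul (mul_le_mul huy (by linarith) (abs_nonneg _) (by positivity)) h₂
      (norm_nonneg _) (by positivity)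
  have n₂ : ‖inner ℝ u (y₂ - ys) • y₂‖ ≤ ‖u‖ * (g * t) * a := by
    rw [norm_smul, Real.norm_eq_abs]
    exact mul_le_mul (abs_inner_le le_rfl h₂s) h₂ (norm_nonneg _) (by positivity)
  have n₃ : ‖inner ℝ u ys • (y₂ - ys)‖ ≤ ‖u‖ * a * (g * t) := by
    rw [norm_smul, Real.norm_eq_abs]
    exact mul_le_mul (abs_inner_le le_rfl hs) h₂s (norm_nonneg _) (by positivity)
  have n₄ : ‖(inner ℝ l₁ (y₂ - y₁) * τ₂) • y₂‖ ≤ s * (g * ‖v‖) * 2 * a := by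
    rw [norm_smul, Real.norm_eq_abs, abs_mul, abs_of_pos hp₂]
    exact mul_le_mul (mul_le_mul hly hb₂ hp₂.le (by positivity)) h₂ (norm_nonneg _) (by positivity)
  have n₅ : ‖(z₁ * (τ₂ - τ₁)) • y₂‖ ≤ s * a * (4 * (‖u‖ * a + s * (g * ‖v‖))) * a := by
    rw [norm_smul, Real.norm_eq_abs, abs_mul]
    exact mul_le_mul (mul_le_mul hz₁ hτ (abs_nonneg _) (by positivity)) h₂ (norm_nonneg _)
      (by positivity)
  have n₆ : ‖(z₁ * τ₁) • (y₂ - y₁)‖ ≤ s * a * 2 * (g * ‖v‖) := by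
    rw [norm_smul, Real.norm_eq_abs, abs_mul, abs_of_pos hp₁]
    exact mul_le_mul (mul_le_mul hz₁ hb₁ hp₁.le (by positivity)) h₁₂ (norm_nonneg _)
      (by positivity)
  obtain ⟨-, ha3, ha2g, hag, -, -⟩ := le_one_add_pow_four_add_sq a g
  set D := 1 + a ^ 4 + g ^ 2 with hD
  have hD0 : 0 ≤ D := by positivity
  have htri : ‖(y₂ - y₁ - Gs v) - (inner ℝ u y₂ * (τ₂ - 1)) • y₂ - inner ℝ u (y₂ - ys) • y₂
        - inner ℝ u ys • (y₂ - ys) - (inner ℝ l₁ (y₂ - y₁) * τ₂) • y₂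
        - (z₁ * (τ₂ - τ₁)) • y₂ - (z₁ * τ₁) • (y₂ - y₁)‖
      ≤ b * t * ‖v‖ + ‖u‖ * a * (2 * (s * a)) * a + ‖u‖ * (g * t) * a + ‖u‖ * a * (g * t)
        + s * (g * ‖v‖) * 2 * a + s * a * (4 * (‖u‖ * a + s * (g * ‖v‖))) * a
        + s * a * 2 * (g * ‖v‖) := by
    refine (norm_sub_le_of_le ?_ n₆)
    refine (norm_sub_le_of_le ?_ n₅)
    refine (norm_sub_le_of_le ?_ n₄)
    refine (norm_sub_le_of_le ?_ n₃)
    refine (norm_sub_le_of_le ?_ n₂)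
    exact norm_sub_le_of_le hG n₁
  refine htri.trans ?_
  calc _ = b * (t * ‖v‖) + a ^ 3 * (6 * s * ‖u‖) + a * g * (2 * t * ‖u‖ + 4 * s * ‖v‖)
        + a ^ 2 * g * (4 * s * (s * ‖v‖)) := by ring
    _ ≤ (D + b) * (t * ‖v‖) + (D + b) * (6 * s * ‖u‖)
        + (D + b) * (2 * t * ‖u‖ + 4 * s * ‖v‖) + (D + b) * (4 * s * (1 * ‖v‖)) := by
      gcongr <;> linarith
    _ ≤ _ := by
      have h3 : 0 ≤ (D + b) * (t * ‖v‖) := by positivity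
      have h4 : 0 ≤ (D + b) * (t * ‖u‖) := by positivity
      have h5 : 0 ≤ (D + b) * (s * ‖u‖) := by positivity
      nlinarith

/-- The companion bound for the score equation. That score is already linear in `l`, so its limit is
`(l₂ - l₁)'Gs`; the variation of the Jacobian enters through the Lipschitz constant `b`. -/
lemma abs_EL_score_sub_linear_le (h₁ : ‖y₁‖ ≤ a) (h₂ : ‖y₂‖ ≤ a)
    (h₁₂ : ‖y₂ - y₁‖ ≤ g * ‖v‖) (hG₁ : ‖G₁‖ ≤ g) (hG₂ : ‖G₂‖ ≤ g)
    (hG₁₂ : ‖G₂ - G₁‖ ≤ b * ‖v‖) (hG₂s : ‖G₂ - Gs‖ ≤ b * t) (hl₁ : ‖l₁‖ ≤ s) (hl₂ : ‖l₂‖ ≤ s)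
    (hsa : s * a ≤ 1 / 4) (hs1 : s ≤ 1) (ht : 0 ≤ t) (hb : 0 ≤ b) (w : Vec k) :
    |((1 + inner ℝ l₂ y₂)⁻¹ * inner ℝ l₂ (G₂ w) - (1 + inner ℝ l₁ y₁)⁻¹ * inner ℝ l₁ (G₁ w))
        - inner ℝ (l₂ - l₁) (Gs w)|
      ≤ 8 * (s + t) * (‖v‖ + ‖l₂ - l₁‖) * ‖w‖ * (1 + a ^ 4 + g ^ 2 + b) := by
  have ha : 0 ≤ a := (norm_nonneg _).trans h₁
  have hg : 0 ≤ g := (norm_nonneg _).trans hG₁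
  have hs0 : 0 ≤ s := (norm_nonneg _).trans hl₁
  set u := l₂ - l₁ with hu
  set z₁ := inner ℝ l₁ y₁ with hz₁def
  set z₂ := inner ℝ l₂ y₂ with hz₂def
  have hz₁ : |z₁| ≤ s * a := abs_inner_le hl₁ h₁
  have hz₂ : |z₂| ≤ s * a := abs_inner_le hl₂ h₂
  obtain ⟨hp₂, hb₂, hd₂, -⟩ := inv_one_add_bounds (hz₂.trans hsa)
  have hz : z₂ - z₁ = inner ℝ u y₂ + inner ℝ l₁ (y₂ - y₁) := by
    rw [hu, inner_sub_left, inner_sub_right]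
    ring
  have huy : |inner ℝ u y₂| ≤ ‖u‖ * a := abs_inner_le le_rfl h₂
  have hly : |inner ℝ l₁ (y₂ - y₁)| ≤ s * (g * ‖v‖) := abs_inner_le hl₁ h₁₂
  have hτ : |(1 + z₂)⁻¹ - (1 + z₁)⁻¹| ≤ 4 * (‖u‖ * a + s * (g * ‖v‖)) := by
    refine (abs_inv_one_add_sub_le (hz₂.trans hsa) (hz₁.trans hsa)).trans ?_
    rw [hz]
    linarith [abs_add_le (inner ℝ u y₂) (inner ℝ l₁ (y₂ - y₁))]
  set τ₁ := (1 + z₁)⁻¹ with hτ₁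
  set τ₂ := (1 + z₂)⁻¹ with hτ₂
  have hdec : (τ₂ * inner ℝ l₂ (G₂ w) - τ₁ * inner ℝ l₁ (G₁ w)) - inner ℝ u (Gs w)
      = (τ₂ - 1) * inner ℝ u (G₂ w) + inner ℝ u ((G₂ - Gs) w) + τ₂ * inner ℝ l₁ ((G₂ - G₁) w)
        + (τ₂ - τ₁) * inner ℝ l₁ (G₁ w) := by
    simp only [sub_apply, inner_sub_right, hu, inner_sub_left]
    ring
  rw [hdec]
  have n₁ : |(τ₂ - 1) * inner ℝ u (G₂ w)| ≤ 2 * (s * a) * (‖u‖ * (g * ‖w‖)) := by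
    rw [abs_mul]
    exact mul_le_mul (by linarith) (abs_inner_apply_le le_rfl hG₂ w) (abs_nonneg _) (by positivity)
  have n₂ : |inner ℝ u ((G₂ - Gs) w)| ≤ ‖u‖ * (b * t * ‖w‖) := abs_inner_apply_le le_rfl hG₂s w
  have n₃ : |τ₂ * inner ℝ l₁ ((G₂ - G₁) w)| ≤ 2 * (s * (b * ‖v‖ * ‖w‖)) := by
    rw [abs_mul, abs_of_pos hp₂]
    exact mul_le_mul hb₂ (abs_inner_apply_le hl₁ hG₁₂ w) (abs_nonneg _) (by norm_num)
  have n₄ : |(τ₂ - τ₁) * inner ℝ l₁ (G₁ w)|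
      ≤ 4 * (‖u‖ * a + s * (g * ‖v‖)) * (s * (g * ‖w‖)) := by
    rw [abs_mul]
    exact mul_le_mul hτ (abs_inner_apply_le hl₁ hG₁ w) (abs_nonneg _) (by positivity)
  obtain ⟨-, -, -, hag, -, hg2⟩ := le_one_add_pow_four_add_sq a g
  set D := 1 + a ^ 4 + g ^ 2 with hD
  have hD0 : 0 ≤ D := by positivity
  have htri : |(τ₂ - 1) * inner ℝ u (G₂ w) + inner ℝ u ((G₂ - Gs) w)
        + τ₂ * inner ℝ l₁ ((G₂ - G₁) w) + (τ₂ - τ₁) * inner ℝ l₁ (G₁ w)|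
      ≤ 2 * (s * a) * (‖u‖ * (g * ‖w‖)) + ‖u‖ * (b * t * ‖w‖) + 2 * (s * (b * ‖v‖ * ‖w‖))
        + 4 * (‖u‖ * a + s * (g * ‖v‖)) * (s * (g * ‖w‖)) :=
    (abs_add_le _ _).trans (add_le_add ((abs_add_le _ _).trans (add_le_add
      ((abs_add_le _ _).trans (add_le_add n₁ n₂)) n₃)) n₄)
  refine htri.trans ?_
  calc _ = ‖w‖ * (a * g * (6 * s * ‖u‖) + b * (t * ‖u‖ + 2 * s * ‖v‖)
        + g ^ 2 * (4 * s * (s * ‖v‖))) := by ring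
    _ ≤ ‖w‖ * ((D + b) * (6 * s * ‖u‖) + (D + b) * (t * ‖u‖ + 2 * s * ‖v‖)
        + (D + b) * (4 * s * (1 * ‖v‖))) := by
      gcongr <;> linarith
    _ ≤ ‖w‖ * (8 * (s + t) * (‖v‖ + ‖u‖) * (D + b)) := by
      gcongr
      have h3 : 0 ≤ (D + b) * (t * ‖v‖) := by positivity
      have h4 : 0 ≤ (D + b) * (t * ‖u‖) := by positivity
      have h5 : 0 ≤ (D + b) * (s * ‖u‖) := by positivity
      have h6 : 0 ≤ (D + b) * (s * ‖v‖) := by positivity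
      nlinarith
    _ = _ := by ring

end Linearization

/-! ### Well-behaved samples -/

/-- A sample on which the sample averages are close to their limits. Here `a`, `g`, `b` bound
the moment functions, their Jacobians and the Lipschitz constants of the Jacobians on the ball of
radius `ρ` around `θs`, and `e` bounds the moment functions on `Θ`. -/
structure GoodSample {n k m : ℕ} (Y : Vec k → Fin n → Vec m) (Θ : Set (Vec k)) (θs : Vec k)
    (Γ : Vec k →L[ℝ] Vec m) (Ω : Vec m →L[ℝ] Vec m) (ρ c₀ K κ C : ℝ)
    (a g b e : Fin n → ℝ) : Prop where
  contDiffOn : ∀ i, ContDiffOn ℝ 1 (fun θ => Y θ i) (Metric.ball θs ρ)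
  norm_le : ∀ i, ∀ θ ∈ Metric.ball θs ρ, ‖Y θ i‖ ≤ a i
  norm_fderiv_le : ∀ i, ∀ θ ∈ Metric.ball θs ρ, ‖fderiv ℝ (fun θ => Y θ i) θ‖ ≤ g i
  fderiv_lipschitz : ∀ i, ∀ θ₁ ∈ Metric.ball θs ρ, ∀ θ₂ ∈ Metric.ball θs ρ,
    ‖fderiv ℝ (fun θ => Y θ i) θ₁ - fderiv ℝ (fun θ => Y θ i) θ₂‖ ≤ b i * ‖θ₁ - θ₂‖
  nonneg : ∀ i, 0 ≤ b i
  avg_le : avg (fun i => 1 + a i ^ 4 + g i ^ 2 + b i) ≤ K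
  norm_le_envelope : ∀ i, ∀ θ ∈ Θ, ‖Y θ i‖ ≤ e i
  avg_envelope_le : avg (fun i => e i ^ 2) ≤ K
  separated : ∀ θ ∈ Θ, ρ / 2 ≤ ‖θ - θs‖ → c₀ ≤ ‖avg (Y θ)‖
  norm_avg_le : ‖avg (Y θs)‖ ≤ C * (√n)⁻¹
  norm_avg_fderiv_sub_le : ‖avg (fun i => fderiv ℝ (fun θ => Y θ i) θs) - Γ‖ ≤ κ
  norm_avg_var_sub_le : ∀ u, ‖avg (fun i => inner ℝ u (Y θs i) • Y θs i) - Ω u‖ ≤ κ * ‖u‖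

namespace GoodSample

variable {n k m : ℕ} {Y : Vec k → Fin n → Vec m} {Θ : Set (Vec k)} {θs : Vec k}
  {Γ : Vec k →L[ℝ] Vec m} {Ω : Vec m →L[ℝ] Vec m} {ρ c₀ K κ C : ℝ} {a g b e : Fin n → ℝ}

lemma hasStrictFDerivAt (hY : GoodSample Y Θ θs Γ Ω ρ c₀ K κ C a g b e) {θ : Vec k}
    (hθ : θ ∈ Metric.ball θs ρ) (i : Fin n) :
    HasStrictFDerivAt (fun θ => Y θ i) (fderiv ℝ (fun θ => Y θ i) θ) θ :=
  ((hY.contDiffOn i).contDiffAt (Metric.isOpen_ball.mem_nhds hθ)).hasStrictFDerivAt one_ne_zero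

lemma norm_sub_le (hY : GoodSample Y Θ θs Γ Ω ρ c₀ K κ C a g b e) {θ₁ θ₂ : Vec k}
    (h₁ : θ₁ ∈ Metric.ball θs ρ) (h₂ : θ₂ ∈ Metric.ball θs ρ) (i : Fin n) :
    ‖Y θ₂ i - Y θ₁ i‖ ≤ g i * ‖θ₂ - θ₁‖ :=
  (convex_ball θs ρ).norm_image_sub_le_of_norm_fderiv_le
    (fun _ hθ => (hY.hasStrictFDerivAt hθ i).differentiableAt) (hY.norm_fderiv_le i) h₁ h₂

lemma norm_sub_sub_fderiv_le (hY : GoodSample Y Θ θs Γ Ω ρ c₀ K κ C a g b e) {θ₁ θ₂ : Vec k}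
    {t : ℝ} (ht : t < ρ) (ht0 : 0 ≤ t) (h₁ : ‖θ₁ - θs‖ ≤ t) (h₂ : ‖θ₂ - θs‖ ≤ t) (i : Fin n) :
    ‖Y θ₂ i - Y θ₁ i - fderiv ℝ (fun θ => Y θ i) θs (θ₂ - θ₁)‖ ≤ b i * t * ‖θ₂ - θ₁‖ := by
  have hsub : Metric.closedBall θs t ⊆ Metric.ball θs ρ := Metric.closedBall_subset_ball ht
  refine (convex_closedBall θs t).norm_image_sub_le_of_norm_fderiv_le'
    (f := fun θ => Y θ i)
    (fun _ hθ => (hY.hasStrictFDerivAt (hsub hθ) i).differentiableAt) (fun θ hθ => ?_)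
    (mem_closedBall_iff_norm.2 h₁) (mem_closedBall_iff_norm.2 h₂)
  refine (hY.fderiv_lipschitz i θ (hsub hθ) θs (hsub (Metric.mem_closedBall_self ht0))).trans ?_
  exact mul_le_mul_of_nonneg_left (mem_closedBall_iff_norm.1 hθ) (hY.nonneg i)

lemma avg_b_le (hY : GoodSample Y Θ θs Γ Ω ρ c₀ K κ C a g b e) : avg b ≤ K :=
  (avg_mono fun i => by nlinarith [sq_nonneg (a i ^ 2), sq_nonneg (g i)]).trans hY.avg_le

lemma avg_pow_four_le (hY : GoodSample Y Θ θs Γ Ω ρ c₀ K κ C a g b e) :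
    avg (fun i => 1 + a i ^ 4 + g i ^ 2) ≤ K :=
  (avg_mono fun i => by linarith [hY.nonneg i]).trans hY.avg_le

/-- A local inverse bound that turns a small average moment into closeness to `θs`. Half of `c₁` is
given up: a quarter to the sampling error of the Jacobian, a quarter to its variation over the ball.
-/
lemma mul_norm_sub_le (hY : GoodSample Y Θ θs Γ Ω ρ c₀ K κ C a g b e) {c₁ : ℝ}
    (hΓ : ∀ v, c₁ * ‖v‖ ≤ ‖Γ v‖) (hκ : κ ≤ c₁ / 4) (hK : K * ρ ≤ c₁ / 4)
    (hK0 : 0 ≤ K) {θ : Vec k} (hθ : θ ∈ Metric.ball θs ρ) :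
    c₁ / 2 * ‖θ - θs‖ ≤ ‖avg (Y θ) - avg (Y θs)‖ := by
  have hlt : ‖θ - θs‖ < ρ := mem_ball_iff_norm.1 hθ
  have h1 : ‖avg (fun i => Y θ i - Y θs i - fderiv ℝ (fun θ => Y θ i) θs (θ - θs))‖
      ≤ ‖θ - θs‖ * ‖θ - θs‖ * K := by
    refine norm_avg_le_mul (D := b) (by positivity) (fun i => ?_) hY.avg_b_le
    have := hY.norm_sub_sub_fderiv_le hlt (norm_nonneg _) (θ₁ := θs) (θ₂ := θ) (by simp) le_rfl i
    linarith
  rw [avg_sub, avg_sub, ← avg_apply] at h1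
  have h2 := (avg (fun i => fderiv ℝ (fun θ => Y θ i) θs) - Γ).le_of_opNorm_le
    hY.norm_avg_fderiv_sub_le (θ - θs)
  rw [sub_apply] at h2
  have h3 := hΓ (θ - θs)
  set A := avg (fun i => fderiv ℝ (fun θ => Y θ i) θs) (θ - θs)
  have h4 : ‖Γ (θ - θs)‖ ≤ ‖avg (Y θ) - avg (Y θs)‖ + ‖avg (Y θ) - avg (Y θs) - A‖
      + ‖A - Γ (θ - θs)‖ := by
    have : Γ (θ - θs) = (avg (Y θ) - avg (Y θs)) - (avg (Y θ) - avg (Y θs) - A)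
        - (A - Γ (θ - θs)) := by abel
    conv_lhs => rw [this]
    exact norm_sub_le_of_le (_root_.norm_sub_le _ _) le_rfl
  have h5 : ‖θ - θs‖ * ‖θ - θs‖ * K ≤ c₁ / 4 * ‖θ - θs‖ := by
    have h6 : ‖θ - θs‖ * K ≤ ρ * K := mul_le_mul_of_nonneg_right hlt.le hK0
    nlinarith [norm_nonneg (θ - θs)]
  have h6 : κ * ‖θ - θs‖ ≤ c₁ / 4 * ‖θ - θs‖ := by gcongr
  have h7 : ‖avg (Y θ) - avg (Y θs) - A‖ ≤ ‖θ - θs‖ * ‖θ - θs‖ * K := h1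
  linarith

/-- Coercivity of the sample variance survives with half its constant: `κ` pays for sampling error
at `θs` and `2 K t` for moving to `θ`. -/
lemma mul_sq_le_avg_inner_sq (hY : GoodSample Y Θ θs Γ Ω ρ c₀ K κ C a g b e) {c₂ t : ℝ}
    (hΩ : ∀ u, c₂ * ‖u‖ ^ 2 ≤ inner ℝ (Ω u) u) (hκ : κ + 2 * K * t ≤ c₂ / 2) (hρ : 0 < ρ)
    {θ : Vec k} (hθ : θ ∈ Metric.ball θs ρ) (ht : ‖θ - θs‖ ≤ t) (u : Vec m) :
    c₂ / 2 * ‖u‖ ^ 2 ≤ avg fun i => inner ℝ u (Y θ i) ^ 2 := by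
  have hs : θs ∈ Metric.ball θs ρ := Metric.mem_ball_self hρ
  have h1 : avg (fun i => inner ℝ u (Y θs i) ^ 2)
      = inner ℝ u (avg fun i => inner ℝ u (Y θs i) • Y θs i) := by
    rw [inner_avg]
    congr 1
    funext i
    rw [inner_smul_right, sq]
  have h2 := (abs_le.1 (abs_inner_le (le_refl ‖u‖) (hY.norm_avg_var_sub_le u))).1
  rw [inner_sub_right, ← h1, real_inner_comm] at h2
  have h3 := hΩ u
  have h4 : |avg fun i => inner ℝ u (Y θ i) ^ 2 - inner ℝ u (Y θs i) ^ 2|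
      ≤ 2 * t * ‖u‖ ^ 2 * K := by
    have ht0 : 0 ≤ t := (norm_nonneg _).trans ht
    refine abs_avg_le_mul (D := fun i => 1 + a i ^ 4 + g i ^ 2) (by positivity) (fun i => ?_)
      hY.avg_pow_four_le
    have ha0 : 0 ≤ a i := (norm_nonneg _).trans (hY.norm_le i θ hθ)
    have hg0 : 0 ≤ g i := (norm_nonneg _).trans (hY.norm_fderiv_le i θ hθ)
    have h5 : inner ℝ u (Y θ i) ^ 2 - inner ℝ u (Y θs i) ^ 2
        = inner ℝ u (Y θ i - Y θs i) * (inner ℝ u (Y θ i) + inner ℝ u (Y θs i)) := by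
      rw [inner_sub_right]
      ring
    have h6 : |inner ℝ u (Y θ i - Y θs i)| ≤ ‖u‖ * (g i * t) :=
      abs_inner_le le_rfl ((hY.norm_sub_le hs hθ i).trans (by gcongr))
    have h7 : |inner ℝ u (Y θ i) + inner ℝ u (Y θs i)| ≤ 2 * (‖u‖ * a i) := by
      refine (abs_add_le _ _).trans ?_
      have h8 := abs_inner_le (le_refl ‖u‖) (hY.norm_le i θ hθ)
      have h9 := abs_inner_le (le_refl ‖u‖) (hY.norm_le i θs hs)
      linarith
    rw [h5, abs_mul]
    calc _ ≤ ‖u‖ * (g i * t) * (2 * (‖u‖ * a i)) :=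
          mul_le_mul h6 h7 (abs_nonneg _) (by positivity)
      _ = 2 * t * ‖u‖ ^ 2 * (a i * g i) := by ring
      _ ≤ _ := by
        gcongr
        exact (le_one_add_pow_four_add_sq (a i) (g i)).2.2.2.1
  rw [avg_sub] at h4
  have h5 := (abs_le.1 h4).1
  have h6 : (κ + 2 * K * t) * ‖u‖ ^ 2 ≤ c₂ / 2 * ‖u‖ ^ 2 := by gcongr
  nlinarith

/-- Each term is at most the sum, so `a i ≤ (n K)^{1/4}`. With `s` of order `n^{-1/2}` the products
are small uniformly in `i`. -/
lemma mul_envelope_le (hY : GoodSample Y Θ θs Γ Ω ρ c₀ K κ C a g b e) {s : ℝ}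
    (hsn : s ^ 4 * (n * K) ≤ (1 / 8) ^ 4) (i : Fin n) : s * a i ≤ 1 / 8 := by
  have h1 : a i ^ 4 ≤ n * K := by
    have h2 := le_mul_avg (f := fun i => a i ^ 4) (fun i => by positivity) i
    have h3 : avg (fun i => a i ^ 4) ≤ K :=
      (avg_mono fun i => by nlinarith [sq_nonneg (g i)]).trans hY.avg_pow_four_le
    exact h2.trans (mul_le_mul_of_nonneg_left h3 (by positivity))
  refine le_of_pow_le_pow_left₀ (n := 4) (by norm_num) (by norm_num) ?_
  rw [mul_pow]
  exact (mul_le_mul_of_nonneg_left h1 (by positivity)).trans hsn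

/-- Weights with a small log-discrepancy only exist if the average moment is small. -/
lemma norm_avg_le_of_discrepancy_le (hY : GoodSample Y Θ θs Γ Ω ρ c₀ K κ C a g b e)
    (hn : n ≠ 0) (hK : 0 < K) {θ : Vec k} (hθ : θ ∈ Θ) {w : Fin n → ℝ}
    (hw : w ∈ weightSet (Set.Ioi 0) (Y θ)) {R : ℝ} (hR : discrepancy hEL w ≤ R * (√n)⁻¹ ^ 2) :
    ‖avg (Y θ)‖ ≤ 2 * √K * (|R| + 1 / 2) * (√n)⁻¹ := by
  rcases eq_or_ne (avg (Y θ)) 0 with h0 | h0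
  · rw [h0, norm_zero]
    positivity
  have hn' : (0 : ℝ) < n := by positivity
  set h := (√n)⁻¹ with hh
  have hh0 : 0 < h := by positivity
  have hhn : h ^ 2 * n = 1 := by
    rw [hh, inv_pow, Real.sq_sqrt hn'.le]
    exact inv_mul_cancel₀ hn'.ne'
  have hnorm : 0 < ‖avg (Y θ)‖ := norm_pos_iff.2 h0
  -- A test vector for weak duality, along the average moment. Its length makes `|η'yᵢ| ≤ 1/2`,
  -- since the second moment bound gives `‖yᵢ‖ ≤ √K / h`. The linear gain `‖η‖ ‖avg‖` must then fit
  -- below `R h²` plus a quadratic loss of order `h²`.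
  set η : Vec m := (h / (2 * √K) / ‖avg (Y θ)‖) • avg (Y θ) with hη
  have hηnorm : ‖η‖ = h / (2 * √K) := by
    rw [hη, norm_smul, Real.norm_of_nonneg (by positivity), div_mul_cancel₀ _ hnorm.ne']
  have hηinner : inner ℝ η (avg (Y θ)) = h / (2 * √K) * ‖avg (Y θ)‖ := by
    rw [hη, real_inner_smul_left, real_inner_self_eq_norm_sq]
    field_simp
  have he : ∀ i, ‖Y θ i‖ ≤ √K * h⁻¹ := fun i => by
    refine (hY.norm_le_envelope i θ hθ).trans ?_
    have h1 := le_mul_avg (f := fun i => e i ^ 2) (fun i => sq_nonneg _) i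
    have h2 : e i ^ 2 ≤ (√K * h⁻¹) ^ 2 := by
      refine h1.trans ((mul_le_mul_of_nonneg_left hY.avg_envelope_le hn'.le).trans (le_of_eq ?_))
      rw [mul_pow, Real.sq_sqrt hK.le, inv_pow, eq_comm, mul_inv_eq_iff_eq_mul₀ (by positivity)]
      linear_combination (-K) * hhn
    exact le_of_abs_le (abs_le_of_sq_le_sq h2 (by positivity))
  have hηy : ∀ i, |inner ℝ η (Y θ i)| ≤ 1 / 2 := fun i => by
    refine (abs_inner_le hηnorm.le (he i)).trans (le_of_eq ?_)
    field_simp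
  have hlog : ∀ i, inner ℝ η (Y θ i) - 2 * inner ℝ η (Y θ i) ^ 2
      ≤ Real.log (1 + inner ℝ η (Y θ i)) := fun i => by
    set x := inner ℝ η (Y θ i)
    have hx := abs_le.1 (hηy i)
    have hp : 0 < 1 + x := by linarith
    have h1 := Real.one_sub_inv_le_log_of_pos hp
    have h2 : 1 - (1 + x)⁻¹ = x - (1 + x)⁻¹ * x ^ 2 := by field_simp; ring
    have h3 : (1 + x)⁻¹ ≤ 2 := by
      rw [inv_le_comm₀ hp two_pos]
      linarith
    nlinarith [sq_nonneg x]
  have h1 := (avg_log_le_discrepancy_hEL hn hw (l := η)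
    (fun i => by linarith [(abs_le.1 (hηy i)).1])).1
  have h2 := (avg_mono hlog).trans (h1.trans hR)
  rw [avg_sub, ← inner_avg, hηinner, avg_mul_left] at h2
  have h3 : avg (fun i => inner ℝ η (Y θ i) ^ 2) ≤ (h / (2 * √K)) ^ 2 * K := by
    refine (le_abs_self _).trans (abs_avg_le_mul (D := fun i => e i ^ 2) (by positivity)
      (fun i => ?_) hY.avg_envelope_le)
    rw [abs_of_nonneg (sq_nonneg _), ← sq_abs, ← mul_pow]
    exact pow_le_pow_left₀ (abs_nonneg _)
      (abs_inner_le hηnorm.le (hY.norm_le_envelope i θ hθ)) 2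
  have h4 : (h / (2 * √K)) ^ 2 * K = h ^ 2 / 4 := by
    rw [div_pow, mul_pow, Real.sq_sqrt hK.le]
    field_simp
    norm_num
  have h5 : h / (2 * √K) * ‖avg (Y θ)‖ ≤ (|R| + 1 / 2) * h ^ 2 := by
    have : R * h ^ 2 ≤ |R| * h ^ 2 := by gcongr; exact le_abs_self R
    nlinarith
  have h6 : ‖avg (Y θ)‖ = (2 * √K) / h * (h / (2 * √K) * ‖avg (Y θ)‖) := by field_simp
  rw [h6]
  calc _ ≤ (2 * √K) / h * ((|R| + 1 / 2) * h ^ 2) := by gcongr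
    _ = _ := by field_simp

end GoodSample

/-! ### The two estimates on well-behaved samples -/

namespace GoodSample

/-- On a well-behaved sample, the log-discrepancy estimates exist, and they and their tilting
parameters are of order `n^{-1/2}`. -/
lemma exists_isLogEstimator {k m : ℕ} {Θ : Set (Vec k)} {θs : Vec k}
    {Γ : Vec k →L[ℝ] Vec m} {Ω : Vec m →L[ℝ] Vec m} {ρ c₀ c₁ c₂ K κ C : ℝ}
    (hρ : 0 < ρ) (hc₀ : 0 < c₀) (hc₁ : 0 < c₁) (hc₂ : 0 < c₂) (hK : 0 < K) (hC : 0 ≤ C)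
    (hΓ : ∀ v, c₁ * ‖v‖ ≤ ‖Γ v‖) (hΩ : ∀ u, c₂ * ‖u‖ ^ 2 ≤ inner ℝ (Ω u) u)
    (hκ₁ : κ ≤ c₁ / 4) (hκ₂ : κ ≤ c₂ / 4) (hKρ : K * ρ ≤ c₁ / 4)
    (hΘ : Metric.ball θs ρ ⊆ Θ) :
    ∃ T S : ℝ, 0 ≤ T ∧ 0 < S ∧ ∀ᶠ n : ℕ in atTop, n ≠ 0 ∧ T * (√n)⁻¹ < ρ ∧
      ∀ (Y : Vec k → Fin n → Vec m) (a g b e : Fin n → ℝ),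
      GoodSample Y Θ θs Γ Ω ρ c₀ K κ C a g b e →
      (∀ i, S * (√n)⁻¹ * a i ≤ 1 / 8) ∧
      (∀ θ, ‖θ - θs‖ ≤ T * (√n)⁻¹ → ∀ u : Vec m,
        c₂ / 2 * ‖u‖ ^ 2 ≤ avg fun i => inner ℝ u (Y θ i) ^ 2) ∧
      ∀ {IsSol : ∀ {n : ℕ}, (Fin n → Vec m) → (Fin n → ℝ) → Prop} {τ U : ℝ → ℝ},
      IsTilting m IsSol τ U →
      (∃ θ, IsLogEstimator (fun y w => IsSol y w) Θ Y θ) ∧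
      ∀ θ, IsLogEstimator (fun y w => IsSol y w) Θ Y θ →
        ‖θ - θs‖ ≤ T * (√n)⁻¹ ∧ ∃ l : Vec m, ‖l‖ ≤ S * (√n)⁻¹ ∧
          avg (fun i => τ (inner ℝ l (Y θ i)) • Y θ i) = 0 ∧
          ∀ θ' ∈ Θ, ∀ l' : Vec m, (∀ i, |inner ℝ l' (Y θ' i)| < 1) →
            avg (fun i => τ (inner ℝ l' (Y θ' i)) • Y θ' i) = 0 →
            discrepancy hEL (tilt τ (Y θ) l) ≤ discrepancy hEL (tilt τ (Y θ') l') := by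
  -- The constants are chosen in sequence: `S₀` bounds the tilting parameter at `θs` and with `C`
  -- fixes the discrepancy level; that level fixes the bound `B` on the average moment; `B` fixes
  -- the tilting bound `S` and the radius `T`.
  set S₀ := 4 * (C + 1) / (c₂ / 2) with hS₀
  set B := max C (2 * √K * (|S₀ * C| + 1 / 2)) with hB
  have hCB : C ≤ B := le_max_left _ _
  have hB0 : 0 ≤ B := hC.trans hCB
  set S := 4 * (B + 1) / (c₂ / 2) with hS
  have hS₀S : S₀ ≤ S := by rw [hS₀, hS]; gcongr
  have hS₀0 : 0 < S₀ := by positivity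
  have hS0 : 0 < S := hS₀0.trans_le hS₀S
  set T := 2 / c₁ * (B + C) with hT
  have hT0 : 0 ≤ T := by positivity
  refine ⟨T, S, hT0, hS0, ?_⟩
  have hlim : Tendsto (fun n : ℕ => (√(n : ℝ))⁻¹) atTop (𝓝 0) :=
    (Real.tendsto_sqrt_atTop.comp tendsto_natCast_atTop_atTop).inv_tendsto_atTop
  have hev : ∀ (A : ℝ) {δ : ℝ}, 0 < δ → ∀ᶠ n : ℕ in atTop, A * (√(n : ℝ))⁻¹ < δ :=
    fun A δ hδ => by
      have h := hlim.const_mul A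
      rw [mul_zero] at h
      exact h.eventually_lt_const hδ
  have hev4 : ∀ᶠ n : ℕ in atTop, S ^ 4 * K * (√(n : ℝ))⁻¹ ^ 2 < (1 / 8) ^ 4 := by
    have h := (hlim.pow 2).const_mul (S ^ 4 * K)
    rw [zero_pow two_ne_zero, mul_zero] at h
    exact h.eventually_lt_const (by norm_num)
  filter_upwards [eventually_ne_atTop 0, hev T hρ, hev T (half_pos hρ), hev B hc₀,
    hev (2 * K * T) (show 0 < c₂ / 4 by positivity), hev4] with n hn hTρ hTρ2 hBc hKT hS4
  have hn' : (0 : ℝ) < n := by positivity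
  set h := (√(n : ℝ))⁻¹ with hh
  have hh0 : 0 < h := by positivity
  have hhn : h ^ 2 * n = 1 := by
    rw [hh, inv_pow, Real.sq_sqrt hn'.le]
    exact inv_mul_cancel₀ hn'.ne'
  refine ⟨hn, hTρ, fun Y a g b e hY => ?_⟩
  have hsa : ∀ i, S * h * a i ≤ 1 / 8 := hY.mul_envelope_le (by
    refine le_trans (le_of_eq ?_) hS4.le
    linear_combination (S ^ 4 * K * h ^ 2) * hhn)
  have hball : ∀ θ, ‖θ - θs‖ ≤ T * h → θ ∈ Metric.ball θs ρ := fun θ hθ =>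
    mem_ball_iff_norm.2 (hθ.trans_lt hTρ)
  have hpd : ∀ θ, ‖θ - θs‖ ≤ T * h → ∀ u : Vec m,
      c₂ / 2 * ‖u‖ ^ 2 ≤ avg fun i => inner ℝ u (Y θ i) ^ 2 := fun θ hθ u =>
    hY.mul_sq_le_avg_inner_sq (t := T * h) hΩ (by linarith) hρ (hball θ hθ) hθ u
  refine ⟨hsa, hpd, fun {IsSol τ U} hτ => ?_⟩
  -- The compact set to which the sublevel set of either criterion is confined.
  set Q : Set (Vec k) := {θ ∈ Metric.closedBall θs (ρ / 2) | ‖avg (Y θ)‖ ≤ B * h} with hQ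
  have hhalf : Metric.closedBall θs (ρ / 2) ⊆ Metric.ball θs ρ :=
    Metric.closedBall_subset_ball (by linarith)
  have hcont : ∀ i, ContinuousOn (fun θ => Y θ i) (Metric.closedBall θs (ρ / 2)) := fun i =>
    (hY.contDiffOn i).continuousOn.mono hhalf
  have hQc : IsCompact Q := by
    have hc : ContinuousOn (fun θ => ‖avg (Y θ)‖) (Metric.closedBall θs (ρ / 2)) :=
      (continuousOn_avg hcont).norm
    have hcl := hc.preimage_isClosed_of_isClosed Metric.isClosed_closedBall
      (isClosed_Iic (a := B * h))
    exact (isCompact_closedBall θs (ρ / 2)).of_isClosed_subset hcl fun θ hθ => hθ.1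
  have hQball : ∀ θ ∈ Q, θ ∈ Metric.ball θs ρ := fun θ hθ => hhalf hθ.1
  have hQT : ∀ θ ∈ Q, ‖θ - θs‖ ≤ T * h := fun θ hθ => by
    have h1 := hY.mul_norm_sub_le hΓ hκ₁ hKρ hK.le (hQball θ hθ)
    have h2 : ‖avg (Y θ) - avg (Y θs)‖ ≤ B * h + C * h :=
      norm_sub_le_of_le hθ.2 hY.norm_avg_le
    have h3 : T * h = (B * h + C * h) / (c₁ / 2) := by rw [hT]; field_simp
    rw [h3, le_div_iff₀ (by positivity)]
    linarith
  have hsmall : ∀ θ ∈ Q, ∀ i, S * h * ‖Y θ i‖ ≤ 1 / 8 := fun θ hθ i =>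
    (mul_le_mul_of_nonneg_left (hY.norm_le i θ (hQball θ hθ)) (by positivity)).trans (hsa i)
  have hex : ∀ θ ∈ Q, ∃ l : Vec m, ‖l‖ ≤ S * h ∧
      avg (fun i => τ (inner ℝ l (Y θ i)) • Y θ i) = 0 := fun θ hθ => by
    refine hτ.exists_tilting hn (by positivity) (hsmall θ hθ) (hpd θ (hQT θ hθ))
      (lt_of_le_of_lt hθ.2 ?_)
    have : c₂ / 2 * (S * h) / 4 = (B + 1) * h := by rw [hS]; field_simp
    rw [this]
    nlinarith
  have hsmem : θs ∈ Q := ⟨Metric.mem_closedBall_self (by positivity),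
    hY.norm_avg_le.trans (by gcongr)⟩
  obtain ⟨ls, hls, hls0⟩ : ∃ l : Vec m, ‖l‖ ≤ S₀ * h ∧
      avg (fun i => τ (inner ℝ l (Y θs i)) • Y θs i) = 0 := by
    refine hτ.exists_tilting hn (by positivity) (fun i => ?_) (hpd θs (hQT θs hsmem))
      (lt_of_le_of_lt hY.norm_avg_le ?_)
    · exact le_trans (by gcongr) (hsmall θs hsmem i)
    · have : c₂ / 2 * (S₀ * h) / 4 = (C + 1) * h := by rw [hS₀]; field_simp
      rw [this]
      nlinarith
  have hlevel : ∀ θ ∈ Θ, ∀ w ∈ weightSet (Set.Ioi 0) (Y θ),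
      discrepancy hEL w ≤ S₀ * C * h ^ 2 → θ ∈ Q := fun θ hθ w hw hle => by
    have h1 : ‖avg (Y θ)‖ ≤ B * h :=
      (hY.norm_avg_le_of_discrepancy_le hn hK hθ hw hle).trans
        (mul_le_mul_of_nonneg_right (le_max_right _ _) hh0.le)
    refine ⟨mem_closedBall_iff_norm.2 ?_, h1⟩
    by_contra! hlt
    linarith [hY.separated θ hθ hlt.le]
  have hR : ‖ls‖ * ‖avg (Y θs)‖ ≤ S₀ * C * h ^ 2 := by
    calc _ ≤ (S₀ * h) * (C * h) :=
          mul_le_mul hls hY.norm_avg_le (norm_nonneg _) (by positivity)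
      _ = _ := by ring
  have hQΘ : Q ⊆ Θ := fun θ hθ => hΘ (hQball θ hθ)
  have hls' : ‖ls‖ ≤ S * h := hls.trans (by gcongr)
  refine ⟨hτ.exists_isLogEstimator hn hQc hQΘ (fun i => (hcont i).mono fun θ hθ => hθ.1)
    hsmall hex hlevel hsmem hls' hls0 hR, fun θ hθ => ?_⟩
  obtain ⟨hθQ, l, hl, hl0, hmin⟩ := hτ.isLogEstimator_exists_tilting hn hQΘ hsmall hex hlevel
    hsmem hls' hls0 hR hθ
  exact ⟨hQT θ hθQ, l, hl, hl0, hmin⟩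

/-- On a well-behaved sample, both estimates exist and their difference is of order
`n^{-3/2}`. -/
theorem exists_norm_sub_le {k m : ℕ} {Θ : Set (Vec k)} {θs : Vec k}
    {Γ : Vec k →L[ℝ] Vec m} {Ω : Vec m →L[ℝ] Vec m} {ρ c₀ c₁ c₂ A K κ C : ℝ}
    (hρ : 0 < ρ) (hc₀ : 0 < c₀) (hc₁ : 0 < c₁) (hc₂ : 0 < c₂) (hK : 0 < K) (hC : 0 ≤ C)
    (hΓ : ∀ v, c₁ * ‖v‖ ≤ ‖Γ v‖) (hΩ : ∀ u, c₂ * ‖u‖ ^ 2 ≤ inner ℝ (Ω u) u)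
    (hA : ∀ (v : Vec k) (u : Vec m) (q : ℝ), 0 ≤ q → ‖Γ v - Ω u‖ ≤ q →
      (∀ w, |inner ℝ u (Γ w)| ≤ q * ‖w‖) → ‖v‖ + ‖u‖ ≤ A * q)
    (hκ₁ : κ ≤ c₁ / 4) (hκ₂ : κ ≤ c₂ / 4) (hκA : A * κ ≤ 1 / 4) (hκ0 : 0 ≤ κ)
    (hKρ : K * ρ ≤ c₁ / 4) (hΘ : Metric.ball θs ρ ⊆ Θ) :
    ∃ D : ℝ, ∀ᶠ n : ℕ in atTop, ∀ (Y : Vec k → Fin n → Vec m) (a g b e : Fin n → ℝ),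
      GoodSample Y Θ θs Γ Ω ρ c₀ K κ C a g b e →
      (∃ θ, IsLogEstimator IsELWeights Θ Y θ) ∧ (∃ θ, IsLogEstimator IsETWeights Θ Y θ) ∧
      ∀ θ₁ θ₂, IsLogEstimator IsELWeights Θ Y θ₁ → IsLogEstimator IsETWeights Θ Y θ₂ →
        ‖θ₂ - θ₁‖ ≤ D * (√n)⁻¹ ^ 3 := by
  obtain ⟨T, S, hT0, hS0, hest⟩ := exists_isLogEstimator hρ hc₀ hc₁ hc₂ hK hC hΓ hΩ hκ₁ hκ₂ hKρ hΘ
  obtain ⟨R, hR0, hres⟩ := exists_bound_EL_residual (c₂ / 2) K (by positivity) hK.le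
  refine ⟨2 * A * R * S ^ 3, ?_⟩
  have hlim : Tendsto (fun n : ℕ => (√(n : ℝ))⁻¹) atTop (𝓝 0) :=
    (Real.tendsto_sqrt_atTop.comp tendsto_natCast_atTop_atTop).inv_tendsto_atTop
  have hev : ∀ (A : ℝ) {δ : ℝ}, 0 < δ → ∀ᶠ n : ℕ in atTop, A * (√(n : ℝ))⁻¹ < δ :=
    fun A δ hδ => by
      have h := hlim.const_mul A
      rw [mul_zero] at h
      exact h.eventually_lt_const hδ
  filter_upwards [hest, hev S (show (0 : ℝ) < 1 / 2 by norm_num),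
    hev (2 * K / (c₂ / 2) * S) one_pos,
    hev (A * (8 * (2 * S + T) * K)) (show (0 : ℝ) < 1 / 4 by norm_num)]
    with n hn hS1 hKS hη Y a g b e hY
  obtain ⟨hn0, hTρ, hest⟩ := hn
  obtain ⟨hsa, hpd, hest⟩ := hest Y a g b e hY
  obtain ⟨hex₁, hEL⟩ := hest (isTilting_EL m)
  obtain ⟨hex₂, hET⟩ := hest (isTilting_ET m)
  refine ⟨hex₁, hex₂, fun θ₁ θ₂ h₁ h₂ => ?_⟩
  obtain ⟨ht₁, l₁, hl₁, hm₁, hmin₁⟩ := hEL θ₁ h₁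
  obtain ⟨ht₂, l₂, hl₂, hm₂, hmin₂⟩ := hET θ₂ h₂
  have hn' : (0 : ℝ) < n := by positivity
  set h := (√(n : ℝ))⁻¹ with hh
  have hh0 : 0 < h := by positivity
  set s := S * h with hs
  set t := T * h with ht
  have hs0 : 0 < s := by positivity
  have htt : 0 ≤ t := by positivity
  have hb₁ : θ₁ ∈ Metric.ball θs ρ := mem_ball_iff_norm.2 (ht₁.trans_lt hTρ)
  have hb₂ : θ₂ ∈ Metric.ball θs ρ := mem_ball_iff_norm.2 (ht₂.trans_lt hTρ)
  have hbs : θs ∈ Metric.ball θs ρ := Metric.mem_ball_self hρ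
  have hnhds : ∀ {θ}, θ ∈ Metric.ball θs ρ → Θ ∈ 𝓝 θ := fun hθ =>
    Filter.mem_of_superset (Metric.isOpen_ball.mem_nhds hθ) hΘ
  have hlt : ∀ {θ} {l : Vec m}, θ ∈ Metric.ball θs ρ → ‖l‖ ≤ s → ∀ i, |inner ℝ l (Y θ i)| < 1 :=
    fun hθ hl i => by
      have h1 := (abs_inner_le hl (hY.norm_le i _ hθ)).trans (hsa i)
      linarith
  have hscore₁ := avg_inner_jac_eq_zero_of_EL hn0 (hnhds hb₁)
    (fun i => hY.hasStrictFDerivAt hb₁ i) (hlt hb₁ hl₁) hm₁ (half_pos hc₂) (hpd θ₁ ht₁) hmin₁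
  obtain ⟨ν, hν₁, hν₂⟩ := exists_multiplier_of_ETEL hn0 (hnhds hb₂)
    (fun i => hY.hasStrictFDerivAt hb₂ i) (hlt hb₂ hl₂) hm₂ (half_pos hc₂) (hpd θ₂ ht₂) hmin₂
  obtain ⟨hν, hF, hscore⟩ := hres hn0 (hpd θ₂ ht₂) (fun i => hY.norm_le i θ₂ hb₂)
    (fun i => hY.norm_fderiv_le i θ₂ hb₂) hY.avg_pow_four_le hs0.le (by linarith) (by linarith)
    hsa hl₂ hm₂ hν₁ hν₂
  set E := ‖θ₂ - θ₁‖ + ‖ν - l₁‖ with hE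
  have hE0 : 0 ≤ E := by positivity
  -- The ETEL residual plus the linearization and sampling errors, the latter proportional to the
  -- unknown distance `E`.
  set q := R * s ^ 3 + (8 * (2 * s + t) * K + κ) * E with hq
  have hq0 : 0 ≤ q := by positivity
  have hl₁' : ‖l₁‖ ≤ 2 * s := by linarith
  have hsa' : ∀ i, 2 * s * a i ≤ 1 / 4 := fun i => by linarith [hsa i]
  have hmom : ‖Γ (θ₂ - θ₁) - Ω (ν - l₁)‖ ≤ q := by
    have hd1 : ‖avg (fun i => (1 + inner ℝ ν (Y θ₂ i))⁻¹ • Y θ₂ i)‖ ≤ R * s ^ 3 := by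
      set F := avg (fun i => (1 + inner ℝ ν (Y θ₂ i))⁻¹ • Y θ₂ i) with hFdef
      -- Testing against `F` itself turns the directional bound into a norm bound.
      have h3 := hF F
      have h4 : (avg fun i => (1 + inner ℝ ν (Y θ₂ i))⁻¹ * inner ℝ F (Y θ₂ i)) = ‖F‖ ^ 2 := by
        rw [← real_inner_self_eq_norm_sq]
        conv_rhs => rw [hFdef, inner_avg, ← hFdef]
        simp only [inner_smul_right]
      rw [h4, abs_of_nonneg (sq_nonneg _)] at h3
      rcases (norm_nonneg F).eq_or_lt with h5 | h5
      · rw [← h5]; positivity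
      · refine le_of_mul_le_mul_right ?_ h5
        linarith
    have hd2 : ‖avg (fun i => ((1 + inner ℝ ν (Y θ₂ i))⁻¹ • Y θ₂ i
          - (1 + inner ℝ l₁ (Y θ₁ i))⁻¹ • Y θ₁ i)
        - (fderiv ℝ (fun θ => Y θ i) θs (θ₂ - θ₁) - inner ℝ (ν - l₁) (Y θs i) • Y θs i))‖
        ≤ 8 * (2 * s + t) * E * K :=
      norm_avg_le_mul (by positivity) (fun i => norm_EL_moment_sub_linear_le
        (hY.norm_le i _ hb₁) (hY.norm_le i _ hb₂) (hY.norm_le i _ hbs)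
        (hY.norm_sub_le hb₁ hb₂ i) ((hY.norm_sub_le hbs hb₂ i).trans
          (mul_le_mul_of_nonneg_left ht₂ ((norm_nonneg _).trans (hY.norm_fderiv_le i _ hbs))))
        (hY.norm_sub_sub_fderiv_le hTρ htt ht₁ ht₂ i) hl₁' hν (hsa' i) (by linarith) htt
        (hY.nonneg i) ((norm_nonneg _).trans (hY.norm_fderiv_le i _ hbs))) hY.avg_le
    rw [avg_sub, avg_sub, avg_sub, ← avg_apply, hm₁, sub_zero] at hd2
    have hd3 := (avg (fun i => fderiv ℝ (fun θ => Y θ i) θs) - Γ).le_of_opNorm_le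
      hY.norm_avg_fderiv_sub_le (θ₂ - θ₁)
    rw [sub_apply] at hd3
    have hd4 := hY.norm_avg_var_sub_le (ν - l₁)
    have hid : Γ (θ₂ - θ₁) - Ω (ν - l₁)
        = avg (fun i => (1 + inner ℝ ν (Y θ₂ i))⁻¹ • Y θ₂ i)
          - (avg (fun i => (1 + inner ℝ ν (Y θ₂ i))⁻¹ • Y θ₂ i)
            - (avg (fun i => fderiv ℝ (fun θ => Y θ i) θs) (θ₂ - θ₁)
              - avg fun i => inner ℝ (ν - l₁) (Y θs i) • Y θs i))
          - (avg (fun i => fderiv ℝ (fun θ => Y θ i) θs) (θ₂ - θ₁) - Γ (θ₂ - θ₁))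
          + (avg (fun i => inner ℝ (ν - l₁) (Y θs i) • Y θs i) - Ω (ν - l₁)) := by
      abel
    rw [hid]
    refine (norm_add_le_of_le (norm_sub_le_of_le (norm_sub_le_of_le hd1 hd2) hd3) hd4).trans
      (le_of_eq ?_)
    rw [hq, hE]
    ring
  have hsc : ∀ w, |inner ℝ (ν - l₁) (Γ w)| ≤ q * ‖w‖ := fun w => by
    have hd2 : |avg (fun i => ((1 + inner ℝ ν (Y θ₂ i))⁻¹
            * inner ℝ ν (fderiv ℝ (fun θ => Y θ i) θ₂ w)
          - (1 + inner ℝ l₁ (Y θ₁ i))⁻¹ * inner ℝ l₁ (fderiv ℝ (fun θ => Y θ i) θ₁ w))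
        - inner ℝ (ν - l₁) (fderiv ℝ (fun θ => Y θ i) θs w))|
        ≤ 8 * (2 * s + t) * E * ‖w‖ * K :=
      abs_avg_le_mul (by positivity) (fun i => abs_EL_score_sub_linear_le
        (hY.norm_le i _ hb₁) (hY.norm_le i _ hb₂) (hY.norm_sub_le hb₁ hb₂ i)
        (hY.norm_fderiv_le i _ hb₁) (hY.norm_fderiv_le i _ hb₂)
        (hY.fderiv_lipschitz i _ hb₂ _ hb₁) ((hY.fderiv_lipschitz i _ hb₂ _ hbs).trans
          (mul_le_mul_of_nonneg_left ht₂ (hY.nonneg i))) hl₁' hν (hsa' i) (by linarith) htt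
        (hY.nonneg i) w) hY.avg_le
    rw [avg_sub, avg_sub, hscore₁ w, sub_zero, ← inner_avg, ← avg_apply] at hd2
    have hd1 := hscore w
    have hd3 : |inner ℝ (ν - l₁) (avg (fun i => fderiv ℝ (fun θ => Y θ i) θs) w - Γ w)|
        ≤ κ * E * ‖w‖ := by
      have h3 := abs_inner_apply_le (le_refl ‖ν - l₁‖) hY.norm_avg_fderiv_sub_le w
      rw [sub_apply] at h3
      refine h3.trans ?_
      have : ‖ν - l₁‖ ≤ E := by rw [hE]; linarith [norm_nonneg (θ₂ - θ₁)]
      calc _ = κ * ‖ν - l₁‖ * ‖w‖ := by ring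
        _ ≤ _ := by gcongr
    rw [inner_sub_right] at hd3
    have e1 := abs_le.1 hd1
    have e2 := abs_le.1 hd2
    have e3 := abs_le.1 hd3
    have hqw : q * ‖w‖ = R * s ^ 3 * ‖w‖ + 8 * (2 * s + t) * E * ‖w‖ * K + κ * E * ‖w‖ := by
      rw [hq]; ring
    rw [hqw, abs_le]
    constructor <;> linarith
  have hfin := hA (θ₂ - θ₁) (ν - l₁) q hq0 hmom hsc
  -- One quarter comes from `A κ` and one from the linearization error, which tends to zero; so half
  -- of `E` moves to the left side.
  have hAη : A * (8 * (2 * s + t) * K + κ) ≤ 1 / 2 := by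
    have : A * (8 * (2 * s + t) * K) = A * (8 * (2 * S + T) * K) * h := by rw [hs, ht]; ring
    rw [mul_add, this]
    linarith
  have hfin2 : E ≤ A * R * s ^ 3 + E / 2 := by
    calc E ≤ A * q := hfin
      _ = A * R * s ^ 3 + A * (8 * (2 * s + t) * K + κ) * E := by rw [hq]; ring
      _ ≤ A * R * s ^ 3 + 1 / 2 * E := by gcongr
      _ = _ := by ring
  have hfin3 : ‖θ₂ - θ₁‖ ≤ E := by rw [hE]; linarith [norm_nonneg (ν - l₁)]
  calc ‖θ₂ - θ₁‖ ≤ 2 * (A * R * s ^ 3) := by linarith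
    _ = _ := by rw [hs]; ring

end GoodSample

/-! ### The population limits -/

lemma exists_mul_norm_le_of_injective {k m : ℕ} {Γ : Vec k →L[ℝ] Vec m}
    (h : Function.Injective Γ) : ∃ c : ℝ, 0 < c ∧ ∀ v, c * ‖v‖ ≤ ‖Γ v‖ := by
  obtain ⟨K, hK, hΓ⟩ := Γ.toLinearMap.exists_antilipschitzWith (LinearMap.ker_eq_bot.2 h)
  refine ⟨(K : ℝ)⁻¹, by positivity, fun v => ?_⟩
  rw [inv_mul_le_iff₀ (by exact_mod_cast hK)]
  exact hΓ.le_mul_norm (map_zero Γ) v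

lemma exists_coercive {m : ℕ} {Ω : Vec m →L[ℝ] Vec m}
    (h : ∀ u, u ≠ 0 → 0 < inner ℝ (Ω u) u) :
    ∃ c : ℝ, 0 < c ∧ ∀ u, c * ‖u‖ ^ 2 ≤ inner ℝ (Ω u) u := by
  have hpos : ∀ u ∈ Metric.sphere (0 : Vec m) 1, 0 < inner ℝ (Ω u) u := fun u hu =>
    h u (ne_zero_of_mem_unit_sphere ⟨u, hu⟩)
  obtain ⟨c, hc, hle⟩ : ∃ c : ℝ, 0 < c ∧ ∀ u ∈ Metric.sphere (0 : Vec m) 1,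
      c ≤ inner ℝ (Ω u) u := by
    rcases (Metric.sphere (0 : Vec m) 1).eq_empty_or_nonempty with he | hne
    · exact ⟨1, one_pos, by simp [he]⟩
    · obtain ⟨u, hu, hmin⟩ := (isCompact_sphere (0 : Vec m) 1).exists_isMinOn hne
        (f := fun u => inner ℝ (Ω u) u) (by fun_prop)
      exact ⟨_, hpos u hu, fun v hv => hmin hv⟩
  refine ⟨c, hc, fun u => ?_⟩
  rcases eq_or_ne u 0 with rfl | hu
  · simp
  have hu' : 0 < ‖u‖ := norm_pos_iff.2 hu
  have := hle (‖u‖⁻¹ • u) (by simp [norm_smul, hu'.ne'])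
  rw [map_smul, real_inner_smul_left, real_inner_smul_right] at this
  calc c * ‖u‖ ^ 2 ≤ ‖u‖⁻¹ * (‖u‖⁻¹ * inner ℝ (Ω u) u) * ‖u‖ ^ 2 := by gcongr
    _ = inner ℝ (Ω u) u := by field_simp

/-- The operator `u ↦ ⟨v, u⟩ v`. -/
def selfOuter {m : ℕ} (v : Vec m) : Vec m →L[ℝ] Vec m := (innerSL ℝ v).smulRight v

lemma selfOuter_apply {m : ℕ} (v u : Vec m) : selfOuter v u = inner ℝ u v • v := by
  rw [selfOuter, ContinuousLinearMap.smulRight_apply, innerSL_apply_apply, real_inner_comm]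

lemma norm_selfOuter {m : ℕ} (v : Vec m) : ‖selfOuter v‖ = ‖v‖ ^ 2 := by
  rw [selfOuter, ContinuousLinearMap.norm_smulRight_apply, innerSL_apply_norm, sq]

lemma continuous_selfOuter {m : ℕ} : Continuous (selfOuter (m := m)) := by
  have h : Continuous fun v : Vec m => (innerSL ℝ v).smulRight v :=
    ((ContinuousLinearMap.smulRightL ℝ (Vec m) (Vec m)).continuous.comp
      (innerSL ℝ).continuous).clm_apply continuous_id
  exact h

section Moments

variable {X : Type*} [MeasurableSpace X] {P : Measure X} {k m : ℕ} {f : X → Vec m}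

lemma integrable_norm_sq (h : ∀ a b, Integrable (fun z => f z a * f z b) P) :
    Integrable (fun z => ‖f z‖ ^ 2) P := by
  simp_rw [EuclideanSpace.norm_sq_eq, Real.norm_eq_abs, sq_abs, sq]
  exact integrable_finsetSum _ fun a _ => h a a

lemma integrable_selfOuter (hf : Measurable f)
    (h : ∀ a b, Integrable (fun z => f z a * f z b) P) :
    Integrable (fun z => selfOuter (f z)) P :=
  (integrable_norm_sq h).mono (continuous_selfOuter.comp_aestronglyMeasurable
    hf.aestronglyMeasurable) (.of_forall fun z => by simp [norm_selfOuter])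

lemma inner_integral_selfOuter (h : Integrable (fun z => selfOuter (f z)) P) (u : Vec m) :
    inner ℝ ((∫ z, selfOuter (f z) ∂P) u) u = ∫ z, inner ℝ u (f z) ^ 2 ∂P := by
  rw [ContinuousLinearMap.integral_apply h, real_inner_comm,
    ← integral_inner (h.apply_continuousLinearMap u)]
  refine integral_congr_ae (.of_forall fun z => ?_)
  simp only [selfOuter_apply, real_inner_smul_right, sq]

/-- If the quadratic form vanishes at `u`, then `u'f = 0` almost everywhere, so `u` lies in the
kernel of the nonsingular second moment matrix. -/
lemma inner_integral_selfOuter_pos (hf : Measurable f)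
    (h : ∀ a b, Integrable (fun z => f z a * f z b) P)
    (hdet : (Matrix.of fun a b => ∫ z, f z a * f z b ∂P : Matrix (Fin m) (Fin m) ℝ).det ≠ 0)
    {u : Vec m} (hu : u ≠ 0) : 0 < inner ℝ ((∫ z, selfOuter (f z) ∂P) u) u := by
  have hint := integrable_selfOuter hf h
  have hsq : Integrable (fun z => inner ℝ u (f z) ^ 2) P := by
    refine ((integrable_norm_sq h).const_mul (‖u‖ ^ 2)).mono (by fun_prop)
      (.of_forall fun z => ?_)
    rw [← mul_pow, norm_pow, norm_pow, norm_mul, norm_norm, norm_norm]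
    exact pow_le_pow_left₀ (norm_nonneg _) (norm_inner_le_norm _ _) 2
  rw [inner_integral_selfOuter hint]
  refine lt_of_le_of_ne (integral_nonneg fun z => sq_nonneg _) fun h0 => hu ?_
  have hae := (integral_eq_zero_iff_of_nonneg (fun z => sq_nonneg _) hsq).1 h0.symm
  have hmul : (Matrix.of fun a b => ∫ z, f z a * f z b ∂P : Matrix (Fin m) (Fin m) ℝ).mulVec
      (fun b => u b) = 0 := by
    ext a
    simp only [Matrix.mulVec, dotProduct, Matrix.of_apply, Pi.zero_apply]
    simp_rw [← integral_mul_const]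
    rw [← integral_finsetSum _ fun b _ => (h a b).mul_const _]
    refine integral_eq_zero_of_ae ?_
    filter_upwards [hae] with z hz
    have hz : inner ℝ u (f z) = 0 := by simpa using hz
    rw [PiLp.inner_apply] at hz
    simp_rw [mul_assoc]
    rw [← Finset.mul_sum]
    simp only [RCLike.inner_apply, conj_trivial] at hz
    rw [hz, mul_zero, Pi.zero_apply]
  have := Matrix.eq_zero_of_mulVec_eq_zero hdet hmul
  ext a
  exact congrFun this a

end Moments

/-! ### Rates of sample averages -/

lemma norm_le_sum_abs {m : ℕ} (v : Vec m) : ‖v‖ ≤ ∑ a, |v a| := by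
  rw [EuclideanSpace.norm_eq]
  refine Real.sqrt_le_iff.2 ⟨by positivity, ?_⟩
  simpa only [Real.norm_eq_abs] using
    Finset.sum_sq_le_sq_sum_of_nonneg (s := Finset.univ) (f := fun a => |v a|)
      fun a _ => abs_nonneg _

section Sample

variable {S X : Type*} [MeasurableSpace S] [MeasurableSpace X] {μ : Measure S}
  [IsProbabilityMeasure μ] {P : Measure X} {x : ℕ → S → X}

/-- Chebyshev in each coordinate and a union bound; the share `ε / (m + 1)` also makes sense for `m
= 0`. -/
lemma exists_measure_lt_norm_avg_le (x_indep : iIndepFun x μ) (x_law : ∀ i, HasLaw (x i) P μ)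
    {m : ℕ} {f : X → Vec m} (hf : Measurable f)
    (h : ∀ a b, Integrable (fun z => f z a * f z b) P) (hf0 : ∫ z, f z ∂P = 0)
    {ε : ℝ} (hε : 0 < ε) :
    ∃ C : ℝ, 0 ≤ C ∧ ∀ n : ℕ,
      μ {s | C * (√n)⁻¹ < ‖avg fun i : Fin n => f (x i s)‖} ≤ ENNReal.ofReal ε := by
  have : IsProbabilityMeasure P := (x_law 0).isProbabilityMeasure_iff.1 inferInstance
  have hcoord : ∀ a, Measurable fun z => f z a := fun a => by fun_prop
  have hmem : ∀ a, MemLp (fun z => f z a) 2 P := fun a =>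
    (memLp_two_iff_integrable_sq (hcoord a).aestronglyMeasurable).2
      (by simpa only [sq] using h a a)
  have hint : Integrable f P := by
    refine Integrable.mono' (g := fun z => 1 + ‖f z‖ ^ 2)
      ((integrable_const 1).add (integrable_norm_sq h)) hf.aestronglyMeasurable
      (.of_forall fun z => ?_)
    nlinarith [sq_nonneg (‖f z‖ - 1), sq_nonneg ‖f z‖]
  have hzero : ∀ a, ∫ z, f z a ∂P = 0 := fun a => by
    have := (EuclideanSpace.proj (𝕜 := ℝ) a).integral_comp_comm hint
    rw [hf0, map_zero] at this
    exact this
  choose C hC0 hC using fun a => exists_measure_lt_abs_avg_le x_indep x_law (hmem a) (hzero a)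
    (show 0 < ε / (m + 1) by positivity)
  refine ⟨∑ a, C a, Finset.sum_nonneg fun a _ => (hC0 a).le, fun n => ?_⟩
  calc μ {s | (∑ a, C a) * (√n)⁻¹ < ‖avg fun i : Fin n => f (x i s)‖}
      ≤ μ (⋃ a, {s | C a / √n < |avg fun i : Fin n => f (x i s) a|}) := by
        refine measure_mono fun s hs => ?_
        rw [Set.mem_ofPred_eq, Finset.sum_mul] at hs
        obtain ⟨a, -, ha⟩ := Finset.exists_lt_of_sum_lt (hs.trans_le (norm_le_sum_abs _))
        refine Set.mem_iUnion.2 ⟨a, ?_⟩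
        rw [Set.mem_ofPred_eq, div_eq_mul_inv]
        have := map_avg (EuclideanSpace.proj (𝕜 := ℝ) a) fun i : Fin n => f (x i s)
        exact ha.trans_eq (congrArg abs this)
    _ ≤ ∑ a, μ {s | C a / √n < |avg fun i : Fin n => f (x i s) a|} := measure_iUnion_fintype_le _ _
    _ ≤ ∑ _a : Fin m, ENNReal.ofReal (ε / (m + 1)) := Finset.sum_le_sum fun a _ => hC a n
    _ = ENNReal.ofReal (m * (ε / (m + 1))) := by
        rw [Finset.sum_const, Finset.card_univ, Fintype.card_fin, nsmul_eq_mul,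
          ENNReal.ofReal_mul (by positivity), ENNReal.ofReal_natCast]
    _ ≤ ENNReal.ofReal ε := by
        refine ENNReal.ofReal_le_ofReal ?_
        rw [mul_div_assoc', div_le_iff₀ (by positivity)]
        nlinarith

lemma holdsWPA_avg_le (x_indep : iIndepFun x μ) (x_law : ∀ i, HasLaw (x i) P μ) {f : X → ℝ}
    (hf : Integrable f P) {K : ℝ} (hK : ∫ z, f z ∂P < K) :
    HoldsWPA μ fun n s => avg (fun i : Fin n => f (x i s)) ≤ K :=
  (holdsWPA_norm_avg_sub_integral_lt x_indep x_law hf (sub_pos.2 hK)).mono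
    (.of_forall fun n => .of_forall fun s hs => by
      rw [Real.norm_eq_abs] at hs
      linarith [(abs_lt.1 hs).2])

end Sample

/-! ### Good samples are typical -/

section Typical

variable {S X : Type*} [MeasurableSpace S] [MeasurableSpace X] {μ : Measure S}
  [IsProbabilityMeasure μ] {P : Measure X} {x : ℕ → S → X} {k m : ℕ} {g : X → Vec k → Vec m}
  {Θ : Set (Vec k)} {θs : Vec k}

lemma injective_of_finrank_range_eq {Γ : Vec k →L[ℝ] Vec m}
    (h : Module.finrank ℝ (LinearMap.range Γ.toLinearMap) = k) : Function.Injective Γ := by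
  have := Γ.toLinearMap.finrank_range_add_finrank_ker
  rw [h, finrank_euclideanSpace, Fintype.card_fin] at this
  exact LinearMap.ker_eq_bot.1 (Submodule.finrank_eq_zero.1 (by omega))

/-- The Bochner integral of a non-integrable function is zero by convention, and zero has rank `0 ≠
k`. -/
lemma integrable_jac_of_finrank_range_eq (hk : k ≠ 0)
    (h : Module.finrank ℝ (LinearMap.range (meanJac P g θs).toLinearMap) = k) :
    Integrable (fun z => jac g z θs) P := by
  by_contra hcon
  rw [meanJac, integral_undef hcon] at h
  refine hk (h.symm.trans ?_)
  rw [ContinuousLinearMap.toLinearMap_zero, LinearMap.range_zero, finrank_bot]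

/-- The rate at `θs` is left as a premise inside the event: for a fixed `C` it holds with
probability near one, not tending to one, and `C` depends on `ε`. -/
lemma holdsWPA_goodSample (x_indep : iIndepFun x μ) (x_law : ∀ i, HasLaw (x i) P μ)
    {ρ c₀ K κ : ℝ} (hκ : 0 < κ) {a l b e : X → ℝ}
    (hdiff : ∀ᵐ z ∂P, ContDiffOn ℝ 1 (g z) (Metric.ball θs ρ))
    (ha : ∀ᵐ z ∂P, ∀ θ ∈ Metric.ball θs ρ, ‖g z θ‖ ≤ a z)
    (hl : ∀ᵐ z ∂P, ∀ θ ∈ Metric.ball θs ρ, ‖jac g z θ‖ ≤ l z)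
    (hb : ∀ᵐ z ∂P, ∀ θ₁ ∈ Metric.ball θs ρ, ∀ θ₂ ∈ Metric.ball θs ρ,
      ‖jac g z θ₁ - jac g z θ₂‖ ≤ b z * ‖θ₁ - θ₂‖)
    (hb0 : ∀ z, 0 ≤ b z) (hint : Integrable (fun z => 1 + a z ^ 4 + l z ^ 2 + b z) P)
    (hK : ∫ z, (1 + a z ^ 4 + l z ^ 2 + b z) ∂P < K)
    (he : ∀ᵐ z ∂P, ∀ θ ∈ Θ, ‖g z θ‖ ≤ e z) (heint : Integrable (fun z => e z ^ 2) P)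
    (hKe : ∫ z, e z ^ 2 ∂P < K)
    (hsep : HoldsWPA μ fun n s => ∀ θ ∈ Θ \ Metric.ball θs (ρ / 2),
      c₀ ≤ ‖avg fun i : Fin n => g (x i s) θ‖)
    (hjac : Integrable (fun z => jac g z θs) P)
    (hvar : Integrable (fun z => selfOuter (g z θs)) P) :
    HoldsWPA μ fun n s => ∀ C : ℝ, ‖avg fun i : Fin n => g (x i s) θs‖ ≤ C * (√n)⁻¹ →
      GoodSample (n := n) (fun θ i => g (x i s) θ) Θ θs (meanJac P g θs)
        (∫ z, selfOuter (g z θs) ∂P) ρ c₀ K κ C (fun i => a (x i s)) (fun i => l (x i s))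
        (fun i => b (x i s)) (fun i => e (x i s)) := by
  refine ((((holdsWPA_avg_le x_indep x_law hint hK).and
    (holdsWPA_avg_le x_indep x_law heint hKe)).and hsep).and
    ((holdsWPA_norm_avg_sub_integral_lt x_indep x_law hjac hκ).and
      (holdsWPA_norm_avg_sub_integral_lt x_indep x_law hvar hκ))).mono (.of_forall fun n => ?_)
  filter_upwards [ae_forall_sample x_law hdiff, ae_forall_sample x_law ha,
    ae_forall_sample x_law hl, ae_forall_sample x_law hb, ae_forall_sample x_law he]
    with s hdiff ha hl hb he
  rintro ⟨⟨⟨h1, h2⟩, h3⟩, h4, h5⟩ C hC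
  exact
    { contDiffOn := fun i => hdiff i
      norm_le := fun i => ha i
      norm_fderiv_le := fun i => hl i
      fderiv_lipschitz := fun i => hb i
      nonneg := fun i => hb0 _
      avg_le := h1
      norm_le_envelope := fun i => he i
      avg_envelope_le := h2
      separated := fun θ hθ hθs => h3 θ ⟨hθ, by
        rwa [Metric.mem_ball, dist_eq_norm, not_lt]⟩
      norm_avg_le := hC
      norm_avg_fderiv_sub_le := h4.le
      norm_avg_var_sub_le := fun u => by
        have := (ContinuousLinearMap.le_of_opNorm_le _ h5.le u)
        rwa [sub_apply, avg_apply, funext fun i : Fin n => selfOuter_apply _ u] at this }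

end Typical

end

/-! ### Choice of constants and proof of the theorem -/

theorem theorem5 {S X : Type*} [MeasurableSpace S] [MeasurableSpace X] [StandardBorelSpace X]
    {k m : ℕ}
    -- an i.i.d. sequence `x 0, x 1, …` with law `P`
    (μ : Measure S) [IsProbabilityMeasure μ] (P : Measure X) (x : ℕ → S → X)
    (x_indep : iIndepFun x μ) (x_law : ∀ i, HasLaw (x i) P μ)
    -- the moment function and the regularity conditions
    (g : X → Vec k → Vec m) (Θ N : Set (Vec k)) (θs : Vec k)
    (hreg : Regular P g Θ N θs)
    (hg4 : ∫⁻ z, ⨆ θ ∈ N, ‖g z θ‖ₑ ^ 4 ∂P < ∞)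
    (hG2 : ∫⁻ z, ⨆ θ ∈ N, ‖jac g z θ‖ₑ ^ 2 ∂P < ∞)
    (b : X → ℝ) (hb : Integrable b P)
    (hLip : ∀ᵐ z ∂P, ∀ θ₁ ∈ N, ∀ θ₂ ∈ N, ‖jac g z θ₁ - jac g z θ₂‖ ≤ b z * ‖θ₁ - θ₂‖)
    -- the two estimators, which are only constrained on samples for which they exist
    (θEL θETEL : ℕ → S → Vec k)
    (hEL_est : ∀ n, ∀ᵐ s ∂μ, (∃ θ, IsELEstimate g Θ n (fun i => x i s) θ) →
      IsELEstimate g Θ n (fun i => x i s) (θEL n s))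
    (hETEL_est : ∀ n, ∀ᵐ s ∂μ, (∃ θ, IsETELEstimate g Θ n (fun i => x i s) θ) →
      IsETELEstimate g Θ n (fun i => x i s) (θETEL n s)) :
    IsBigOInProbability μ (fun n s => θETEL n s - θEL n s)
      (fun n => (n : ℝ) ^ (-(3 / 2) : ℝ)) := by
  intro ε hε
  -- For `k = 0` the rank condition no longer forces integrability of the Jacobian, but all
  -- parameters coincide.
  rcases eq_or_ne k 0 with rfl | hk
  · refine ⟨0, .of_forall fun n => ?_⟩
    simp [Subsingleton.elim (_ : Vec 0) 0]
  have : IsProbabilityMeasure P := (x_law 0).isProbabilityMeasure_iff.1 inferInstance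
  have hgm : Measurable fun z => g z θs :=
    hreg.measurable.comp (measurable_id.prodMk measurable_const)
  have hΘm : MeasurableSet Θ := hreg.isCompact.isClosed.measurableSet
  have hjac : Integrable (fun z => jac g z θs) P :=
    integrable_jac_of_finrank_range_eq hk hreg.rank_eq
  have hvar := integrable_selfOuter hgm hreg.finite_var
  obtain ⟨c₁, hc₁, hΓ⟩ := exists_mul_norm_le_of_injective
    (injective_of_finrank_range_eq hreg.rank_eq)
  obtain ⟨c₂, hc₂, hΩ⟩ := exists_coercive fun u hu =>
    inner_integral_selfOuter_pos hgm hreg.finite_var hreg.nonsingular hu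
  obtain ⟨A, hA0, hA⟩ := exists_bound_of_linearized hc₁ hc₂ hΓ hΩ
  obtain ⟨ρ₀, hρ₀, hball⟩ := Metric.isOpen_iff.1 (hreg.isOpen.inter isOpen_interior) θs
    ⟨hreg.mem_nhd, hreg.mem_interior⟩
  have hballN : Metric.ball θs ρ₀ ⊆ N := hball.trans Set.inter_subset_left
  obtain ⟨δ, hδ, hmom⟩ := hreg.moment_bound
  obtain ⟨e, he0, heint, he⟩ := exists_sq_integrable_envelope hreg.measurable hΘm hδ hmom
  obtain ⟨a, ha0, haint, ha⟩ :=
    exists_pow_four_integrable_envelope hreg.measurable hreg.isOpen.measurableSet hg4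
  obtain ⟨l, hl0, hlint, hl⟩ :=
    exists_jac_envelope hreg.measurable hreg.isOpen hreg.contDiff hG2 hballN
  have hint : Integrable (fun z => 1 + a z ^ 4 + l z ^ 2 + |b z|) P :=
    (((integrable_const 1).add haint).add hlint).add hb.abs
  obtain ⟨K, hK⟩ := exists_gt (max (∫ z, (1 + a z ^ 4 + l z ^ 2 + |b z|) ∂P)
    (max (∫ z, e z ^ 2 ∂P) 0))
  obtain ⟨hK1, hK2, hK0⟩ : _ ∧ _ ∧ _ := by simpa only [max_lt_iff] using hK
  -- The envelopes, and with them `K`, are fixed on the ball of radius `ρ₀`. Shrinking the radius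
  -- afterwards is not circular because they remain valid on smaller balls.
  let ρ := min ρ₀ (c₁ / (4 * K))
  have hρ : 0 < ρ := by positivity
  have hsub : Metric.ball θs ρ ⊆ Metric.ball θs ρ₀ := Metric.ball_subset_ball (min_le_left _ _)
  have hKρ : K * ρ ≤ c₁ / 4 := by
    calc K * ρ ≤ K * (c₁ / (4 * K)) := by gcongr; exact min_le_right _ _
      _ = c₁ / 4 := by field_simp
  let κ := min (min (c₁ / 4) (c₂ / 4)) (1 / (4 * A))
  have hκ : 0 < κ := by positivity
  have hκA : A * κ ≤ 1 / 4 := by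
    calc A * κ ≤ A * (1 / (4 * A)) := by gcongr; exact min_le_right _ _
      _ = 1 / 4 := by field_simp
  have heint' : Integrable e P := by
    have hm : AEStronglyMeasurable e P := by
      -- Measurability of `e` is recovered from that of `e ^ 2`, as `e` is nonnegative.
      have h := heint.aestronglyMeasurable.aemeasurable.sqrt.aestronglyMeasurable
      simpa only [Real.sqrt_sq (he0 _)] using h
    refine ((integrable_const 1).add heint).mono' hm (.of_forall fun z => ?_)
    rw [Real.norm_eq_abs, abs_of_nonneg (he0 z)]
    change e z ≤ 1 + e z ^ 2
    nlinarith [sq_nonneg (e z - 1)]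
  obtain ⟨c₀, hc₀, hsep⟩ := exists_holdsWPA_le_norm_avg_of_isCompact x_indep x_law
    hreg.measurable hΘm heint' he hreg.continuous
    (hreg.isCompact.diff (Metric.isOpen_ball (x := θs) (ε := ρ / 2))) Set.sdiff_subset
    (fun θ hθ h0 => hθ.2 (by
      rw [hreg.unique θ hθ.1 h0]
      exact Metric.mem_ball_self (half_pos hρ)))
  have hgood := holdsWPA_goodSample (b := fun z => |b z|) x_indep x_law hκ
    (hreg.contDiff.mono fun z hz => hz.mono (hsub.trans hballN))
    (ha.mono fun z hz θ hθ => hz θ (hballN (hsub hθ)))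
    (hl.mono fun z hz θ hθ => hz θ (hsub hθ))
    (hLip.mono fun z hz θ₁ h₁ θ₂ h₂ => (hz θ₁ (hballN (hsub h₁)) θ₂ (hballN (hsub h₂))).trans
      (by gcongr; exact le_abs_self _))
    (fun z => abs_nonneg _) hint hK1 he heint hK2 hsep hjac hvar
  obtain ⟨C, hC0, hC⟩ := exists_measure_lt_norm_avg_le x_indep x_law hgm hreg.finite_var
    hreg.moment_eq_zero (half_pos hε)
  obtain ⟨D, hD⟩ := GoodSample.exists_norm_sub_le hρ hc₀ hc₁ hc₂ hK0 hC0 hΓ hΩ hA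
    ((min_le_left _ _).trans (min_le_left _ _)) ((min_le_left _ _).trans (min_le_right _ _))
    hκA hκ.le hKρ
    ((hsub.trans hball).trans (Set.inter_subset_right.trans interior_subset))
  refine ⟨D, ?_⟩
  filter_upwards [hD, hgood.eventually_measure_le (half_pos hε)] with n hn hmeas
  have hpow : (n : ℝ) ^ (-(3 / 2) : ℝ) = (√n)⁻¹ ^ 3 := by
    rw [Real.sqrt_eq_rpow, ← Real.rpow_neg n.cast_nonneg, ← Real.rpow_natCast,
      ← Real.rpow_mul n.cast_nonneg]
    norm_num
  -- The estimators need not be measurable, so the event is covered, up to a null set, by two events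
  -- of outer measure at most `ε / 2` each: a bad sample, or a large average moment at `θs`.
  refine (measure_mono_ae (t := {s | ¬ ∀ C : ℝ, ‖avg fun i : Fin n => g (x i s) θs‖ ≤ C * (√n)⁻¹ →
      GoodSample (n := n) (fun θ i => g (x i s) θ) Θ θs (meanJac P g θs)
        (∫ z, selfOuter (g z θs) ∂P) ρ c₀ K κ C (fun i => a (x i s)) (fun i => l (x i s))
        (fun i => |b (x i s)|) (fun i => e (x i s))} ∪
      {s | C * (√n)⁻¹ < ‖avg fun i : Fin n => g (x i s) θs‖}) ?_).trans
    ((measure_union_le _ _).trans ((add_le_add hmeas (hC n)).trans_eq ?_))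
  · filter_upwards [hEL_est n, hETEL_est n] with s hEL hETEL hs
    by_contra hcon
    obtain ⟨h1, h2⟩ := not_or.1 hcon
    obtain ⟨hex₁, hex₂, hle⟩ := hn _ _ _ _ _ (not_not.1 h1 C (not_lt.1 h2))
    refine absurd (hle _ _ (hEL hex₁) (hETEL hex₂)) (not_le.2 ?_)
    rw [← hpow]
    exact hs
  · rw [← ENNReal.ofReal_add (by positivity) (by positivity), add_halves]
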